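/- **Setting.** A *pseudo-composition* of $n$ is a sequence $\alpha=(\alpha_1,\ldots,\alpha_\ell)$, $\ell\ge1$, of integers with $\alpha_1\ge0$, $\alpha_2,\ldots,\alpha_\ell>0$ and size $|\alpha|=\alpha_1+\cdots+\alpha_\ell=n$; put $\ell(\alpha)=\ell$ and $D(\alpha)=\{\alpha_1,\alpha_1+\alpha_2,\ldots,\alpha_1+\cdots+\alpha_{\ell-1}\}$, and write $\alpha\preccurlyeq\beta$ if $|\alpha|=|\beta|$ and $D(\alpha)\subseteq D(\beta)$. It is a *pseudo-partition* if $\alpha_2\ge\cdots\ge\alpha_\ell$; let $\lambda^B(\alpha)$ be the pseudo-partition obtained from $\alpha$ by rearranging $\alpha_2,\ldots,\alpha_\ell$. Let $\mathbf x_i$ ($i\in\mathbb Z$) be noncommuting and $x_0,x_1,x_2,\ldots$ commuting variables. Put $$\mathbf h_k=\sum_{i_1\le\cdots\le i_k}\mathbf x_{i_1}\cdots\mathbf x_{i_k},\qquad \mathbf h^B_k=\sum_{0\le i_1\le\cdots\le i_k}\mathbf x_{i_1}\cdots\mathbf x_{i_k},$$ $\mathbf h_\alpha=\mathbf h_{\alpha_1}\cdots\mathbf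 h_{\alpha_\ell}$ for a composition $\alpha$ (a possibly empty sequence of positive integers), $\mathbf h^B_\alpha=\mathbf h^B_{\alpha_1}\mathbf h_{\alpha_2}\cdots\mathbf h_{\alpha_\ell}$ and $\mathbf s^B_\alpha=\sum_{\beta\preccurlyeq\alpha}(-1)^{\ell(\alpha)-\ell(\beta)}\mathbf h^B_\beta$ for a pseudo-composition $\alpha$. Let $\mathrm{NSym}$ be the $\mathbb Z$-span of all $\mathbf h_\alpha$ and $\mathrm{NSym}^B$ the $\mathbb Z$-span of all $\mathbf h^B_\alpha$. Let $\chi$ be the substitution $\mathbf x_i\mapsto x_i$ for $i>0$, $\mathbf x_i\mapsto0$ for $i\le0$, and $\chi^B$ the substitution $\mathbf x_i\mapsto x_{|i|}$ for all $i$. Put $\mathrm{Sym}=\chi(\mathrm{NSym})$, $\mathrm{Sym}^B=\chi^B(\mathrm{NSym}^B)$, $h^B_\alpha=\chi^B(\mathbf h^B_\alpha)$, $s^B_\alpha=\chi^B(\mathbf s^B_\alpha)$. Put $M^B_\alpha=\sum_{0<i_2<\cdots<i_\ell}x_0^{\alpha_1}x_{i_2}^{\alpha_2}\cdots x_{i_\ell}^{\alpha_\ell}$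 and, for a pseudo-partition $\lambda$, $m^B_\lambda=\sum_{\lambda^B(\alpha)=\lambda}M^B_\alpha$. For a field $\mathbb K$ of characteristic zero and a $\mathbb Z$-module $U$ of power series with integer coefficients let $U_{\mathbb K}$ be the image of $\mathbb K\otimes_{\mathbb Z}U$ in the power series over $\mathbb K$. Let $\mathfrak S^B_n$ be the group of signed permutations $w$ of $\{\pm1,\ldots,\pm n\}$, with $w(0)=0$ and $D(w)=\{i\in\{0,\ldots,n-1\}:w(i)>w(i+1)\}$. **Statement.** 1. If $\lambda$ is a pseudo-partition, then $h^B_\lambda:=h^B_\alpha$ does not depend on the choice of a pseudo-composition $\alpha$ with $\lambda^B(\alpha)=\lambda$, and $\{h^B_\lambda\}$, with $\lambda$ running through all pseudo-partitions, is a free $\mathbb Z$-basis of $\mathrm{Sym}^B$. 2. $\mathrm{Sym}^B\subsetneq\mathbb Z[x_0]\cdot\mathrm{Sym}$, and multiplication $p\otimes f\mapsto p(x_0)f$ is an isomorphism $\mathbb Z[x_0]\otimes_{\mathbb Z}\mathrm{Sym}\cong\mathbb Z[x_0]\cdot\mathrm{Sym}$. 3. Let $\mathbb K$ be a field of characteristic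 zero. Then $\mathbb K\otimes_{\mathbb Z}\mathrm{Sym}^B\to\mathrm{Sym}^B_{\mathbb K}$ and $\mathbb K\otimes_{\mathbb Z}\mathrm{Sym}\to\mathrm{Sym}_{\mathbb K}$ are isomorphisms, $\mathrm{Sym}^B_{\mathbb K}=\mathbb K[x_0]\cdot\mathrm{Sym}_{\mathbb K}$, and multiplication is an isomorphism $\mathbb K[x_0]\otimes_{\mathbb K}\mathrm{Sym}_{\mathbb K}\cong\mathbb K[x_0]\cdot\mathrm{Sym}_{\mathbb K}$. 4. Let $\mathbb K$ be a field of characteristic zero. There is a unique $\mathbb K$-bilinear form on $\mathrm{Sym}^B_{\mathbb K}$ such that $\langle s^B_\alpha,s^B_\beta\rangle=\#\{w\in\mathfrak S^B_n:D(w^{-1})=D(\alpha),\ D(w)=D(\beta)\}$ if $|\alpha|=|\beta|=n$ and $\langle s^B_\alpha,s^B_\beta\rangle=0$ if $|\alpha|\ne|\beta|$. It is symmetric and nondegenerate, and with respect to it $\{h^B_\lambda\}$ and $\{m^B_\lambda\}$ are dual $\mathbb K$-bases of $\mathrm{Sym}^B_{\mathbb K}$: $\langle h^B_\lambda,m^B_\mu\rangle=\delta_{\lambda,\mu}$.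 -/

import Mathlib

open scoped TensorProduct

noncomputable section

namespace TypeB

/-! ### Pseudo-compositions and pseudo-partitions -/

/-- A composition: a (possibly empty) finite sequence of positive integers. -/
abbrev Comp : Type := {α : List ℕ // ∀ a ∈ α, 0 < a}

/-- A pseudo-composition `(α₁, α₂, …, α_ℓ)` with `ℓ ≥ 1`, `α₁ = head ≥ 0` and
`(α₂, …, α_ℓ) = tail` a sequence of positive integers. -/
@[ext]
structure PseudoComp : Type where
  head : ℕ
  tail : List ℕ
  tail_pos : ∀ a ∈ tail, 0 < a

namespace PseudoComp

/-- The size `|α| = α₁ + ⋯ + α_ℓ`. -/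
def size (α : PseudoComp) : ℕ := α.head + α.tail.sum

/-- The length `ℓ(α)`. -/
def length (α : PseudoComp) : ℕ := α.tail.length + 1

/-- The descent set `D(α) = {α₁, α₁ + α₂, …, α₁ + ⋯ + α_{ℓ-1}}`. -/
def descents (α : PseudoComp) : Finset ℕ :=
  (Finset.range α.tail.length).image fun i => α.head + (α.tail.take i).sum

/-- `α ≼ β`: the sizes agree and `D(α) ⊆ D(β)`. -/
def Coarser (α β : PseudoComp) : Prop := α.size = β.size ∧ α.descents ⊆ β.descents

end PseudoComp

/-- A pseudo-partition: a pseudo-composition with `λ₂ ≥ ⋯ ≥ λ_ℓ (≥ 1)`. -/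
abbrev PseudoPart : Type := {l : PseudoComp // l.tail.Pairwise (· ≥ ·)}

/-- The pseudo-partition `λᴮ(α)`: keep `α₁`, rearrange `α₂, …, α_ℓ` weakly decreasingly. -/
def PseudoComp.toPart (α : PseudoComp) : PseudoPart :=
  ⟨⟨α.head, α.tail.insertionSort (· ≥ ·),
    fun a ha => α.tail_pos a ((List.mem_insertionSort (· ≥ ·)).1 ha)⟩,
    List.pairwise_insertionSort (· ≥ ·) α.tail⟩

/-! ### Power series in noncommuting variables `𝐱ᵢ`, `i ∈ ℤ` -/

/-- Formal power series over `ℤ` in noncommuting variables `𝐱ᵢ` (`i ∈ ℤ`): `f w` is the coefficient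
of the word `𝐱_{w₁} 𝐱_{w₂} ⋯`.  The product of two series is `ncMul`, not the pointwise one. -/
abbrev NCSeries : Type := List ℤ → ℤ

/-- The product (concatenation of words, extended bilinearly) of noncommutative series. -/
def ncMul (f g : NCSeries) : NCSeries := fun w =>
  ∑ i ∈ Finset.range (w.length + 1), f (w.take i) * g (w.drop i)

/-- The unit series (the empty word). -/
def ncOne : NCSeries := fun w => if w = [] then 1 else 0

/-- `𝐡_k = ∑_{i₁ ≤ ⋯ ≤ i_k} 𝐱_{i₁} ⋯ 𝐱_{i_k}`, the indices running through `ℤ`. -/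
def ncH (k : ℕ) : NCSeries := fun w =>
  if w.length = k ∧ w.Pairwise (· ≤ ·) then 1 else 0

/-- `𝐡ᴮ_k = ∑_{0 ≤ i₁ ≤ ⋯ ≤ i_k} 𝐱_{i₁} ⋯ 𝐱_{i_k}`. -/
def ncHB (k : ℕ) : NCSeries := fun w =>
  if w.length = k ∧ w.Pairwise (· ≤ ·) ∧ ∀ a ∈ w, 0 ≤ a then 1 else 0

/-- `𝐡_α = 𝐡_{α₁} ⋯ 𝐡_{α_ℓ}` for a composition `α`. -/
def ncHComp (α : Comp) : NCSeries := (α.1.map ncH).foldl ncMul ncOne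

/-- `𝐡ᴮ_α = 𝐡ᴮ_{α₁} · 𝐡_{α₂} ⋯ 𝐡_{α_ℓ}` for a pseudo-composition `α`. -/
def ncHBComp (α : PseudoComp) : NCSeries := (α.tail.map ncH).foldl ncMul (ncHB α.head)

/-- `𝐬ᴮ_α = ∑_{β ≼ α} (-1)^{ℓ(α) - ℓ(β)} 𝐡ᴮ_β`, i.e. the solution of `𝐡ᴮ_α = ∑_{β ≼ α} 𝐬ᴮ_β`
(the sum is finite). -/
def ncSBComp (α : PseudoComp) : NCSeries :=
  ∑ᶠ β ∈ {β : PseudoComp | β.Coarser α}, (-1 : ℤ) ^ (α.length - β.length) • ncHBComp β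

/-- `NSym`: noncommutative symmetric functions, the `ℤ`-span of all `𝐡_α`. -/
def NSym : Submodule ℤ NCSeries := Submodule.span ℤ (Set.range ncHComp)

/-- `NSymᴮ`: noncommutative symmetric functions of type B, the `ℤ`-span of all `𝐡ᴮ_α`. -/
def NSymB : Submodule ℤ NCSeries := Submodule.span ℤ (Set.range ncHBComp)

theorem ncSBComp_mem (α : PseudoComp) : ncSBComp α ∈ NSymB :=
  finsum_mem_induction (· ∈ NSymB) (Submodule.zero_mem _)
    (fun _ _ hx hy => Submodule.add_mem _ hx hy)
    (fun β _ => Submodule.smul_mem _ _ (Submodule.subset_span ⟨β, rfl⟩))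

/-! ### Passage to commuting variables `x₀, x₁, x₂, …` -/

/-- The commutative monomial `x_{|w₁|} x_{|w₂|} ⋯` of a word `w`, as an exponent vector. -/
def content (w : List ℤ) : ℕ →₀ ℕ := Multiset.toFinsupp (w.map Int.natAbs : Multiset ℕ)

/-- Words with letters in `L` and commutative monomial `m`. -/
def words (L : Set ℤ) (m : ℕ →₀ ℕ) : Set (List ℤ) := {w | (∀ a ∈ w, a ∈ L) ∧ content w = m}

theorem words_finite (L : Set ℤ) (m : ℕ →₀ ℕ) : (words L m).Finite := by
  set N : ℕ := (Finsupp.toMultiset m).sum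
  set T : Set ℤ := {a : ℤ | a.natAbs ≤ N}
  have hT : T.Finite := (Set.finite_Icc (-(N : ℤ)) N).subset fun a (ha : a.natAbs ≤ N) => by
    constructor <;> omega
  have := hT.to_subtype
  refine ((List.finite_length_eq T (Multiset.card (Finsupp.toMultiset m))).image
    (List.map Subtype.val)).subset ?_
  rintro w ⟨-, hw⟩
  have hw' : (w.map Int.natAbs : Multiset ℕ) = Finsupp.toMultiset m := by
    rw [← hw, content, Multiset.toFinsupp_toMultiset]
  have hmem : ∀ a ∈ w, a ∈ T := fun a ha => by
    have h1 : a.natAbs ∈ Finsupp.toMultiset m := by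
      rw [← hw']
      exact Multiset.mem_coe.2 (List.mem_map_of_mem ha)
    exact Multiset.le_sum_of_mem h1
  refine ⟨w.attach.map fun a => ⟨a.1, hmem a.1 a.2⟩, ?_, ?_⟩
  · rw [← hw']
    simp
  · simp

/-- The substitution `𝐱ᵢ ↦ x_{|i|}` for `i ∈ L` and `𝐱ᵢ ↦ 0` for `i ∉ L`, on series in noncommuting
variables (each commutative monomial is the image of finitely many words). -/
def commutize (L : Set ℤ) : NCSeries →ₗ[ℤ] MvPowerSeries ℕ ℤ where
  toFun f := fun m => ∑ᶠ w ∈ words L m, f w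
  map_add' f g := by
    funext m
    exact finsum_mem_add_distrib (words_finite L m)
  map_smul' c f := by
    funext m
    exact (smul_finsum_mem (r := c) (f := f) (words_finite L m)).symm

/-- `χ`: replace `𝐗` by the commuting variables `X_{>0} = {x₁, x₂, …}`. -/
def chi : NCSeries →ₗ[ℤ] MvPowerSeries ℕ ℤ := commutize (Set.Ioi 0)

/-- `χᴮ`: the substitution `𝐱ᵢ ↦ x_{|i|}` for all `i ∈ ℤ`. -/
def chiB : NCSeries →ₗ[ℤ] MvPowerSeries ℕ ℤ := commutize Set.univ

/-- `Sym = χ(NSym)`: symmetric functions over `ℤ` in `x₁, x₂, …` (Mathlib uses the name `Sym` for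
symmetric powers). -/
def SymF : Submodule ℤ (MvPowerSeries ℕ ℤ) := NSym.map chi

/-- `Symᴮ = χᴮ(NSymᴮ)`: symmetric functions of type B over `ℤ`. -/
def SymB : Submodule ℤ (MvPowerSeries ℕ ℤ) := NSymB.map chiB

/-- `hᴮ_α = χᴮ(𝐡ᴮ_α)`. -/
def hB (α : PseudoComp) : MvPowerSeries ℕ ℤ := chiB (ncHBComp α)

/-- `sᴮ_α = χᴮ(𝐬ᴮ_α)`, as an element of `Symᴮ`. -/
def sB (α : PseudoComp) : SymB := ⟨chiB (ncSBComp α), Submodule.mem_map_of_mem (ncSBComp_mem α)⟩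

/-- The monomial quasisymmetric function of type B,
`Mᴮ_α = ∑_{0 < i₂ < ⋯ < i_ℓ} x₀^{α₁} x_{i₂}^{α₂} ⋯ x_{i_ℓ}^{α_ℓ}`. -/
def MB (α : PseudoComp) : MvPowerSeries ℕ ℤ := fun m =>
  (Nat.card {i : Fin α.tail.length → ℕ // StrictMono i ∧ (∀ j, 0 < i j) ∧
    Finsupp.single 0 α.head + ∑ j, Finsupp.single (i j) (α.tail.get j) = m} : ℤ)

/-- `mᴮ_λ = ∑_{λᴮ(α) = λ} Mᴮ_α` (a finite sum). -/
def mB (l : PseudoPart) : MvPowerSeries ℕ ℤ :=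
  ∑ᶠ α ∈ {α : PseudoComp | α.toPart = l}, MB α

/-! ### `R[x₀] · U`, and extension of scalars -/

section scalars

variable (R : Type*) [CommRing R]

/-- The product `R[x₀] · U` inside the ring of power series in `x₀, x₁, …`. -/
def polyMul (U : Submodule R (MvPowerSeries ℕ R)) : Submodule R (MvPowerSeries ℕ R) :=
  Subalgebra.toSubmodule (Algebra.adjoin R {(MvPowerSeries.X 0 : MvPowerSeries ℕ R)}) * U

/-- The multiplication map `R[x₀] ⊗ U → R[[x₀, x₁, …]]`, `p ⊗ f ↦ p(x₀) · f`. -/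
def tensorMul (U : Submodule R (MvPowerSeries ℕ R)) :
    Polynomial R ⊗[R] U →ₗ[R] MvPowerSeries ℕ R :=
  LinearMap.mul' R (MvPowerSeries ℕ R) ∘ₗ
    TensorProduct.map
      (Polynomial.aeval (MvPowerSeries.X 0 : MvPowerSeries ℕ R)).toLinearMap U.subtype

/-- The map `R ⊗_ℤ U → R[[x₀, x₁, …]]`, `c ⊗ f ↦ c f`, for a `ℤ`-module `U` of power series with
integer coefficients. -/
def scalarExt (U : Submodule ℤ (MvPowerSeries ℕ ℤ)) : R ⊗[ℤ] U →ₗ[R] MvPowerSeries ℕ R :=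
  TensorProduct.AlgebraTensorModule.lift
    (LinearMap.toSpanSingleton R (U →ₗ[ℤ] MvPowerSeries ℕ R)
      ((MvPowerSeries.map (Int.castRingHom R)).toAddMonoidHom.toIntLinearMap ∘ₗ U.subtype))

/-- `U_R`: the image of `R ⊗_ℤ U` in `R[[x₀, x₁, …]]`. -/
def extended (U : Submodule ℤ (MvPowerSeries ℕ ℤ)) : Submodule R (MvPowerSeries ℕ R) :=
  LinearMap.range (scalarExt R U)

/-- The image of `1 ⊗ f` in `U_R`. -/
def toExtended {U : Submodule ℤ (MvPowerSeries ℕ ℤ)} (f : U) : extended R U :=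
  ⟨scalarExt R U (1 ⊗ₜ f), LinearMap.mem_range_self _ _⟩

end scalars

/-! ### Signed permutations and the bilinear form -/

/-- The hyperoctahedral group `𝔖ᴮ_n` of signed permutations of `{±1, …, ±n}`; they are extended to
`ℤ` by fixing `0` and all `i` with `|i| > n`. -/
def SignedPerm (n : ℕ) : Subgroup (Equiv.Perm ℤ) where
  carrier := {w | (∀ i, w (-i) = -w i) ∧ ∀ i : ℤ, (n : ℤ) < |i| → w i = i}
  one_mem' := by simp
  mul_mem' := by
    rintro u v ⟨hu, hu'⟩ ⟨hv, hv'⟩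
    refine ⟨fun i => by simp [hu, hv], fun i hi => ?_⟩
    simp [hv' i hi, hu' i hi]
  inv_mem' := by
    rintro u ⟨hu, hu'⟩
    refine ⟨fun i => ?_, fun i hi => ?_⟩
    · rw [Equiv.Perm.inv_eq_iff_eq, hu]; simp
    · rw [Equiv.Perm.inv_eq_iff_eq, hu' i hi]

/-- The descent set `D(w) = {i ∈ {0, …, n-1} : w(i) > w(i+1)}` (where `w(0) = 0`). -/
def SignedPerm.descents {n : ℕ} (w : SignedPerm n) : Finset ℕ :=
  (Finset.range n).filter fun i => w.1 (i : ℤ) > w.1 ((i : ℤ) + 1)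

/-- `c_{αβ} = #{w ∈ 𝔖ᴮ_n : D(w⁻¹) = D(α), D(w) = D(β)}` if `α`, `β` have the same size `n`, and
`c_{αβ} = 0` otherwise. -/
def formCoeff (α β : PseudoComp) : ℕ :=
  if α.size = β.size then
    Nat.card {w : SignedPerm β.size // SignedPerm.descents w⁻¹ = α.descents ∧
      SignedPerm.descents w = β.descents}
  else 0

/-- `B` is the bilinear form on `Symᴮ_K` given by `⟨sᴮ_α, sᴮ_β⟩ = c_{αβ}`. -/
def IsSymBForm (K : Type*) [Field K] (B : LinearMap.BilinForm K (extended K SymB)) : Prop :=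
  ∀ α β : PseudoComp, B (toExtended K (sB α)) (toExtended K (sB β)) = (formCoeff α β : K)

end TypeB

end

open TypeB

noncomputable section

namespace TypeB

open Finset hiding antidiagonal mem_antidiagonal
open Finset.HasAntidiagonal MvPowerSeries

/-! ### The substitution into commuting variables is multiplicative -/

/-! After commuting, everything becomes a product of complete homogeneous series. `chi` sends 𝐡_k to
`hPos`, the series in x₁, x₂, …; `chiB` sends 𝐡ᴮ_k to `hAll`, the series in x₀, x₁, …. Cutting a
weakly increasing word between its negative and nonnegative letters shows that `chiB` sends 𝐡_k to
`hDbl`, the series in x₀, x₁, x₁, x₂, x₂, …. So hᴮ_α is `hAll` at α₁ times a commutative product of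
`hDbl` at the other parts, and their order does not matter.

Over a field of characteristic zero the hᴮ_λ span the algebra `symAlg` of all series of bounded
degree symmetric in x₁, x₂, … (`hBSpan_eq`). The generating series of `hAll` and `hDbl` have
logarithmic derivatives ∑ (x₀ⁿ⁺¹ + pₙ₊₁) tⁿ and ∑ (x₀ⁿ⁺¹ + 2pₙ₊₁) tⁿ, with pₙ the power sums in x₁,
x₂, …. Hence hAll(t) · hDbl(t)^(-1/2) = (1 - x₀t)^(-1/2), whose coefficients are nonzero multiples
of the powers of x₀ (`X_pow_mem_hBSpan`). The span is a module over the algebra generated by the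
`hDbl`, which contains x₀ⁿ + 2pₙ; so it contains all polynomials in x₀ and the pₙ, and these include
every monomial series mᴮ_λ. The mᴮ_λ form a basis of `symAlg` with the same index set, finite in
each degree, so spanning forces linear independence (`hToM_injective`). Independence over ℚ gives it
over ℤ. The inclusion in ℤ[x₀]·Sym is proper because 3x₀² has coefficient 8 at hᴮ_(2), so x₀² is not
an integral combination. The tensor product statements hold because x₀ does not occur in Sym.

The form is defined by letting ⟨hᴮ_λ, f⟩ be the coefficient in f of a monomial of shape λ, which
makes duality with mᴮ_λ immediate. Then ⟨hᴮ_α, hᴮ_β⟩ counts words with prescribed absolute values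
and descents in D(β). A type B standardization (`coeff_canon_hB_eq_card`) matches these words with
signed permutations w satisfying D(w⁻¹) ⊆ D(α) and D(w) ⊆ D(β); inclusion-exclusion in both
arguments turns the inclusions into equalities, which is the formula for the sᴮ. The sᴮ span, so the
form is unique; w ↦ w⁻¹ gives symmetry, and the dual bases give nondegeneracy. -/

theorem coeff_commutize (L : Set ℤ) (f : NCSeries) (m : ℕ →₀ ℕ) :
    coeff m (commutize L f) = ∑ w ∈ (words_finite L m).toFinset, f w :=
  finsum_mem_eq_finite_toFinset_sum f (words_finite L m)

theorem content_append (u v : List ℤ) : content (u ++ v) = content u + content v := by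
  simp [content, ← Multiset.coe_add]

theorem content_cons (a : ℤ) (v : List ℤ) :
    content (a :: v) = Finsupp.single a.natAbs 1 + content v := by
  rw [← List.singleton_append, content_append]
  congr 1
  simp [content]

/-- A word with a marked cut is the same as a pair of words, and contents add under concatenation.
-/
theorem commutize_ncMul (L : Set ℤ) (f g : NCSeries) :
    commutize L (ncMul f g) = commutize L f * commutize L g := by
  ext m
  rw [coeff_mul, coeff_commutize]
  simp only [coeff_commutize, ncMul, Finset.sum_mul_sum, ← Finset.sum_product']
  rw [Finset.sum_sigma', Finset.sum_sigma']
  refine Finset.sum_bij' (fun x _ => ⟨(content (x.1.take x.2), content (x.1.drop x.2)),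
    (x.1.take x.2, x.1.drop x.2)⟩) (fun y _ => ⟨y.2.1 ++ y.2.2, y.2.1.length⟩) ?_ ?_ ?_ ?_ ?_
  · rintro ⟨w, i⟩ h
    simp only [mem_sigma, Set.Finite.mem_toFinset, words, Set.mem_ofPred_eq, mem_range,
      mem_antidiagonal, mem_product] at h ⊢
    obtain ⟨⟨h1, h2⟩, h3⟩ := h
    refine ⟨?_, ⟨fun a ha => h1 a (List.mem_of_mem_take ha), trivial⟩,
      fun a ha => h1 a (List.mem_of_mem_drop ha), trivial⟩
    rw [← content_append, List.take_append_drop, h2]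
  · rintro ⟨⟨a, b⟩, u, v⟩ h
    simp only [mem_sigma, Set.Finite.mem_toFinset, words, Set.mem_ofPred_eq, mem_range,
      mem_antidiagonal, mem_product] at h ⊢
    obtain ⟨h1, ⟨h2, h3⟩, h4, h5⟩ := h
    refine ⟨⟨?_, by rw [content_append, h3, h5, h1]⟩, by simp⟩
    intro c hc
    rcases List.mem_append.1 hc with hc | hc
    exacts [h2 c hc, h4 c hc]
  · rintro ⟨w, i⟩ h
    simp only [mem_sigma, mem_range] at h
    have : min i w.length = i := by omega
    simp [this]
  · rintro ⟨⟨a, b⟩, u, v⟩ h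
    simp only [mem_sigma, Set.Finite.mem_toFinset, words, Set.mem_ofPred_eq,
      mem_antidiagonal, mem_product] at h
    simp [h.2.1.2, h.2.2.2]
  · rintro ⟨w, i⟩ h
    rfl

theorem commutize_foldl (L : Set ℤ) (s : List NCSeries) (f : NCSeries) :
    commutize L (s.foldl ncMul f) = commutize L f * (s.map (commutize L)).prod := by
  induction s generalizing f with
  | nil => simp
  | cons g s ih => simp [ih, commutize_ncMul, mul_assoc]

theorem commutize_one (L : Set ℤ) : commutize L ncOne = 1 := by
  ext m
  rw [coeff_commutize, coeff_one]
  simp only [ncOne, Finset.sum_ite_eq', Set.Finite.mem_toFinset, words, Set.mem_ofPred_eq]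
  refine if_congr ?_ rfl rfl
  simp [content, eq_comm]

/-! ### Complete homogeneous series in commuting variables -/

section complete

variable (R : Type*) [CommRing R]

/-- The complete homogeneous symmetric function in `x₁, x₂, …`. -/
def hPos (k : ℕ) : MvPowerSeries ℕ R := fun m => if m 0 = 0 ∧ m.degree = k then 1 else 0

/-- The complete homogeneous symmetric function in `x₀, x₁, x₂, …`. -/
def hAll (k : ℕ) : MvPowerSeries ℕ R := fun m => if m.degree = k then 1 else 0

/-- The complete homogeneous symmetric function in `x₀, x₁, x₁, x₂, x₂, …`. -/
def hDbl (k : ℕ) : MvPowerSeries ℕ R := ∑ p ∈ antidiagonal k, hPos R p.1 * hAll R p.2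

theorem coeff_hPos (k : ℕ) (m : ℕ →₀ ℕ) :
    coeff m (hPos R k) = if m 0 = 0 ∧ m.degree = k then 1 else 0 := rfl

theorem coeff_hAll (k : ℕ) (m : ℕ →₀ ℕ) :
    coeff m (hAll R k) = if m.degree = k then 1 else 0 := rfl

theorem map_hPos (k : ℕ) : MvPowerSeries.map (Int.castRingHom R) (hPos ℤ k) = hPos R k := by
  ext m
  rw [coeff_map, coeff_hPos, coeff_hPos]
  split_ifs <;> simp

theorem map_hAll (k : ℕ) : MvPowerSeries.map (Int.castRingHom R) (hAll ℤ k) = hAll R k := by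
  ext m
  rw [coeff_map, coeff_hAll, coeff_hAll]
  split_ifs <;> simp

theorem map_hDbl (k : ℕ) : MvPowerSeries.map (Int.castRingHom R) (hDbl ℤ k) = hDbl R k := by
  simp [hDbl, map_hPos, map_hAll]

/-- Every monomial factors uniquely into a power of x₀ and a monomial free of x₀, so exactly one
summand contributes. -/
theorem hAll_eq (k : ℕ) :
    hAll R k = ∑ p ∈ antidiagonal k, (X 0 : MvPowerSeries ℕ R) ^ p.1 * hPos R p.2 := by
  ext m
  simp only [map_sum, X_pow_eq, coeff_monomial_mul, coeff_hAll, coeff_hPos, one_mul,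
    Finsupp.single_le_iff]
  have hdeg : ∀ a ≤ m 0, (m - Finsupp.single 0 a).degree + a = m.degree := by
    intro a ha
    conv_rhs => rw [← tsub_add_cancel_of_le (Finsupp.single_le_iff.2 ha), map_add]
    simp
  have hle : m 0 ≤ m.degree := Finsupp.le_degree 0 m
  split_ifs with h
  · rw [Finset.sum_eq_single (m 0, k - m 0)]
    · have := hdeg (m 0) le_rfl
      rw [if_pos le_rfl, if_pos]
      simp
      omega
    · rintro ⟨a, b⟩ hab hne
      rw [mem_antidiagonal] at hab
      dsimp only at hab ⊢
      by_cases h0 : a ≤ m 0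
      · rw [if_pos h0, if_neg]
        rintro ⟨h1, h2⟩
        simp at h1
        exact hne (by ext <;> simp <;> omega)
      · rw [if_neg h0]
    · intro hn
      exact absurd (by rw [mem_antidiagonal]; dsimp only; omega) hn
  · symm
    refine Finset.sum_eq_zero ?_
    rintro ⟨a, b⟩ hab
    rw [mem_antidiagonal] at hab
    dsimp only at hab ⊢
    by_cases h0 : a ≤ m 0
    · rw [if_pos h0, if_neg]
      rintro ⟨h1, h2⟩
      have := hdeg a h0
      omega
    · rw [if_neg h0]

end complete

/-! ### The images of `𝐡_k` and `𝐡ᴮ_k` -/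

theorem length_eq_degree_content (w : List ℤ) : (content w).degree = w.length := by
  induction w with
  | nil => simp [content]
  | cons a w ih => simp [content_cons, ih]; omega

theorem content_perm {u v : List ℤ} :
    content u = content v ↔ (u.map Int.natAbs).Perm (v.map Int.natAbs) := by
  simp [content]

theorem exists_sorted_word (m : ℕ →₀ ℕ) :
    ∃ w : List ℤ, (w.Pairwise (· ≤ ·) ∧ (∀ a ∈ w, 0 ≤ a)) ∧ content w = m := by
  refine ⟨((Finsupp.toMultiset m).sort (· ≤ ·)).map (fun n : ℕ => (n : ℤ)), ⟨?_, ?_⟩, ?_⟩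
  · rw [List.pairwise_map]
    exact (Multiset.pairwise_sort _ _).imp (fun h => by exact_mod_cast h)
  · simp
  · simp [content, Function.comp_def]

theorem zero_notMem_iff_content (w : List ℤ) : (0 : ℤ) ∉ w ↔ content w 0 = 0 := by
  induction w with
  | nil => simp [content]
  | cons a w ih =>
    simp only [content_cons, List.mem_cons, not_or, ih, Finsupp.add_apply, Nat.add_eq_zero_iff]
    refine and_congr ?_ Iff.rfl
    rw [Finsupp.single_apply]
    split_ifs <;> simp_all [eq_comm]

/-- Nonnegative letters are recovered from their absolute values, and a multiset has only one sorted
arrangement. -/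
theorem sorted_word_unique {u v : List ℤ} (hu : u.Pairwise (· ≤ ·)) (hv : v.Pairwise (· ≤ ·))
    (hu0 : ∀ a ∈ u, 0 ≤ a) (hv0 : ∀ a ∈ v, 0 ≤ a) (h : content u = content v) : u = v := by
  have key : ∀ w : List ℤ, (∀ a ∈ w, 0 ≤ a) → (w.map Int.natAbs).map (fun n : ℕ => (n : ℤ)) = w := by
    intro w hw
    rw [List.map_map]
    conv_rhs => rw [← List.map_id w]
    refine List.map_congr_left fun a ha => ?_
    simpa using hw a ha
  have h1 := (content_perm.1 h).map (fun n : ℕ => (n : ℤ))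
  rw [key u hu0, key v hv0] at h1
  exact h1.eq_of_pairwise (fun _ _ _ _ h1 h2 => le_antisymm h1 h2) hu hv

/-- If the words with property `P` are determined by their content, then so is the commutative
image of their sum. -/
theorem coeff_commutize_indicator (L : Set ℤ) (P : List ℤ → Prop) [DecidablePred P]
    (Q : (ℕ →₀ ℕ) → Prop) [DecidablePred Q] (m : ℕ →₀ ℕ)
    (hex : Q m → ∃ w ∈ words L m, P w) (hQ : ∀ w ∈ words L m, P w → Q m)
    (huniq : ∀ u ∈ words L m, ∀ v ∈ words L m, P u → P v → u = v) :
    coeff m (commutize L fun w => if P w then 1 else 0) = if Q m then 1 else 0 := by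
  rw [coeff_commutize]
  split_ifs with h
  · obtain ⟨w, hw, hP⟩ := hex h
    rw [Finset.sum_eq_single w, if_pos hP]
    · intro b hb hne
      rw [if_neg]
      intro hb'
      exact hne (huniq b ((Set.Finite.mem_toFinset _).1 hb) w hw hb' hP)
    · intro hn
      exact absurd ((Set.Finite.mem_toFinset _).2 hw) hn
  · refine Finset.sum_eq_zero fun w hw => if_neg fun hP => h (hQ w ((Set.Finite.mem_toFinset _).1 hw) hP)

theorem chi_ncH (k : ℕ) : chi (ncH k) = hPos ℤ k := by
  ext m
  rw [coeff_hPos]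
  refine coeff_commutize_indicator _ _ (fun m => m 0 = 0 ∧ m.degree = k) _ ?_ ?_ ?_
  · rintro ⟨h0, rfl⟩
    obtain ⟨w, ⟨h1, h2⟩, rfl⟩ := exists_sorted_word m
    rw [← zero_notMem_iff_content] at h0
    refine ⟨w, ⟨fun a ha => ?_, rfl⟩, (length_eq_degree_content w).symm, h1⟩
    exact lt_of_le_of_ne (h2 a ha) (fun h => h0 (h ▸ ha))
  · rintro w ⟨h1, rfl⟩ ⟨rfl, -⟩
    exact ⟨(zero_notMem_iff_content w).1 fun h => lt_irrefl (0 : ℤ) (h1 0 h), length_eq_degree_content w⟩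
  · rintro u ⟨hu, hu'⟩ v ⟨hv, hv'⟩ ⟨-, h1⟩ ⟨-, h2⟩
    exact sorted_word_unique h1 h2 (fun a ha => (hu a ha).le) (fun a ha => (hv a ha).le)
      (hu'.trans hv'.symm)

theorem chiB_ncHB (k : ℕ) : chiB (ncHB k) = hAll ℤ k := by
  ext m
  rw [coeff_hAll]
  refine coeff_commutize_indicator _ _ (fun m => m.degree = k) _ ?_ ?_ ?_
  · rintro rfl
    obtain ⟨w, ⟨h1, h2⟩, rfl⟩ := exists_sorted_word m
    exact ⟨w, ⟨fun a ha => trivial, rfl⟩, (length_eq_degree_content w).symm, h1, h2⟩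
  · rintro w ⟨h1, rfl⟩ ⟨rfl, -⟩
    exact length_eq_degree_content w
  · rintro u ⟨-, hu'⟩ v ⟨-, hv'⟩ ⟨-, h1, hu⟩ ⟨-, h2, hv⟩
    exact sorted_word_unique h1 h2 hu hv (hu'.trans hv'.symm)

/-- The sum of the weakly increasing words of length `k` with negative letters. -/
def ncNeg (k : ℕ) : NCSeries := fun w =>
  if w.length = k ∧ w.Pairwise (· ≤ ·) ∧ ∀ a ∈ w, a < 0 then 1 else 0

/-- Reversing a word and negating its letters keeps it weakly increasing and exchanges negative with
positive letters. This reduces `ncNeg` to words with positive letters. -/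
theorem content_reverse_neg (w : List ℤ) : content (w.map (- ·)).reverse = content w := by
  rw [content_perm, List.map_reverse]
  refine (List.reverse_perm _).trans ?_
  simp [Function.comp_def]

theorem pairwise_reverse_neg (w : List ℤ) :
    (w.map (- ·)).reverse.Pairwise (· ≤ ·) ↔ w.Pairwise (· ≤ ·) := by
  rw [List.pairwise_reverse, List.pairwise_map]
  simp

theorem reverse_neg_involutive (w : List ℤ) :
    (((w.map (- ·)).reverse).map (- ·)).reverse = w := by
  simp [List.map_reverse]

theorem chiB_ncNeg (k : ℕ) : chiB (ncNeg k) = hPos ℤ k := by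
  ext m
  rw [coeff_hPos]
  refine coeff_commutize_indicator _ _ (fun m => m 0 = 0 ∧ m.degree = k) _ ?_ ?_ ?_
  · rintro ⟨h0, rfl⟩
    obtain ⟨w, ⟨h1, h2⟩, rfl⟩ := exists_sorted_word m
    rw [← zero_notMem_iff_content] at h0
    refine ⟨(w.map (- ·)).reverse, ⟨fun a ha => trivial, content_reverse_neg w⟩,
      by simp [length_eq_degree_content w], (pairwise_reverse_neg w).2 h1, ?_⟩
    intro a ha
    simp only [List.mem_reverse, List.mem_map] at ha
    obtain ⟨b, hb, rfl⟩ := ha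
    have := lt_of_le_of_ne (h2 b hb) (fun h => h0 (h ▸ hb))
    omega
  · rintro w ⟨-, rfl⟩ ⟨rfl, -, h1⟩
    exact ⟨(zero_notMem_iff_content w).1 fun h => lt_irrefl (0 : ℤ) (h1 0 h), length_eq_degree_content w⟩
  · rintro u ⟨-, hu'⟩ v ⟨-, hv'⟩ ⟨-, h1, hu⟩ ⟨-, h2, hv⟩
    rw [← reverse_neg_involutive u, ← reverse_neg_involutive v]
    congr 2
    refine sorted_word_unique ((pairwise_reverse_neg u).2 h1) ((pairwise_reverse_neg v).2 h2)
      ?_ ?_ (by rw [content_reverse_neg, content_reverse_neg, hu', hv'])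
    · intro a ha
      simp only [List.mem_reverse, List.mem_map] at ha
      obtain ⟨b, hb, rfl⟩ := ha
      have := hu b hb
      omega
    · intro a ha
      simp only [List.mem_reverse, List.mem_map] at ha
      obtain ⟨b, hb, rfl⟩ := ha
      have := hv b hb
      omega

/-- A weakly increasing word has all its negative letters in front, so it arises from exactly one
cut. -/
theorem ncH_eq (k : ℕ) : ncH k = ∑ p ∈ antidiagonal k, ncMul (ncNeg p.1) (ncHB p.2) := by
  funext w
  simp only [Finset.sum_apply, ncMul, ncNeg, ncHB, ncH, ← ite_and, mul_ite, mul_one, mul_zero]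
  by_cases hw : w.length = k ∧ w.Pairwise (· ≤ ·)
  · rw [if_pos hw]
    obtain ⟨rfl, hs⟩ := hw
    -- The number of negative letters: the only cut position with a nonzero contribution.
    set i := (w.takeWhile (· < 0)).length with hi
    have hsplit : w.takeWhile (· < 0) ++ w.dropWhile (· < 0) = w := List.takeWhile_append_dropWhile
    have hil : i ≤ w.length := by
      conv_rhs => rw [← hsplit, List.length_append]
      omega
    have ht : w.take i = w.takeWhile (· < 0) := by
      conv_lhs => rw [← hsplit]
      rw [hi, List.take_left]
    have hd : w.drop i = w.dropWhile (· < 0) := by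
      conv_lhs => rw [← hsplit]
      rw [hi, List.drop_left]
    have hneg : ∀ a ∈ w.take i, a < 0 := by
      intro a ha
      rw [ht] at ha
      simpa using List.mem_takeWhile_imp ha
    have hpos : ∀ a ∈ w.drop i, 0 ≤ a := by
      have hsd : (w.drop i).Pairwise (· ≤ ·) := hs.sublist (List.drop_sublist _ _)
      have hhead := List.head?_dropWhile_not (fun a : ℤ => decide (a < 0)) w
      rw [← hd] at hhead
      cases hdr : w.drop i with
      | nil => simp
      | cons b t =>
        rw [hdr] at hsd hhead
        simp at hhead
        intro a ha
        rcases List.mem_cons.1 ha with rfl | ha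
        · exact hhead
        · exact hhead.trans ((List.pairwise_cons.1 hsd).1 a ha)
    rw [Finset.sum_eq_single (i, w.length - i), Finset.sum_eq_single i, if_pos]
    · exact ⟨⟨by simp, hs.sublist (List.drop_sublist _ _), hpos⟩,
        by simp [hil], hs.sublist (List.take_sublist _ _), hneg⟩
    · intro j hj hne
      rw [if_neg]
      rintro ⟨⟨h1, -⟩, h2, -⟩
      simp at h1 h2 hj
      omega
    · intro h
      simp at h
      omega
    · rintro ⟨a, b⟩ hab hne
      rw [mem_antidiagonal] at hab
      refine Finset.sum_eq_zero fun j hj => if_neg ?_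
      rintro ⟨⟨h1, -, h2⟩, h3, -, h4⟩
      simp at h1 h3 hj
      dsimp only at hab
      have hja : j = a := by omega
      subst hja
      apply hne
      have hij : i = j := by
        rcases lt_trichotomy i j with hlt | h | hlt
        · have hlt' : i < w.length := by omega
          have e1 := h4 w[i] (List.mem_take_iff_getElem.2 ⟨i, by omega, rfl⟩)
          have e2 := hpos w[i] (List.mem_drop_iff_getElem.2 ⟨0, by omega, by simp⟩)
          omega
        · exact h
        · have hlt' : j < w.length := by omega
          have e1 := hneg w[j] (List.mem_take_iff_getElem.2 ⟨j, by omega, rfl⟩)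
          have e2 := h2 w[j] (List.mem_drop_iff_getElem.2 ⟨0, by omega, by simp⟩)
          omega
      subst hij
      ext <;> simp
      omega
    · intro h
      simp at h
      omega
  · rw [if_neg hw]
    symm
    refine Finset.sum_eq_zero ?_
    rintro ⟨a, b⟩ hab
    rw [mem_antidiagonal] at hab
    refine Finset.sum_eq_zero fun j hj => if_neg ?_
    rintro ⟨⟨h1, h1', h2⟩, h3, h3', h4⟩
    apply hw
    simp at h1 h3 hj
    dsimp only at hab
    refine ⟨by omega, ?_⟩
    rw [← List.take_append_drop j w, List.pairwise_append]
    exact ⟨h3', h1', fun a ha b hb => (h4 a ha).le.trans (h2 b hb)⟩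

theorem chiB_ncH (k : ℕ) : chiB (ncH k) = hDbl ℤ k := by
  rw [ncH_eq, map_sum, hDbl]
  refine Finset.sum_congr rfl fun p _ => ?_
  rw [← chiB_ncNeg, ← chiB_ncHB]
  exact commutize_ncMul _ _ _

/-! ### The generators of `Sym` and `Symᴮ` -/

/-- `hᴮ_α` over an arbitrary ring of coefficients. -/
def hBOver (R : Type*) [CommRing R] (α : PseudoComp) : MvPowerSeries ℕ R :=
  hAll R α.head * (α.tail.map (hDbl R)).prod

theorem hB_eq (α : PseudoComp) : hB α = hBOver ℤ α := by
  rw [hB, ncHBComp, chiB, commutize_foldl, List.map_map, hBOver]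
  congr 1
  · exact chiB_ncHB _
  · congr 1
    exact List.map_congr_left fun k _ => chiB_ncH k

theorem map_hB (R : Type*) [CommRing R] (α : PseudoComp) :
    MvPowerSeries.map (Int.castRingHom R) (hB α) = hBOver R α := by
  rw [hB_eq, hBOver, hBOver, map_mul, map_hAll, map_list_prod, List.map_map]
  congr 2
  exact List.map_congr_left fun k _ => map_hDbl R k

theorem chi_ncHComp (α : Comp) : chi (ncHComp α) = (α.1.map (hPos ℤ)).prod := by
  rw [ncHComp, chi, commutize_foldl, commutize_one, one_mul, List.map_map]
  congr 1
  exact List.map_congr_left fun k _ => chi_ncH k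

theorem hBOver_toPart (R : Type*) [CommRing R] (α : PseudoComp) :
    hBOver R α.toPart.1 = hBOver R α := by
  rw [hBOver, hBOver, PseudoComp.toPart]
  congr 1
  exact ((List.perm_insertionSort _ α.tail).map _).prod_eq

theorem symF_eq_span : SymF = Submodule.span ℤ (Set.range fun α : Comp => (α.1.map (hPos ℤ)).prod) := by
  rw [SymF, NSym, Submodule.map_span, ← Set.range_comp]
  congr 2
  funext α
  exact chi_ncHComp α

theorem symB_eq_span : SymB = Submodule.span ℤ (Set.range (hBOver ℤ)) := by
  rw [SymB, NSymB, Submodule.map_span, ← Set.range_comp]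
  congr 2
  funext α
  exact hB_eq α

/-! ### Pseudo-compositions and their descent sets -/

namespace PseudoComp

instance : DecidableEq PseudoComp := fun _ _ => decidable_of_iff _ PseudoComp.ext_iff.symm

/-- Append a positive part. -/
def snoc (α : PseudoComp) (k : ℕ) (hk : 0 < k) : PseudoComp :=
  ⟨α.head, α.tail ++ [k], by
    intro a ha
    rcases List.mem_append.1 ha with ha | ha
    · exact α.tail_pos a ha
    · rw [List.mem_singleton.1 ha]
      exact hk⟩

/-- The pseudo-composition with a single part. -/
def single (n : ℕ) : PseudoComp := ⟨n, [], by simp⟩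

/-- Induction on the last part suits both the left-associated products and the descent sets:
appending a part adds just one descent, the old size, above all others. -/
theorem snoc_induction {P : PseudoComp → Prop} (h1 : ∀ n, P (single n))
    (h2 : ∀ α k hk, P α → P (snoc α k hk)) (α : PseudoComp) : P α := by
  obtain ⟨n, t, ht⟩ := α
  induction t using List.reverseRecOn with
  | nil => exact h1 n
  | append_singleton t k ih =>
    exact h2 ⟨n, t, fun a ha => ht a (List.mem_append_left _ ha)⟩ k (ht k (by simp)) (ih _)

@[simp] theorem size_single (n : ℕ) : (single n).size = n := by simp [single, size]

@[simp] theorem size_snoc (α : PseudoComp) (k hk) : (snoc α k hk).size = α.size + k := by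
  simp [snoc, size, add_assoc]

@[simp] theorem descents_single (n : ℕ) : (single n).descents = ∅ := by simp [single, descents]

@[simp] theorem descents_snoc (α : PseudoComp) (k hk) :
    (snoc α k hk).descents = insert α.size α.descents := by
  rw [snoc, descents, descents]
  simp only [List.length_append, List.length_singleton, Finset.range_add_one, Finset.image_insert]
  congr 1
  · rw [List.take_append_of_le_length le_rfl, List.take_length, size]
  · refine Finset.image_congr fun i hi => ?_
    rw [Finset.mem_coe, Finset.mem_range] at hi
    rw [List.take_append_of_le_length hi.le]

theorem lt_size_of_mem_descents {α : PseudoComp} {d : ℕ} (hd : d ∈ α.descents) : d < α.size := by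
  induction α using snoc_induction with
  | h1 n => simp at hd
  | h2 α k hk ih =>
    rw [descents_snoc, Finset.mem_insert] at hd
    rw [size_snoc]
    rcases hd with rfl | hd
    · omega
    · have := ih hd
      omega

theorem size_notMem_descents (α : PseudoComp) : α.size ∉ α.descents :=
  fun h => (lt_size_of_mem_descents h).false

theorem descents_subset_range (α : PseudoComp) : α.descents ⊆ Finset.range α.size :=
  fun _ h => Finset.mem_range.2 (lt_size_of_mem_descents h)

theorem length_eq (α : PseudoComp) : α.length = α.descents.card + 1 := by
  induction α using snoc_induction with
  | h1 n => simp [single, length, descents]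
  | h2 α k hk ih =>
    rw [descents_snoc, Finset.card_insert_of_notMem α.size_notMem_descents, ← ih]
    simp [snoc, length]

theorem eq_of_size_of_descents {α β : PseudoComp} (h : α.size = β.size)
    (hD : α.descents = β.descents) : α = β := by
  induction α using snoc_induction generalizing β with
  | h1 n =>
    induction β using snoc_induction with
    | h1 m => simp at h; rw [h]
    | h2 β k hk _ => simp at hD; exact absurd hD.symm (Finset.insert_ne_empty _ _)
  | h2 α k hk ih =>
    induction β using snoc_induction with
    | h1 m => simp at hD
    | h2 β l hl _ =>
      simp only [descents_snoc, size_snoc] at h hD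
      -- Both truncated sizes are the maximum of the common descent set.
      have hs : α.size = β.size := by
        have h1 : α.size ∈ insert β.size β.descents := hD ▸ Finset.mem_insert_self _ _
        have h2 : β.size ∈ insert α.size α.descents := hD ▸ Finset.mem_insert_self _ _
        rcases Finset.mem_insert.1 h1 with h1 | h1
        · exact h1
        · rcases Finset.mem_insert.1 h2 with h2 | h2
          · exact h2.symm
          · exact absurd ((lt_size_of_mem_descents h1).trans (lt_size_of_mem_descents h2)) (lt_irrefl _)
      have hd : α.descents = β.descents := by
        have h1 := congrArg (fun s => s.erase α.size) hD
        rwa [Finset.erase_insert α.size_notMem_descents, hs,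
          Finset.erase_insert β.size_notMem_descents] at h1
      obtain rfl := ih hs hd
      obtain rfl : k = l := by omega
      rfl

theorem exists_of_descents (n : ℕ) (S : Finset ℕ) (hS : S ⊆ Finset.range n) :
    ∃ α : PseudoComp, α.size = n ∧ α.descents = S := by
  induction n using Nat.strong_induction_on generalizing S with
  | _ n ih =>
    rcases S.eq_empty_or_nonempty with rfl | hne
    · exact ⟨single n, by simp⟩
    -- The largest descent is the size of the pseudo-composition without its last part.
    · set d := S.max' hne
      have hd : d ∈ S := S.max'_mem hne
      have hdn : d < n := Finset.mem_range.1 (hS hd)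
      obtain ⟨α, h1, h2⟩ := ih d hdn (S.erase d) (fun c hc => Finset.mem_range.2
        (S.lt_max'_of_mem_erase_max' hne hc))
      refine ⟨snoc α (n - d) (by omega), by rw [size_snoc]; omega, ?_⟩
      rw [descents_snoc, h1, h2, Finset.insert_erase hd]

theorem finite_size_le (N : ℕ) : {α : PseudoComp | α.size ≤ N}.Finite := by
  refine Set.Finite.of_injOn (f := fun α : PseudoComp => (α.size, α.descents))
    (t := ((Finset.range (N + 1) ×ˢ (Finset.range N).powerset : Finset _) : Set _)) ?_ ?_
    (Finset.finite_toSet _)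
  · intro α hα
    have hα' : α.size ≤ N := hα
    simp only [Finset.coe_product, Set.mem_prod, Finset.mem_coe, Finset.mem_range,
      Finset.mem_powerset]
    exact ⟨by omega, α.descents_subset_range.trans (Finset.range_mono hα')⟩
  · intro α _ β _ h
    exact eq_of_size_of_descents (congrArg Prod.fst h) (congrArg Prod.snd h)

theorem toPart_eq_iff (α : PseudoComp) (l : PseudoPart) :
    α.toPart = l ↔ α.head = l.1.head ∧ α.tail.Perm l.1.tail := by
  constructor
  · rintro rfl
    exact ⟨rfl, (List.perm_insertionSort _ _).symm⟩
  · rintro ⟨h1, h2⟩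
    refine Subtype.ext (PseudoComp.ext h1 ?_)
    refine List.Perm.eq_of_pairwise (le := (· ≥ ·)) (fun a b _ _ h h' => le_antisymm h' h)
      (List.pairwise_insertionSort _ _) l.2 ((List.perm_insertionSort _ _).trans h2)

theorem toPart_val (l : PseudoPart) : l.1.toPart = l := (toPart_eq_iff _ _).2 ⟨rfl, List.Perm.refl _⟩

theorem size_toPart (α : PseudoComp) : α.toPart.1.size = α.size := by
  obtain ⟨h1, h2⟩ := (toPart_eq_iff α _).1 rfl
  rw [size, size, ← h1, h2.sum_eq]

end PseudoComp

/-! ### The shape of a monomial -/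

/-- The positive indices of the variables of a monomial. -/
def posSupp (m : ℕ →₀ ℕ) : Finset ℕ := m.support.erase 0

theorem mem_posSupp {m : ℕ →₀ ℕ} {c : ℕ} : c ∈ posSupp m ↔ 0 < c ∧ m c ≠ 0 := by
  simp [posSupp, Nat.pos_iff_ne_zero]

/-- The nonzero exponents of `x₁, x₂, …`. -/
def posValues (m : ℕ →₀ ℕ) : Multiset ℕ := (posSupp m).val.map m

theorem pos_of_mem_posValues {m : ℕ →₀ ℕ} {a : ℕ} (ha : a ∈ posValues m) : 0 < a := by
  obtain ⟨c, hc, rfl⟩ := Multiset.mem_map.1 ha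
  exact Nat.pos_of_ne_zero (mem_posSupp.1 hc).2

/-- The pseudo-partition of the exponents of a monomial. -/
def shape (m : ℕ →₀ ℕ) : PseudoPart :=
  ⟨⟨m 0, (posValues m).sort (· ≥ ·), fun _ ha => pos_of_mem_posValues ((Multiset.mem_sort _).1 ha)⟩,
    Multiset.pairwise_sort _ _⟩

theorem shape_eq_iff (m : ℕ →₀ ℕ) (l : PseudoPart) :
    shape m = l ↔ m 0 = l.1.head ∧ posValues m = l.1.tail := by
  constructor
  · rintro rfl
    exact ⟨rfl, by simp [shape]⟩
  · rintro ⟨h1, h2⟩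
    refine Subtype.ext (PseudoComp.ext h1 ?_)
    refine List.Perm.eq_of_pairwise (le := (· ≥ ·)) (fun _ _ _ _ h h' => le_antisymm h' h)
      (Multiset.pairwise_sort _ _) l.2 ?_
    rw [← Multiset.coe_eq_coe, ← h2, shape, Multiset.sort_eq]

/-- The monomial `x₀ᵏ ∏ⱼ x_{iⱼ}^{aⱼ}`. -/
def expo (k : ℕ) {r : ℕ} (i a : Fin r → ℕ) : ℕ →₀ ℕ :=
  Finsupp.single 0 k + ∑ j, Finsupp.single (i j) (a j)

theorem expo_zero (k : ℕ) {r : ℕ} {i : Fin r → ℕ} (a : Fin r → ℕ) (hi : ∀ j, 0 < i j) :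
    expo k i a 0 = k := by
  simp only [expo, Finsupp.add_apply, Finsupp.single_eq_same, Finsupp.finsetSum_apply]
  rw [Finset.sum_eq_zero, add_zero]
  intro j _
  exact Finsupp.single_eq_of_ne (hi j).ne

theorem expo_apply (k : ℕ) {r : ℕ} {i : Fin r → ℕ} (a : Fin r → ℕ) (hi : ∀ j, 0 < i j)
    (hinj : Function.Injective i) (j : Fin r) : expo k i a (i j) = a j := by
  simp only [expo, Finsupp.add_apply, Finsupp.finsetSum_apply]
  rw [Finsupp.single_eq_of_ne (hi j).ne', zero_add, Finset.sum_eq_single j, Finsupp.single_eq_same]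
  · intro b _ hb
    exact Finsupp.single_eq_of_ne (fun h => hb (hinj h).symm)
  · simp

theorem expo_apply_of_ne (k : ℕ) {r : ℕ} {i : Fin r → ℕ} (a : Fin r → ℕ) {c : ℕ} (hc : 0 < c)
    (hi : ∀ j, i j ≠ c) : expo k i a c = 0 := by
  simp only [expo, Finsupp.add_apply, Finsupp.finsetSum_apply]
  rw [Finsupp.single_eq_of_ne hc.ne', zero_add, Finset.sum_eq_zero]
  intro b _
  exact Finsupp.single_eq_of_ne (hi b).symm

theorem degree_expo (k : ℕ) {r : ℕ} (i a : Fin r → ℕ) : (expo k i a).degree = k + ∑ j, a j := by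
  simp [expo, map_sum]

theorem posSupp_expo (k : ℕ) {r : ℕ} {i a : Fin r → ℕ} (hi : ∀ j, 0 < i j)
    (hinj : Function.Injective i) (ha : ∀ j, 0 < a j) :
    posSupp (expo k i a) = Finset.univ.map ⟨i, hinj⟩ := by
  ext c
  rw [mem_posSupp]
  simp only [Finset.mem_map, Finset.mem_univ, true_and, Function.Embedding.coeFn_mk]
  constructor
  · rintro ⟨h0, h1⟩
    by_contra! h
    exact h1 (expo_apply_of_ne k a h0 h)
  · rintro ⟨j, rfl⟩
    rw [expo_apply k a hi hinj]
    exact ⟨hi j, (ha j).ne'⟩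

theorem posValues_expo (k : ℕ) {r : ℕ} {i a : Fin r → ℕ} (hi : ∀ j, 0 < i j)
    (hinj : Function.Injective i) (ha : ∀ j, 0 < a j) :
    posValues (expo k i a) = List.ofFn a := by
  rw [posValues, posSupp_expo k hi hinj ha, Finset.map_val, Multiset.map_map, ← Fin.univ_val_map]
  refine Multiset.map_congr rfl fun j _ => ?_
  exact expo_apply k a hi hinj j

/-- Turns an equality of multisets of values into an actual enumeration of `S` without repetition,
removing one element at a time. -/
theorem exists_enum {r : ℕ} (S : Finset ℕ) (g : ℕ → ℕ) (a : Fin r → ℕ)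
    (h : S.val.map g = List.ofFn a) :
    ∃ i : Fin r → ℕ, Function.Injective i ∧ (∀ c, c ∈ S ↔ ∃ j, i j = c) ∧ ∀ j, g (i j) = a j := by
  induction r generalizing S with
  | zero =>
    simp at h
    subst h
    exact ⟨Fin.elim0, fun j => j.elim0, by simp, fun j => j.elim0⟩
  | succ r ih =>
    rw [List.ofFn_succ, ← Multiset.cons_coe] at h
    have hmem : a 0 ∈ S.val.map g := h ▸ Multiset.mem_cons_self _ _
    obtain ⟨x, hx, hxa⟩ := Multiset.mem_map.1 hmem
    have hx' : x ∈ S := hx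
    rw [← Finset.insert_erase hx', Finset.insert_val_of_notMem (Finset.notMem_erase x S),
      Multiset.map_cons, hxa, Multiset.cons_inj_right] at h
    obtain ⟨i, h1, h2, h3⟩ := ih (S.erase x) (fun j => a j.succ) h
    refine ⟨Fin.cons x i, ?_, ?_, ?_⟩
    · rw [Fin.cons_injective_iff]
      refine ⟨?_, h1⟩
      rintro ⟨j, hj⟩
      exact Finset.notMem_erase x S ((h2 x).2 ⟨j, hj⟩)
    · intro c
      rw [Fin.exists_fin_succ]
      simp only [Fin.cons_zero, Fin.cons_succ, ← h2, Finset.mem_erase]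
      constructor
      · intro hc
        by_cases hxc : x = c
        · exact Or.inl hxc
        · exact Or.inr ⟨Ne.symm hxc, hc⟩
      · rintro (rfl | h)
        exacts [hx', h.2]
    · intro j
      refine Fin.cases ?_ (fun j => ?_) j
      · simpa using hxa
      · simpa using h3 j

theorem expo_eq {r : ℕ} {m : ℕ →₀ ℕ} {i a : Fin r → ℕ} (h1 : Function.Injective i)
    (h2 : ∀ c, c ∈ posSupp m ↔ ∃ j, i j = c) (h3 : ∀ j, m (i j) = a j) :
    (∀ j, 0 < i j) ∧ expo (m 0) i a = m := by
  have hi : ∀ j, 0 < i j := fun j => (mem_posSupp.1 ((h2 _).2 ⟨j, rfl⟩)).1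
  refine ⟨hi, ?_⟩
  ext c
  rcases Nat.eq_zero_or_pos c with rfl | hc
  · rw [expo_zero _ _ hi]
  · by_cases hj : ∃ j, i j = c
    · obtain ⟨j, rfl⟩ := hj
      rw [expo_apply _ _ hi h1, h3]
    · have : c ∉ posSupp m := fun h => hj ((h2 c).1 h)
      push Not at hj
      rw [expo_apply_of_ne _ _ hc hj]
      by_contra h0
      exact this (mem_posSupp.2 ⟨hc, fun h => h0 h.symm⟩)

theorem exists_expo {r : ℕ} (m : ℕ →₀ ℕ) (a : Fin r → ℕ) (h : posValues m = List.ofFn a) :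
    ∃ i : Fin r → ℕ, Function.Injective i ∧ (∀ j, 0 < i j) ∧ expo (m 0) i a = m := by
  obtain ⟨i, h1, h2, h3⟩ := exists_enum _ _ a h
  exact ⟨i, h1, expo_eq h1 h2 h3⟩

/-- The monomial `x₀^{α₁} x₁^{α₂} x₂^{α₃} ⋯`. -/
def canon (α : PseudoComp) : ℕ →₀ ℕ :=
  expo α.head (fun j : Fin α.tail.length => (j : ℕ) + 1) α.tail.get

theorem shape_canon (α : PseudoComp) : shape (canon α) = α.toPart := by
  have hinj : Function.Injective (fun j : Fin α.tail.length => (j : ℕ) + 1) := by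
    intro a b h
    simpa [Fin.val_inj] using h
  rw [shape_eq_iff]
  refine ⟨?_, ?_⟩
  · exact expo_zero _ _ (by simp)
  · rw [canon, posValues_expo _ (by simp) hinj, List.ofFn_get]
    · exact Multiset.coe_eq_coe.2 (List.perm_insertionSort _ _).symm
    · intro j
      exact α.tail_pos _ (List.get_mem _ _)

theorem shape_canon_part (l : PseudoPart) : shape (canon l.1) = l := by
  rw [shape_canon, PseudoComp.toPart_val]

theorem degree_canon (α : PseudoComp) : (canon α).degree = α.size := by
  rw [canon, degree_expo, PseudoComp.size, ← List.sum_ofFn, List.ofFn_get]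

theorem exists_expo_shape (m : ℕ →₀ ℕ) :
    ∃ i : Fin (shape m).1.tail.length → ℕ, Function.Injective i ∧ (∀ j, 0 < i j) ∧
      expo (shape m).1.head i (shape m).1.tail.get = m := by
  obtain ⟨h1, h2⟩ := (shape_eq_iff m _).1 rfl
  rw [← h1]
  exact exists_expo m _ (by rw [List.ofFn_get]; exact h2)

theorem size_shape (m : ℕ →₀ ℕ) : (shape m).1.size = m.degree := by
  obtain ⟨i, -, -, h⟩ := exists_expo_shape m
  conv_rhs => rw [← h]
  rw [degree_expo, PseudoComp.size, ← List.sum_ofFn, List.ofFn_get]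

theorem exists_perm_of_shape_eq {m m' : ℕ →₀ ℕ} (h : shape m = shape m') :
    ∃ π : Equiv.Perm ℕ, π 0 = 0 ∧ Finsupp.domCongr π m = m' := by
  obtain ⟨i, hi, hi0, hm⟩ := exists_expo_shape m
  have hex := exists_expo_shape m'
  rw [← h] at hex
  obtain ⟨i', hi', hi0', hm'⟩ := hex
  have hc : ∀ {i : Fin (shape m).1.tail.length → ℕ}, Function.Injective i → (∀ j, 0 < i j) →
      Function.Injective (Fin.cons 0 i : Fin (_ + 1) → ℕ) := by
    intro i hi hi0
    rw [Fin.cons_injective_iff]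
    exact ⟨fun ⟨j, hj⟩ => (hi0 j).ne' hj, hi⟩
  -- The permutations of ℕ act transitively on injective tuples. Prepending 0 to both tuples forces
  -- π to fix 0.
  obtain ⟨π, hπ⟩ := (MulAction.isMultiplyPretransitive_iff.1
    (Equiv.Perm.isMultiplyPretransitive ℕ _)) ⟨_, hc hi hi0⟩ ⟨_, hc hi' hi0'⟩
  have h0 : ∀ j, π ((Fin.cons 0 i : Fin (_ + 1) → ℕ) j) = (Fin.cons 0 i' : Fin (_ + 1) → ℕ) j :=
    fun j => DFunLike.congr_fun hπ j
  have hπ0 : π 0 = 0 := h0 0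
  have hπi : ∀ j, π (i j) = i' j := fun j => h0 j.succ
  refine ⟨π, hπ0, ?_⟩
  rw [← hm, ← hm', expo, expo, map_add, map_sum]
  simp [hπ0, hπi]

/-! ### Series symmetric in `x₁, x₂, …` -/

theorem degree_domCongr (π : Equiv.Perm ℕ) (m : ℕ →₀ ℕ) :
    (Finsupp.domCongr π m).degree = m.degree := by
  induction m using Finsupp.induction_linear with
  | zero => simp
  | add f g hf hg => simp only [map_add, hf, hg]
  | single a b => simp

theorem domCongr_zero {π : Equiv.Perm ℕ} (hπ : π 0 = 0) (m : ℕ →₀ ℕ) :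
    Finsupp.domCongr π m 0 = m 0 := by
  rw [Finsupp.domCongr_apply, Finsupp.equivMapDomain_apply,
    (Equiv.symm_apply_eq π).2 hπ.symm]

section symmetric

variable (R : Type*) [CommRing R]

/-- The series of bounded degree that are symmetric in `x₁, x₂, …`. -/
def symAlg : Subalgebra R (MvPowerSeries ℕ R) where
  carrier := {f | (∀ π : Equiv.Perm ℕ, π 0 = 0 → ∀ m, coeff (Finsupp.domCongr π m) f = coeff m f) ∧
    ∃ N, ∀ m : ℕ →₀ ℕ, N < m.degree → coeff m f = 0}
  mul_mem' := by
    rintro f g ⟨hf, M, hM⟩ ⟨hg, N, hN⟩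
    refine ⟨fun π hπ m => ?_, M + N, fun m hm => ?_⟩
    · rw [coeff_mul, coeff_mul]
      symm
      refine Finset.sum_nbij' (fun p => (Finsupp.domCongr π p.1, Finsupp.domCongr π p.2))
        (fun p => (Finsupp.domCongr π.symm p.1, Finsupp.domCongr π.symm p.2)) ?_ ?_ ?_ ?_ ?_
      · intro p hp
        rw [mem_antidiagonal] at hp ⊢
        rw [← map_add, hp]
      · intro p hp
        rw [mem_antidiagonal] at hp ⊢
        rw [← map_add, hp, ← Finsupp.domCongr_symm, AddEquiv.symm_apply_apply]
      · intro p _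
        simp only [← Finsupp.domCongr_symm, AddEquiv.symm_apply_apply]
      · intro p _
        simp only [← Finsupp.domCongr_symm, AddEquiv.apply_symm_apply]
      · intro p _
        rw [hf π hπ, hg π hπ]
    · rw [coeff_mul]
      refine Finset.sum_eq_zero fun p hp => ?_
      rw [mem_antidiagonal] at hp
      rw [← hp, map_add] at hm
      by_cases h : M < p.1.degree
      · rw [hM _ h, zero_mul]
      · rw [hN _ (by omega), mul_zero]
  add_mem' := by
    rintro f g ⟨hf, M, hM⟩ ⟨hg, N, hN⟩
    refine ⟨fun π hπ m => by rw [map_add, map_add, hf π hπ, hg π hπ], M + N, fun m hm => ?_⟩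
    rw [map_add, hM _ (by omega), hN _ (by omega), add_zero]
  algebraMap_mem' := by
    intro r
    rw [MvPowerSeries.algebraMap_apply, Algebra.algebraMap_self, RingHom.id_apply]
    refine ⟨fun π hπ m => ?_, 0, fun m hm => ?_⟩
    · rw [coeff_C, coeff_C]
      exact if_congr (map_eq_zero_iff _ (Finsupp.domCongr π).injective) rfl rfl
    · rw [coeff_C, if_neg]
      rintro rfl
      simp at hm

variable {R}

theorem coeff_eq_of_shape_eq {f : MvPowerSeries ℕ R} (hf : f ∈ symAlg R) {m m' : ℕ →₀ ℕ}
    (h : shape m = shape m') : coeff m f = coeff m' f := by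
  obtain ⟨π, h0, rfl⟩ := exists_perm_of_shape_eq h
  exact (hf.1 π h0 m).symm

theorem shape_domCongr {π : Equiv.Perm ℕ} (hπ : π 0 = 0) (m : ℕ →₀ ℕ) :
    shape (Finsupp.domCongr π m) = shape m := by
  obtain ⟨i, hi, hi0, h⟩ := exists_expo_shape m
  have hpos : ∀ j, 0 < (shape m).1.tail.get j := fun j => (shape m).1.tail_pos _ (List.get_mem _ _)
  have hm : Finsupp.domCongr π m =
      expo (shape m).1.head (fun j => π (i j)) (shape m).1.tail.get := by
    conv_lhs => rw [← h]
    rw [expo, expo, map_add, map_sum]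
    simp [hπ]
  have hπi : ∀ j, 0 < π (i j) := fun j => Nat.pos_of_ne_zero fun h0 =>
    (hi0 j).ne' (π.injective (h0.trans hπ.symm))
  rw [shape_eq_iff, hm, posValues_expo _ hπi (π.injective.comp hi) hpos, expo_zero _ _ hπi,
    List.ofFn_get]
  exact ⟨rfl, rfl⟩

theorem mem_symAlg_of_shape {f : MvPowerSeries ℕ R} (c : PseudoPart → R)
    (hf : ∀ m, coeff m f = c (shape m)) (N : ℕ) (hc : ∀ l : PseudoPart, N < l.1.size → c l = 0) :
    f ∈ symAlg R := by
  refine ⟨fun π hπ m => by rw [hf, hf, shape_domCongr hπ], N, fun m hm => ?_⟩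
  rw [hf, hc]
  rwa [size_shape]

variable (R) in
/-- The monomial series `mᴮ_λ` over an arbitrary ring of coefficients. -/
def mOver (l : PseudoPart) : MvPowerSeries ℕ R := fun m => if shape m = l then 1 else 0

theorem coeff_mOver (l : PseudoPart) (m : ℕ →₀ ℕ) :
    coeff m (mOver R l) = if shape m = l then 1 else 0 := rfl

theorem mOver_mem (l : PseudoPart) : mOver R l ∈ symAlg R :=
  mem_symAlg_of_shape (fun l' => if l' = l then 1 else 0) (coeff_mOver l) l.1.size
    fun l' h => if_neg fun h' => by rw [h'] at h; exact h.false

theorem finite_part_size_le (N : ℕ) : {l : PseudoPart | l.1.size ≤ N}.Finite :=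
  (PseudoComp.finite_size_le N).preimage Subtype.val_injective.injOn

variable (R) in
/-- The coefficients of a symmetric series with respect to the monomial series. -/
def symEquiv : Subalgebra.toSubmodule (symAlg R) ≃ₗ[R] (PseudoPart →₀ R) where
  -- The support is finite because `canon l` has degree the size of `l`, and the degree of `f` is
  -- bounded.
  toFun f := Finsupp.ofSupportFinite (fun l => coeff (canon l.1) f.1) (by
    obtain ⟨-, N, hN⟩ := f.2
    refine (finite_part_size_le N).subset fun l hl => ?_
    by_contra h
    exact hl (hN _ (by rw [degree_canon]; exact not_le.1 h)))
  map_add' f g := by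
    ext l
    rfl
  map_smul' r f := by
    ext l
    rfl
  invFun c := ⟨fun m => c (shape m), mem_symAlg_of_shape c (fun m => rfl)
    (c.support.sup fun l => l.1.size) (fun l hl => by
      by_contra h
      exact hl.not_ge (Finset.le_sup (f := fun l : PseudoPart => l.1.size) (Finsupp.mem_support_iff.2 h)))⟩
  left_inv f := by
    refine Subtype.ext ?_
    ext m
    exact coeff_eq_of_shape_eq f.2 (shape_canon_part _)
  right_inv c := by
    ext l
    exact congrArg c (shape_canon_part l)

variable (R) in
/-- The basis of monomial series. -/
def mBasis : Module.Basis PseudoPart R (Subalgebra.toSubmodule (symAlg R)) :=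
  Module.Basis.ofRepr (symEquiv R)

theorem mBasis_apply (l : PseudoPart) : (mBasis R l : MvPowerSeries ℕ R) = mOver R l := by
  have : mBasis R l = ⟨mOver R l, mOver_mem l⟩ := by
    rw [Module.Basis.apply_eq_iff]
    ext l'
    change coeff (canon l'.1) (mOver R l) = _
    rw [coeff_mOver, shape_canon_part, Finsupp.single_apply]
    exact if_congr eq_comm rfl rfl
  rw [this]

variable (R) in
theorem hPos_mem (k : ℕ) : hPos R k ∈ symAlg R := by
  refine ⟨fun π hπ m => ?_, k, fun m hm => ?_⟩
  · rw [coeff_hPos, coeff_hPos, domCongr_zero hπ, degree_domCongr]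
  · rw [coeff_hPos, if_neg]
    omega

variable (R) in
theorem hAll_mem (k : ℕ) : hAll R k ∈ symAlg R := by
  refine ⟨fun π hπ m => ?_, k, fun m hm => ?_⟩
  · rw [coeff_hAll, coeff_hAll, degree_domCongr]
  · rw [coeff_hAll, if_neg]
    omega

variable (R) in
theorem hDbl_mem (k : ℕ) : hDbl R k ∈ symAlg R :=
  Subalgebra.sum_mem _ fun _ _ => Subalgebra.mul_mem _ (hPos_mem R _) (hAll_mem R _)

variable (R) in
theorem hBOver_mem (α : PseudoComp) : hBOver R α ∈ symAlg R :=
  Subalgebra.mul_mem _ (hAll_mem R _) (Subalgebra.list_prod_mem _ fun f hf => by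
    obtain ⟨k, -, rfl⟩ := List.mem_map.1 hf
    exact hDbl_mem R k)

variable (R) in
theorem X_mem : (X 0 : MvPowerSeries ℕ R) ∈ symAlg R := by
  refine ⟨fun π hπ m => ?_, 1, fun m hm => ?_⟩
  · rw [coeff_X, coeff_X]
    refine if_congr ?_ rfl rfl
    conv_rhs => rw [← (Finsupp.domCongr π).injective.eq_iff]
    simp [hπ]
  · rw [coeff_X, if_neg]
    rintro rfl
    simp at hm

theorem coeff_mul_of_degree_ne {f g : MvPowerSeries ℕ R} {a b : ℕ}
    (hf : ∀ m : ℕ →₀ ℕ, m.degree ≠ a → coeff m f = 0)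
    (hg : ∀ m : ℕ →₀ ℕ, m.degree ≠ b → coeff m g = 0) (m : ℕ →₀ ℕ) (hm : m.degree ≠ a + b) :
    coeff m (f * g) = 0 := by
  rw [coeff_mul]
  refine Finset.sum_eq_zero fun p hp => ?_
  rw [mem_antidiagonal] at hp
  rw [← hp, map_add] at hm
  by_cases h : p.1.degree = a
  · rw [hg _ (by omega), mul_zero]
  · rw [hf _ h, zero_mul]

theorem coeff_hAll_of_degree_ne (k : ℕ) (m : ℕ →₀ ℕ) (hm : m.degree ≠ k) :
    coeff m (hAll R k) = 0 := by
  rw [coeff_hAll, if_neg hm]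

theorem coeff_hDbl_of_degree_ne (k : ℕ) (m : ℕ →₀ ℕ) (hm : m.degree ≠ k) :
    coeff m (hDbl R k) = 0 := by
  rw [hDbl, map_sum]
  refine Finset.sum_eq_zero fun p hp => ?_
  rw [mem_antidiagonal] at hp
  refine coeff_mul_of_degree_ne (a := p.1) (b := p.2) (fun m hm => ?_)
    (coeff_hAll_of_degree_ne _) m (by omega)
  rw [coeff_hPos, if_neg]
  exact fun h => hm h.2

/-- Homogeneity of hᴮ_α makes the transition matrix to the monomial series block diagonal, and makes
the form vanish between different sizes. -/
theorem coeff_hBOver_of_degree_ne (α : PseudoComp) (m : ℕ →₀ ℕ) (hm : m.degree ≠ α.size) :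
    coeff m (hBOver R α) = 0 := by
  refine coeff_mul_of_degree_ne (coeff_hAll_of_degree_ne _) (fun m hm => ?_) m hm
  generalize α.tail = t at hm
  induction t generalizing m with
  | nil =>
    rw [List.map_nil, List.prod_nil, coeff_one, if_neg]
    rintro rfl
    simp at hm
  | cons k t ih =>
    rw [List.map_cons, List.prod_cons]
    exact coeff_mul_of_degree_ne (coeff_hDbl_of_degree_ne k) (fun m hm => ih m hm) m
      (by simpa using hm)

end symmetric

/-! ### The series `mᴮ_λ` -/

/-- The pseudo-composition of exponents of a monomial. -/
def exponents (m : ℕ →₀ ℕ) : PseudoComp :=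
  ⟨m 0, ((posSupp m).sort (· ≤ ·)).map m, by
    intro a ha
    obtain ⟨c, hc, rfl⟩ := List.mem_map.1 ha
    exact Nat.pos_of_ne_zero (mem_posSupp.1 ((Finset.mem_sort _).1 hc)).2⟩

theorem toPart_exponents (m : ℕ →₀ ℕ) : (exponents m).toPart = shape m := by
  rw [PseudoComp.toPart_eq_iff]
  refine ⟨rfl, ?_⟩
  rw [← Multiset.coe_eq_coe, ← ((shape_eq_iff m _).1 rfl).2, posValues, exponents,
    ← Multiset.map_coe, Finset.sort_eq]

theorem sort_posSupp_eq {α : PseudoComp} {m : ℕ →₀ ℕ} {i : Fin α.tail.length → ℕ}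
    (hi : StrictMono i) (hi0 : ∀ j, 0 < i j) (h : expo α.head i α.tail.get = m) :
    (posSupp m).sort (· ≤ ·) = List.ofFn i := by
  refine List.Perm.eq_of_pairwise (le := (· ≤ ·)) (fun _ _ _ _ h h' => le_antisymm h h')
    (Finset.pairwise_sort _ _) ?_ ?_
  · rw [List.pairwise_ofFn]
    exact fun _ _ hab => (hi hab).le
  · rw [← h, posSupp_expo _ hi0 hi.injective fun j => α.tail_pos _ (List.get_mem _ _),
      ← Multiset.coe_eq_coe, Finset.sort_eq, Finset.map_val, ← Fin.univ_val_map]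
    rfl

/-- The indices `i` must enumerate the positive support in increasing order, so both `i` and the
sequence of exponents are determined by the monomial. -/
theorem MB_apply (α : PseudoComp) (m : ℕ →₀ ℕ) : MB α m = if α = exponents m then 1 else 0 := by
  change ((Nat.card {i : Fin α.tail.length → ℕ // StrictMono i ∧ (∀ j, 0 < i j) ∧
    expo α.head i α.tail.get = m} : ℕ) : ℤ) = _
  split_ifs with h
  · rw [Nat.cast_eq_one, Nat.card_eq_one_iff_unique]
    constructor
    · constructor
      rintro ⟨i, hi, hi0, h1⟩ ⟨i', hi', hi0', h1'⟩
      refine Subtype.ext (List.ofFn_injective ?_)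
      rw [← sort_posSupp_eq hi hi0 h1, ← sort_posSupp_eq hi' hi0' h1']
    · subst h
      set s := (posSupp m).sort (· ≤ ·) with hs
      have hlen : (exponents m).tail.length = s.length := by simp [exponents, hs]
      have hmono : StrictMono fun j : Fin (exponents m).tail.length => s.get (j.cast hlen) := by
        intro a b hab
        exact List.pairwise_iff_get.1 (Finset.sortedLT_sort (posSupp m)).pairwise
          (a.cast hlen) (b.cast hlen) hab
      obtain ⟨h1, h2⟩ := expo_eq (m := m) (a := (exponents m).tail.get) hmono.injective (fun c => by
          rw [← Finset.mem_sort (· ≤ ·), ← hs, List.mem_iff_get]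
          exact ⟨fun ⟨n, hn⟩ => ⟨n.cast hlen.symm, hn⟩, fun ⟨n, hn⟩ => ⟨n.cast hlen, hn⟩⟩)
        (fun j => by
          exact (List.getElem_map m).symm)
      exact ⟨⟨_, hmono, h1, h2⟩⟩
  · rw [Nat.cast_eq_zero, Nat.card_eq_zero]
    left
    constructor
    rintro ⟨i, hi, hi0, h1⟩
    apply h
    refine PseudoComp.ext ?_ ?_
    · change α.head = m 0
      rw [← h1, expo_zero _ _ hi0]
    · change α.tail = ((posSupp m).sort (· ≤ ·)).map m
      rw [sort_posSupp_eq hi hi0 h1, List.map_ofFn]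
      conv_lhs => rw [← List.ofFn_get α.tail]
      congr 1
      funext j
      rw [Function.comp_apply, ← h1, expo_apply _ _ hi0 hi.injective]

theorem mB_eq (l : PseudoPart) : mB l = mOver ℤ l := by
  have hfin : {α : PseudoComp | α.toPart = l}.Finite := by
    refine (PseudoComp.finite_size_le l.1.size).subset ?_
    rintro α rfl
    exact α.size_toPart.ge
  ext m
  rw [mB, finsum_mem_eq_finite_toFinset_sum _ hfin, map_sum, coeff_mOver]
  change ∑ α ∈ hfin.toFinset, MB α m = _
  simp only [MB_apply, Finset.sum_ite_eq', Set.Finite.mem_toFinset]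
  exact if_congr (by rw [← toPart_exponents]; rfl) rfl rfl

theorem map_mB (R : Type*) [CommRing R] (l : PseudoPart) :
    MvPowerSeries.map (Int.castRingHom R) (mB l) = mOver R l := by
  ext m
  rw [coeff_map, mB_eq, coeff_mOver, coeff_mOver]
  split_ifs <;> simp

/-! ### Power sums and augmented monomial series -/

section powersums

variable (R : Type*) [CommRing R]

/-- The power sum in `x₁, x₂, …`. -/
def pSum (b : ℕ) : MvPowerSeries ℕ R := fun m =>
  (((posSupp m).filter fun j => m = Finsupp.single j b).card : R)

/-- Choosing the monomial from the power sum amounts to choosing a variable x_j with j > 0 whose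
b-th power divides the given monomial. -/
theorem coeff_pSum_mul {b : ℕ} (hb : 0 < b) (f : MvPowerSeries ℕ R) (m : ℕ →₀ ℕ) :
    coeff m (pSum R b * f) =
      ∑ j ∈ (posSupp m).filter (b ≤ m ·), coeff (m - Finsupp.single j b) f := by
  have h1 : ∀ u, coeff u (pSum R b) = ∑ j ∈ posSupp u with u = Finsupp.single j b, (1 : R) := by
    intro u
    rw [Finset.sum_const, nsmul_one]
    rfl
  rw [coeff_mul]
  simp only [h1, Finset.sum_mul, one_mul]
  rw [Finset.sum_sigma']
  refine Finset.sum_bij' (fun x _ => x.2)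
    (fun j _ => ⟨(Finsupp.single j b, m - Finsupp.single j b), j⟩) ?_ ?_ ?_ ?_ ?_
  · rintro ⟨⟨u, v⟩, j⟩ h
    simp only [mem_sigma, mem_antidiagonal, Finset.mem_filter, mem_posSupp] at h ⊢
    obtain ⟨h, ⟨hj, -⟩, rfl⟩ := h
    have : b ≤ m j := by rw [← h]; simp
    exact ⟨⟨hj, by omega⟩, this⟩
  · intro j h
    simp only [mem_sigma, mem_antidiagonal, Finset.mem_filter, mem_posSupp] at h ⊢
    refine ⟨add_tsub_cancel_of_le (Finsupp.single_le_iff.2 h.2), ⟨h.1.1, ?_⟩, trivial⟩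
    simpa using hb.ne'
  · rintro ⟨⟨u, v⟩, j⟩ h
    simp only [mem_sigma, mem_antidiagonal, Finset.mem_filter, mem_posSupp] at h
    obtain ⟨rfl, ⟨hj, -⟩, rfl⟩ := h
    simp
  · intro j _
    rfl
  · rintro ⟨⟨u, v⟩, j⟩ h
    simp only [mem_sigma, mem_antidiagonal, Finset.mem_filter, mem_posSupp] at h
    obtain ⟨rfl, ⟨hj, -⟩, rfl⟩ := h
    simp

theorem degree_sub_single {m : ℕ →₀ ℕ} {j b : ℕ} (h : b ≤ m j) :
    (m - Finsupp.single j b).degree + b = m.degree := by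
  conv_rhs => rw [← tsub_add_cancel_of_le (Finsupp.single_le_iff.2 h), map_add]
  simp

/-- Newton's identity. -/
theorem hPos_newton (n : ℕ) :
    hPos R (n + 1) * ((n : MvPowerSeries ℕ R) + 1) =
      ∑ p ∈ antidiagonal n, pSum R (p.1 + 1) * hPos R p.2 := by
  ext m
  have h0 : ((n : MvPowerSeries ℕ R) + 1) = C ((n : R) + 1) := by simp
  rw [h0, mul_comm, coeff_C_mul, map_sum, coeff_hPos, Finset.Nat.sum_antidiagonal_eq_sum_range_succ_mk]
  simp only [coeff_pSum_mul R (Nat.succ_pos _), coeff_hPos]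
  -- Removing a power of x_j with j > 0 does not affect the exponent of x₀. So the right side counts
  -- pairs (j, i) with i < m j, and for m free of x₀ and of degree n + 1 there are n + 1 of them.
  have h1 : ∀ i ∈ Finset.range n.succ, ∀ j ∈ (posSupp m).filter (i + 1 ≤ m ·),
      (if (m - Finsupp.single j (i + 1)) 0 = 0 ∧ (m - Finsupp.single j (i + 1)).degree = n - i
        then (1 : R) else 0) = if m 0 = 0 ∧ m.degree = n + 1 then 1 else 0 := by
    intro i hi j hj
    rw [Finset.mem_filter, mem_posSupp] at hj
    have h2 := degree_sub_single hj.2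
    have h3 : (m - Finsupp.single j (i + 1)) 0 = m 0 := by
      rw [Finsupp.tsub_apply, Finsupp.single_eq_of_ne hj.1.1.ne, tsub_zero]
    rw [Finset.mem_range] at hi
    rw [h3]
    refine if_congr (and_congr Iff.rfl ?_) rfl rfl
    omega
  rw [Finset.sum_congr rfl fun i hi => Finset.sum_congr rfl (h1 i hi)]
  split_ifs with h
  · simp only [Finset.sum_filter]
    rw [Finset.sum_comm]
    have h4 : ∀ j ∈ posSupp m, ∑ i ∈ Finset.range n.succ, (if i + 1 ≤ m j then (1 : R) else 0)
        = (m j : R) := by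
      intro j _
      rw [← Finset.sum_filter, Finset.sum_const, nsmul_one]
      congr 1
      have : (Finset.range n.succ).filter (fun i => i + 1 ≤ m j) = Finset.range (m j) := by
        ext i
        have : m j ≤ m.degree := Finsupp.le_degree j m
        simp only [Finset.mem_filter, Finset.mem_range]
        omega
      rw [this, Finset.card_range]
    rw [Finset.sum_congr rfl h4, ← Nat.cast_sum, mul_one, ← Nat.cast_succ]
    congr 1
    rw [Nat.succ_eq_add_one, ← h.2, Finsupp.degree, posSupp]
    rw [Finset.sum_erase _ h.1]
    rfl
  · simp

/-- The augmented monomial series `∑ x₀ᵏ x_{i₁}^{a₁} ⋯ x_{i_r}^{a_r}`, the sum over distinct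
positive `i₁, …, i_r`. -/
def augMono (k : ℕ) {r : ℕ} (a : Fin r → ℕ) : MvPowerSeries ℕ R := fun m =>
  (Nat.card {i : Fin r → ℕ // Function.Injective i ∧ (∀ j, 0 < i j) ∧ expo k i a = m} : R)

theorem coeff_augMono (k : ℕ) {r : ℕ} (a : Fin r → ℕ) (m : ℕ →₀ ℕ) :
    coeff m (augMono R k a) = ({i : Fin r → ℕ | Function.Injective i ∧ (∀ j, 0 < i j) ∧
      expo k i a = m}.ncard : R) := by
  rw [← Nat.card_coe_set_eq]
  rfl

theorem finite_expo (k : ℕ) {r : ℕ} {a : Fin r → ℕ} (ha : ∀ j, 0 < a j) (m : ℕ →₀ ℕ) :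
    {i : Fin r → ℕ | Function.Injective i ∧ (∀ j, 0 < i j) ∧ expo k i a = m}.Finite := by
  refine (Set.Finite.pi' (fun _ : Fin r => (posSupp m).finite_toSet)).subset ?_
  rintro i ⟨h1, h2, rfl⟩ j
  rw [Finset.mem_coe, mem_posSupp, expo_apply _ _ h2 h1]
  exact ⟨h2 j, (ha j).ne'⟩

theorem expo_add_single (k : ℕ) {r : ℕ} (i a : Fin r → ℕ) (j : Fin r) (b : ℕ) :
    expo k i (Function.update a j (a j + b)) = expo k i a + Finsupp.single (i j) b := by
  rw [expo, expo, add_assoc]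
  congr 1
  rw [← Finset.add_sum_erase _ _ (Finset.mem_univ j),
    ← Finset.add_sum_erase _ (fun j => Finsupp.single (i j) (a j)) (Finset.mem_univ j)]
  rw [Function.update_self, Finsupp.single_add]
  rw [Finset.sum_congr (g := fun j => Finsupp.single (i j) (a j)) rfl (fun l hl => by
    rw [Function.update_of_ne (Finset.ne_of_mem_erase hl)])]
  abel

/-- The index contributed by the power sum is either new, giving a longer tuple, or equal to some
i_j, in which case b is added to the exponent a_j. -/
theorem pSum_mul_augMono (k : ℕ) {r : ℕ} {a : Fin r → ℕ} (ha : ∀ j, 0 < a j) {b : ℕ} (hb : 0 < b) :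
    pSum R b * augMono R k a = augMono R k (Fin.cons b a : Fin (r + 1) → ℕ) +
      ∑ j, augMono R k (Function.update a j (a j + b)) := by
  ext m
  rw [coeff_pSum_mul R hb, map_add, map_sum]
  have hcons : ∀ j, 0 < (Fin.cons b a : Fin (r + 1) → ℕ) j := by
    intro j
    refine Fin.cases ?_ (fun j => ?_) j
    exacts [hb, ha j]
  have hupd : ∀ l j, 0 < Function.update a l (a l + b) j := by
    intro l j
    rw [Function.update_apply]
    split_ifs
    · omega
    · exact ha j
  simp only [coeff_augMono]
  simp only [Set.ncard_eq_toFinset_card _ (finite_expo k ha _),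
    Set.ncard_eq_toFinset_card _ (finite_expo k hcons _),
    Set.ncard_eq_toFinset_card _ (finite_expo k (hupd _) _)]
  rw [← Nat.cast_sum, ← Nat.cast_sum, ← Nat.cast_add]
  congr 1
  rw [← Finset.card_sigma, ← Finset.card_sigma, ← Finset.card_disjSum]
  have key : ∀ (j : ℕ) (i : Fin r → ℕ), b ≤ m j →
      (expo k i a = m - Finsupp.single j b ↔ expo k i a + Finsupp.single j b = m) := by
    intro j i h
    have h' := Finsupp.single_le_iff.2 h
    exact ⟨fun h => by rw [h, tsub_add_cancel_of_le h'],
      fun h => by rw [← h, add_tsub_cancel_right]⟩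
  have hexpo : ∀ (j : ℕ) (i : Fin r → ℕ), expo k (Fin.cons j i : Fin (r + 1) → ℕ)
      (Fin.cons b a : Fin (r + 1) → ℕ) = expo k i a + Finsupp.single j b := by
    intro j i
    rw [expo, expo, Fin.sum_univ_succ]
    simp only [Fin.cons_zero, Fin.cons_succ]
    abel
  symm
  refine Finset.card_bij (fun x _ => Sum.elim (fun i => ⟨i 0, fun j => i j.succ⟩)
    (fun y => ⟨y.2 y.1, y.2⟩) x) ?_ ?_ ?_
  · rintro (i | ⟨l, i⟩) h
    · simp only [Finset.inl_mem_disjSum, Set.Finite.mem_toFinset, Set.mem_ofPred_eq] at h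
      obtain ⟨h1, h2, h3⟩ := h
      rw [← Fin.cons_self_tail i, hexpo] at h3
      have h4 : b ≤ m (i 0) := by
        rw [← h3]
        simp
      simp only [Sum.elim_inl, Finset.mem_sigma, Finset.mem_filter, mem_posSupp,
        Set.Finite.mem_toFinset, Set.mem_ofPred_eq]
      exact ⟨⟨⟨h2 0, by omega⟩, h4⟩, fun x y h => Fin.succ_injective _ (h1 h), fun j => h2 _,
        (key _ _ h4).2 h3⟩
    · simp only [Finset.inr_mem_disjSum, Finset.mem_sigma, Finset.mem_univ, true_and,
        Set.Finite.mem_toFinset, Set.mem_ofPred_eq] at h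
      obtain ⟨h1, h2, h3⟩ := h
      rw [expo_add_single] at h3
      have h4 : b ≤ m (i l) := by
        rw [← h3]
        simp
      simp only [Sum.elim_inr, Finset.mem_sigma, Finset.mem_filter, mem_posSupp,
        Set.Finite.mem_toFinset, Set.mem_ofPred_eq]
      exact ⟨⟨⟨h2 l, by omega⟩, h4⟩, h1, h2, (key _ _ h4).2 h3⟩
  · rintro (i | ⟨l, i⟩) h (i' | ⟨l', i'⟩) h' heq
    · simp only [Sum.elim_inl, Sigma.mk.injEq, heq_eq_eq] at heq
      congr 1
      funext j
      refine Fin.cases heq.1 (fun j => congrFun heq.2 j) j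
    · simp only [Finset.inl_mem_disjSum, Set.Finite.mem_toFinset, Set.mem_ofPred_eq] at h
      simp only [Sum.elim_inl, Sum.elim_inr, Sigma.mk.injEq, heq_eq_eq] at heq
      obtain ⟨h1, rfl⟩ := heq
      exact absurd (h.1 h1) (Fin.succ_ne_zero _).symm
    · simp only [Finset.inl_mem_disjSum, Set.Finite.mem_toFinset, Set.mem_ofPred_eq] at h'
      simp only [Sum.elim_inl, Sum.elim_inr, Sigma.mk.injEq, heq_eq_eq] at heq
      obtain ⟨h1, rfl⟩ := heq
      exact absurd (h'.1 h1) (Fin.succ_ne_zero _)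
    · simp only [Finset.inr_mem_disjSum, Finset.mem_sigma, Finset.mem_univ, true_and,
        Set.Finite.mem_toFinset, Set.mem_ofPred_eq] at h
      simp only [Sum.elim_inr, Sigma.mk.injEq, heq_eq_eq] at heq
      obtain ⟨h1, rfl⟩ := heq
      rw [h.1 h1]
  · rintro ⟨j, i⟩ h
    simp only [Finset.mem_sigma, Finset.mem_filter, mem_posSupp, Set.Finite.mem_toFinset,
      Set.mem_ofPred_eq] at h
    obtain ⟨⟨⟨hj, -⟩, hb⟩, h1, h2, h3⟩ := h
    rw [key _ _ hb] at h3
    by_cases hl : ∃ l, i l = j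
    · obtain ⟨l, rfl⟩ := hl
      refine ⟨Sum.inr ⟨l, i⟩, ?_, rfl⟩
      simp only [Finset.inr_mem_disjSum, Finset.mem_sigma, Finset.mem_univ, true_and,
        Set.Finite.mem_toFinset, Set.mem_ofPred_eq]
      exact ⟨h1, h2, by rw [expo_add_single, h3]⟩
    · refine ⟨Sum.inl (Fin.cons j i), ?_, rfl⟩
      simp only [Finset.inl_mem_disjSum, Set.Finite.mem_toFinset, Set.mem_ofPred_eq]
      refine ⟨Fin.cons_injective_iff.2 ⟨hl, h1⟩, ?_, by rw [hexpo, h3]⟩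
      intro j
      refine Fin.cases ?_ (fun j => ?_) j
      exacts [hj, h2 j]

/-- The algebra generated by `x₀` and the power sums. -/
def powerAlg : Subalgebra R (MvPowerSeries ℕ R) :=
  Algebra.adjoin R (insert (X 0) (Set.range fun n => pSum R (n + 1)))

theorem pSum_mem_powerAlg {b : ℕ} (hb : 0 < b) : pSum R b ∈ powerAlg R := by
  obtain ⟨n, rfl⟩ := Nat.exists_eq_add_of_lt hb
  rw [zero_add]
  exact Algebra.subset_adjoin (Set.mem_insert_of_mem _ ⟨n, rfl⟩)

/-- Induction on the number of exponents: `pSum_mul_augMono` expresses the longer augmented series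
through shorter ones and a power sum. No division is needed. -/
theorem augMono_mem (k : ℕ) {r : ℕ} {a : Fin r → ℕ} (ha : ∀ j, 0 < a j) :
    augMono R k a ∈ powerAlg R := by
  induction r with
  | zero =>
    have : augMono R k a = X 0 ^ k := by
      ext m
      rw [X_pow_eq, coeff_monomial]
      change (Nat.card {i : Fin 0 → ℕ // Function.Injective i ∧ (∀ j, 0 < i j) ∧
        expo k i a = m} : R) = _
      have hexpo : ∀ i : Fin 0 → ℕ, expo k i a = Finsupp.single 0 k := by
        intro i
        simp [expo]
      split_ifs with h
      · rw [Nat.card_eq_one_iff_unique.2 ⟨inferInstance, ⟨⟨Fin.elim0, fun j => j.elim0,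
          fun j => j.elim0, by rw [hexpo, h]⟩⟩⟩, Nat.cast_one]
      · rw [Nat.card_eq_zero.2 (Or.inl ⟨fun i => h (by rw [← i.2.2.2, hexpo])⟩), Nat.cast_zero]
    rw [this]
    exact Subalgebra.pow_mem _ (Algebra.subset_adjoin (Set.mem_insert _ _)) _
  | succ r ih =>
    have h := pSum_mul_augMono R k (a := fun j => a j.succ) (fun j => ha _) (ha 0)
    have h2 : (Fin.cons (a 0) (fun j => a j.succ) : Fin (r + 1) → ℕ) = a := Fin.cons_self_tail a
    rw [h2, ← sub_eq_iff_eq_add] at h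
    rw [← h]
    refine Subalgebra.sub_mem _ (Subalgebra.mul_mem _ (pSum_mem_powerAlg R (ha 0))
      (ih fun j => ha _)) (Subalgebra.sum_mem _ fun l _ => ih ?_)
    intro j
    rw [Function.update_apply]
    split_ifs
    · have := ha 0
      omega
    · exact ha _

theorem coeff_augMono_domCongr (k : ℕ) {r : ℕ} (a : Fin r → ℕ) {π : Equiv.Perm ℕ} (hπ : π 0 = 0)
    (m : ℕ →₀ ℕ) : coeff (Finsupp.domCongr π m) (augMono R k a) = coeff m (augMono R k a) := by
  change (Nat.card {i : Fin r → ℕ // Function.Injective i ∧ (∀ j, 0 < i j) ∧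
      expo k i a = Finsupp.domCongr π m} : R) =
    (Nat.card {i : Fin r → ℕ // Function.Injective i ∧ (∀ j, 0 < i j) ∧ expo k i a = m} : R)
  congr 1
  symm
  refine Nat.card_congr (((Equiv.refl (Fin r)).arrowCongr π).subtypeEquiv fun i => ?_)
  have hpos : ∀ c, 0 < π c ↔ 0 < c := by
    intro c
    rw [Nat.pos_iff_ne_zero, Nat.pos_iff_ne_zero, not_iff_not]
    exact ⟨fun h => π.injective (h.trans hπ.symm), fun h => by rw [h, hπ]⟩
  have hexpo : expo k (fun j => π (i j)) a = Finsupp.domCongr π (expo k i a) := by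
    rw [expo, expo, map_add, map_sum]
    simp [hπ]
  refine and_congr (π.injective.of_comp_iff i).symm (and_congr ?_ ?_)
  · exact forall_congr' fun j => (hpos _).symm
  · change _ ↔ expo k (fun j => π (i j)) a = _
    rw [hexpo, (Finsupp.domCongr π).injective.eq_iff]

end powersums

/-- The augmented series counts every monomial of shape `l` the same positive number of times;
characteristic zero allows division by this multiplicity. -/
theorem mOver_mem_powerAlg (K : Type*) [Field K] [CharZero K] (l : PseudoPart) :
    mOver K l ∈ powerAlg K := by
  have hpos : ∀ j, 0 < l.1.tail.get j := fun j => l.1.tail_pos _ (List.get_mem _ _)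
  set c := coeff (canon l.1) (augMono K l.1.head l.1.tail.get) with hc
  have hc0 : c ≠ 0 := by
    change (Nat.card {i : Fin l.1.tail.length → ℕ // Function.Injective i ∧ (∀ j, 0 < i j) ∧
      expo l.1.head i l.1.tail.get = canon l.1} : K) ≠ 0
    rw [Nat.cast_ne_zero]
    have : Finite {i : Fin l.1.tail.length → ℕ // Function.Injective i ∧ (∀ j, 0 < i j) ∧
      expo l.1.head i l.1.tail.get = canon l.1} := (finite_expo _ hpos _).to_subtype
    rw [Nat.card_ne_zero]
    -- The enumeration j ↦ j + 1 is the one that defines `canon`.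
    refine ⟨⟨⟨fun j => j + 1, ?_, by simp, rfl⟩⟩, this⟩
    intro a b h
    simpa [Fin.val_inj] using h
  have : mOver K l = c⁻¹ • augMono K l.1.head l.1.tail.get := by
    ext m
    rw [coeff_mOver, coeff_smul]
    split_ifs with h
    · obtain ⟨π, hπ, hm⟩ := exists_perm_of_shape_eq ((shape_canon_part l).trans h.symm)
      rw [← hm, coeff_augMono_domCongr K _ _ hπ, ← hc, inv_mul_cancel₀ hc0]
    · rw [show coeff m (augMono K l.1.head l.1.tail.get) = 0 from ?_, mul_zero]
      change (Nat.card {i : Fin l.1.tail.length → ℕ // Function.Injective i ∧ (∀ j, 0 < i j) ∧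
        expo l.1.head i l.1.tail.get = m} : K) = 0
      rw [Nat.cast_eq_zero, Nat.card_eq_zero]
      left
      constructor
      rintro ⟨i, h1, h2, rfl⟩
      apply h
      rw [shape_eq_iff, posValues_expo _ h2 h1 hpos, expo_zero _ _ h2, List.ofFn_get]
      exact ⟨rfl, rfl⟩
  rw [this]
  exact Subalgebra.smul_mem _ (augMono_mem K _ hpos) _

/-! ### The span of the `hᴮ_α` over a field of characteristic zero -/

section ode

variable (K : Type*) [Field K] {A : Type*} [CommRing A] [Algebra K A]

/-- The coefficients of the solution of `S' = F S`, `S(0) = 1`. -/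
def odeSol (F : PowerSeries A) : ℕ → A
  | 0 => 1
  | n + 1 => ((n : K) + 1)⁻¹ • ∑ i : Fin (n + 1), PowerSeries.coeff (n - i.1) F * odeSol F i.1

theorem odeSol_mem (B : Subalgebra K A) (F : PowerSeries A) (hF : ∀ n, PowerSeries.coeff n F ∈ B)
    (n : ℕ) : odeSol K F n ∈ B := by
  induction n using Nat.strong_induction_on with
  | _ n ih =>
    cases n with
    | zero => rw [odeSol]; exact B.one_mem
    | succ n =>
      rw [odeSol]
      exact B.smul_mem (B.sum_mem fun (i : Fin (n + 1)) _ => B.mul_mem (hF _) (ih i.1 i.2)) _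

theorem derivative_odeSol [CharZero K] (F : PowerSeries A) :
    PowerSeries.derivative A (PowerSeries.mk (odeSol K F)) = F * PowerSeries.mk (odeSol K F) := by
  ext n
  rw [PowerSeries.coeff_derivative, PowerSeries.coeff_mk, odeSol, mul_comm F,
    PowerSeries.coeff_mul,
    Finset.Nat.sum_antidiagonal_eq_sum_range_succ_mk, Finset.sum_range]
  have h : (n : K) + 1 ≠ 0 := by exact_mod_cast n.succ_ne_zero
  have h' : (n : A) + 1 = algebraMap K A ((n : K) + 1) := by simp
  rw [h', mul_comm, ← Algebra.smul_def, smul_smul, mul_inv_cancel₀ h, one_smul]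
  refine Finset.sum_congr rfl fun i _ => ?_
  rw [PowerSeries.coeff_mk, mul_comm]

end ode

/-! ### Generating series and their logarithmic derivatives -/

section generating

variable (R : Type*) [CommRing R]

theorem hPos_zero : hPos R 0 = 1 := by
  ext m
  rw [coeff_hPos, coeff_one]
  refine if_congr ?_ rfl rfl
  rw [Finsupp.degree_eq_zero_iff]
  exact ⟨fun h => h.2, fun h => ⟨by rw [h]; rfl, h⟩⟩

theorem hAll_zero : hAll R 0 = 1 := by
  ext m
  rw [coeff_hAll, coeff_one]
  exact if_congr (Finsupp.degree_eq_zero_iff m) rfl rfl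

theorem hDbl_zero : hDbl R 0 = 1 := by
  rw [hDbl, Finset.Nat.antidiagonal_zero, Finset.sum_singleton, hPos_zero, hAll_zero, one_mul]

theorem derivative_mk_hPos :
    PowerSeries.derivative _ (PowerSeries.mk (hPos R)) =
      PowerSeries.mk (fun n => pSum R (n + 1)) * PowerSeries.mk (hPos R) := by
  ext1 n
  rw [PowerSeries.coeff_derivative, PowerSeries.coeff_mul, PowerSeries.coeff_mk, hPos_newton]
  simp only [PowerSeries.coeff_mk]

/-- The extra variable x₀ multiplies the generating series by 1/(1 - x₀t), whose logarithmic
derivative is ∑ x₀ⁿ⁺¹ tⁿ. -/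
theorem derivative_mk_hAll :
    PowerSeries.derivative _ (PowerSeries.mk (hAll R)) =
      (PowerSeries.mk (fun n => X 0 ^ (n + 1)) + PowerSeries.mk (fun n => pSum R (n + 1))) *
        PowerSeries.mk (hAll R) := by
  have h1 : PowerSeries.mk (hAll R) =
      PowerSeries.mk (fun n => (X 0 : MvPowerSeries ℕ R) ^ n) * PowerSeries.mk (hPos R) := by
    ext1 n
    rw [PowerSeries.coeff_mul, PowerSeries.coeff_mk, hAll_eq]
    simp only [PowerSeries.coeff_mk]
  have h2 : PowerSeries.derivative _ (PowerSeries.mk (fun n => (X 0 : MvPowerSeries ℕ R) ^ n)) =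
      PowerSeries.mk (fun n => X 0 ^ (n + 1)) *
        PowerSeries.mk (fun n => (X 0 : MvPowerSeries ℕ R) ^ n) := by
    ext1 n
    rw [PowerSeries.coeff_derivative, PowerSeries.coeff_mul, PowerSeries.coeff_mk]
    simp only [PowerSeries.coeff_mk]
    rw [Finset.sum_congr rfl (g := fun _ => (X 0 : MvPowerSeries ℕ R) ^ (n + 1)),
      Finset.sum_const, Finset.Nat.card_antidiagonal, nsmul_eq_mul, Nat.cast_add, Nat.cast_one,
      mul_comm]
    intro p hp
    rw [mem_antidiagonal] at hp
    rw [← pow_add, ← hp]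
    congr 1
    omega
  rw [h1, Derivation.leibniz, h2, derivative_mk_hPos, smul_eq_mul, smul_eq_mul]
  ring

theorem derivative_mk_hDbl :
    PowerSeries.derivative _ (PowerSeries.mk (hDbl R)) =
      (PowerSeries.mk (fun n => X 0 ^ (n + 1)) + 2 * PowerSeries.mk (fun n => pSum R (n + 1))) *
        PowerSeries.mk (hDbl R) := by
  have h1 : PowerSeries.mk (hDbl R) = PowerSeries.mk (hPos R) * PowerSeries.mk (hAll R) := by
    ext1 n
    rw [PowerSeries.coeff_mul, PowerSeries.coeff_mk, hDbl]
    simp only [PowerSeries.coeff_mk]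
  rw [h1, Derivation.leibniz, derivative_mk_hAll, derivative_mk_hPos, smul_eq_mul, smul_eq_mul]
  ring

/-- The span of all `hᴮ_α`. -/
def hBSpan : Submodule R (MvPowerSeries ℕ R) := Submodule.span R (Set.range (hBOver R))

/-- The algebra generated by the images of the `𝐡_k`. -/
def dblAlg : Subalgebra R (MvPowerSeries ℕ R) := Algebra.adjoin R (Set.range (hDbl R))

theorem hDbl_mem_dblAlg (k : ℕ) : hDbl R k ∈ dblAlg R := Algebra.subset_adjoin ⟨k, rfl⟩

variable {R}

/-- Multiplication by `hDbl R k` appends the part k, so the span is a module over `dblAlg`. The case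
k = 0 is separate, since 0 is not an admissible part, but there the factor is 1. -/
theorem mul_mem_hBSpan {f g : MvPowerSeries ℕ R} (hf : f ∈ hBSpan R) (hg : g ∈ dblAlg R) :
    f * g ∈ hBSpan R := by
  induction hg using Algebra.adjoin_induction generalizing f with
  | mem x hx =>
    obtain ⟨k, rfl⟩ := hx
    rcases Nat.eq_zero_or_pos k with rfl | hk
    · rwa [hDbl_zero, mul_one]
    · induction hf using Submodule.span_induction with
      | mem y hy =>
        obtain ⟨α, rfl⟩ := hy
        refine Submodule.subset_span ⟨α.snoc k hk, ?_⟩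
        simp [hBOver, PseudoComp.snoc, mul_assoc]
      | zero => rw [zero_mul]; exact Submodule.zero_mem _
      | add y z _ _ hy hz => rw [add_mul]; exact Submodule.add_mem _ hy hz
      | smul r y _ hy => rw [smul_mul_assoc]; exact Submodule.smul_mem _ _ hy
  | algebraMap r =>
    rw [mul_comm, ← Algebra.smul_def]
    exact Submodule.smul_mem _ _ hf
  | add x y _ _ hx hy => rw [mul_add]; exact Submodule.add_mem _ (hx hf) (hy hf)
  | mul x y _ _ hx hy => rw [← mul_assoc]; exact hy (hx hf)

variable (R) in
/-- The type `B` power sums lie in the algebra generated by the images of the `𝐡_k`. -/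
theorem pSumB_mem_dblAlg (n : ℕ) : X 0 ^ (n + 1) + 2 * pSum R (n + 1) ∈ dblAlg R := by
  induction n using Nat.strong_induction_on with
  | _ n ih =>
    have h := congrArg (PowerSeries.coeff n) (derivative_mk_hDbl R)
    rw [PowerSeries.coeff_derivative, PowerSeries.coeff_mul, PowerSeries.coeff_mk] at h
    have hc : ∀ i, PowerSeries.coeff i (PowerSeries.mk (fun n => (X 0 : MvPowerSeries ℕ R) ^ (n + 1)) +
        2 * PowerSeries.mk (fun n => pSum R (n + 1))) = X 0 ^ (i + 1) + 2 * pSum R (i + 1) := by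
      intro i
      rw [two_mul, two_mul]
      simp only [map_add, PowerSeries.coeff_mk]
    simp only [hc, PowerSeries.coeff_mk] at h
    rw [Finset.Nat.sum_antidiagonal_eq_sum_range_succ_mk, Finset.sum_range_succ] at h
    dsimp only at h
    -- In the coefficient of tⁿ the last summand is the new power sum times `hDbl R 0` = 1; the
    -- other summands are covered by induction.
    rw [Nat.sub_self, hDbl_zero, mul_one, ← sub_eq_iff_eq_add'] at h
    rw [← h]
    refine Subalgebra.sub_mem _ (Subalgebra.mul_mem _ (hDbl_mem_dblAlg R _) ?_)
      (Subalgebra.sum_mem _ fun i hi => Subalgebra.mul_mem _ (ih i (Finset.mem_range.1 hi))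
        (hDbl_mem_dblAlg R _))
    exact Subalgebra.add_mem _ (Subalgebra.natCast_mem _ n) (Subalgebra.one_mem _)

end generating

/-! ### The transition map from the hᴮ_λ to the monomial series -/

section transition

variable (R : Type*) [CommRing R]

/-- The linear map sending the basis vector `λ` to `hᴮ_λ` in the basis of monomial series. -/
def hToM : (PseudoPart →₀ R) →ₗ[R] (PseudoPart →₀ R) :=
  Finsupp.linearCombination R fun l => symEquiv R ⟨hBOver R l.1, hBOver_mem R l.1⟩

theorem hBSpan_eq_span_part :
    hBSpan R = Submodule.span R (Set.range fun l : PseudoPart => hBOver R l.1) := by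
  rw [hBSpan]
  congr 1
  refine subset_antisymm ?_ ?_
  · rintro _ ⟨α, rfl⟩
    exact ⟨α.toPart, hBOver_toPart R α⟩
  · rintro _ ⟨l, rfl⟩
    exact ⟨l.1, rfl⟩

theorem symEquiv_symm_hToM (u : PseudoPart →₀ R) :
    ((symEquiv R).symm (hToM R u)).1 =
      Finsupp.linearCombination R (fun l : PseudoPart => hBOver R l.1) u := by
  induction u using Finsupp.induction_linear with
  | zero => simp
  | add u v hu hv => rw [map_add, map_add, map_add, ← hu, ← hv]; rfl
  | single l c =>
    rw [hToM, Finsupp.linearCombination_single, Finsupp.linearCombination_single, map_smul,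
      LinearEquiv.symm_apply_apply]
    rfl

theorem hToM_apply_eq_zero {u : PseudoPart →₀ R} {n : ℕ} (hu : ∀ l : PseudoPart, l.1.size = n → u l = 0)
    (l' : PseudoPart) (hl' : l'.1.size = n) : hToM R u l' = 0 := by
  rw [hToM, Finsupp.linearCombination_apply, Finsupp.sum_apply]
  refine Finset.sum_eq_zero fun l _ => ?_
  change u l * coeff (canon l'.1) (hBOver R l.1) = 0
  by_cases h : l.1.size = n
  · rw [hu l h, zero_mul]
  · rw [coeff_hBOver_of_degree_ne, mul_zero]
    rw [degree_canon, hl']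
    exact fun h' => h h'.symm

end transition

section field

variable (K : Type*) [Field K] [CharZero K]

/-- Formally S is hDbl(t)^(-1/2), constructed from its differential equation, and Y = hAll(t) · S is
(1 - x₀t)^(-1/2). The coefficients of S lie in `dblAlg`, so those of Y lie in the span. -/
theorem X_pow_mem_hBSpan (n : ℕ) : (X 0 : MvPowerSeries ℕ K) ^ n ∈ hBSpan K := by
  set P := PowerSeries.mk (fun n => pSum K (n + 1)) with hP
  set Z := PowerSeries.mk (fun n => (X 0 : MvPowerSeries ℕ K) ^ (n + 1)) with hZ
  set F := (-(2 : K)⁻¹) • (Z + 2 * P) with hF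
  set S := PowerSeries.mk (odeSol K F) with hS
  set Y := PowerSeries.mk (hAll K) * S with hY
  have hFm : ∀ n, PowerSeries.coeff n F ∈ dblAlg K := by
    intro n
    have : PowerSeries.coeff n F = (-(2 : K)⁻¹) • (X 0 ^ (n + 1) + 2 * pSum K (n + 1)) := by
      rw [hF, two_mul, two_mul]
      change (-(2 : K)⁻¹) • PowerSeries.coeff n (Z + (P + P)) = _
      rw [map_add, map_add, hP, hZ, PowerSeries.coeff_mk, PowerSeries.coeff_mk]
    rw [this]
    exact Subalgebra.smul_mem _ (pSumB_mem_dblAlg K n) _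
  have hYm : ∀ n, PowerSeries.coeff n Y ∈ hBSpan K := by
    intro n
    rw [hY, PowerSeries.coeff_mul]
    refine Submodule.sum_mem _ fun p _ => mul_mem_hBSpan ?_ ?_
    · refine Submodule.subset_span ⟨PseudoComp.single p.1, ?_⟩
      simp [hBOver, PseudoComp.single]
    · rw [hS, PowerSeries.coeff_mk]
      exact odeSol_mem K _ F hFm _
  have hdY : PowerSeries.derivative _ Y = ((2 : K)⁻¹) • (Z * Y) := by
    have h2 : ((2 : K)⁻¹) • (2 : PowerSeries (MvPowerSeries ℕ K)) = 1 := by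
      rw [← one_add_one_eq_two, ← one_add_one_eq_two, smul_add, ← add_smul]
      norm_num
    have hz : Z + P + F = (2 : K)⁻¹ • Z := by
      have e1 : (2 : K)⁻¹ • (2 * P) = P := by rw [← smul_mul_assoc, h2, one_mul]
      have e2 : Z = (2 : K)⁻¹ • Z + (2 : K)⁻¹ • Z := by rw [← add_smul]; norm_num
      rw [hF, neg_smul, smul_add, e1]
      nth_rewrite 1 [e2]
      abel
    rw [hY, Derivation.leibniz, derivative_odeSol, derivative_mk_hAll, smul_eq_mul, smul_eq_mul,
      ← smul_mul_assoc, ← hz]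
    ring
  -- Y' = ½ZY gives (n + 1) cₙ₊₁ = ½(c₀ + ⋯ + cₙ). Positivity of the cₙ is tracked in ℚ, since K
  -- carries no order; it shows that they are invertible in K.
  have hYn : ∀ n, ∃ c : ℚ, 0 < c ∧ PowerSeries.coeff n Y = (c : K) • (X 0 : MvPowerSeries ℕ K) ^ n := by
    intro n
    induction n using Nat.strong_induction_on with
    | _ n ih =>
      cases n with
      | zero =>
        refine ⟨1, one_pos, ?_⟩
        rw [hY, PowerSeries.coeff_mul, Finset.Nat.antidiagonal_zero, Finset.sum_singleton, hS,
          PowerSeries.coeff_mk, PowerSeries.coeff_mk, hAll_zero, odeSol]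
        simp
      | succ n =>
        choose! c hc hcY using ih
        refine ⟨((n : ℚ) + 1)⁻¹ * (2⁻¹ * ∑ p ∈ antidiagonal n, c p.2), ?_, ?_⟩
        · have : 0 < ∑ p ∈ antidiagonal n, c p.2 := by
            refine Finset.sum_pos (fun p hp => hc _ ?_) ⟨(0, n), by simp⟩
            rw [mem_antidiagonal] at hp
            omega
          positivity
        · have h := congrArg (PowerSeries.coeff n) hdY
          change _ = ((2 : K)⁻¹) • PowerSeries.coeff n (Z * Y) at h
          rw [PowerSeries.coeff_derivative, PowerSeries.coeff_mul n] at h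
          have hsum : ∑ p ∈ antidiagonal n, PowerSeries.coeff p.1 Z * PowerSeries.coeff p.2 Y =
              ((∑ p ∈ antidiagonal n, c p.2 : ℚ) : K) • X 0 ^ (n + 1) := by
            rw [Rat.cast_sum, Finset.sum_smul]
            refine Finset.sum_congr rfl fun p hp => ?_
            rw [mem_antidiagonal] at hp
            rw [hcY p.2 (by omega), hZ, PowerSeries.coeff_mk, mul_smul_comm, ← pow_add]
            congr 2
            omega
          rw [hsum] at h
          have hn : (n : K) + 1 ≠ 0 := by exact_mod_cast n.succ_ne_zero
          have hn' : (n : MvPowerSeries ℕ K) + 1 = algebraMap K _ ((n : K) + 1) := by simp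
          rw [hn', mul_comm, ← Algebra.smul_def] at h
          rw [← one_smul K (PowerSeries.coeff (n + 1) Y), ← inv_mul_cancel₀ hn, ← smul_smul, h,
            smul_smul, smul_smul]
          push_cast
          rw [mul_assoc]
  obtain ⟨c, hc, h⟩ := hYn n
  have hc' : (c : K) ≠ 0 := Rat.cast_ne_zero.2 hc.ne'
  have := Submodule.smul_mem (hBSpan K) (c : K)⁻¹ (hYm n)
  rwa [h, smul_smul, inv_mul_cancel₀ hc', one_smul] at this

/-- Half the difference of x₀ⁿ + 2pₙ and x₀ⁿ is pₙ, so x₀ and `dblAlg` generate all of `powerAlg`.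
The span contains the powers of x₀ and is stable under `dblAlg`. -/
theorem powerAlg_le_hBSpan : Subalgebra.toSubmodule (powerAlg K) ≤ hBSpan K := by
  have h1 : powerAlg K ≤ Algebra.adjoin K {(X 0 : MvPowerSeries ℕ K)} ⊔ dblAlg K := by
    refine Algebra.adjoin_le ?_
    have hX : (X 0 : MvPowerSeries ℕ K) ∈ Algebra.adjoin K {(X 0 : MvPowerSeries ℕ K)} ⊔ dblAlg K :=
      (le_sup_left : _ ≤ Algebra.adjoin K {(X 0 : MvPowerSeries ℕ K)} ⊔ dblAlg K)
        (Algebra.subset_adjoin rfl)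
    rintro f (rfl | ⟨n, rfl⟩)
    · exact hX
    · have h2 : pSum K (n + 1) =
          (2 : K)⁻¹ • ((X 0 ^ (n + 1) + 2 * pSum K (n + 1)) - X 0 ^ (n + 1)) := by
        rw [add_sub_cancel_left, two_mul, smul_add, ← add_smul]
        norm_num
      dsimp only
      rw [h2]
      exact Subalgebra.smul_mem _ (Subalgebra.sub_mem _
        ((le_sup_right : dblAlg K ≤ _) (pSumB_mem_dblAlg K n)) (Subalgebra.pow_mem _ hX _)) _
  refine (Subalgebra.toSubmodule.monotone h1).trans ?_
  rw [← Subalgebra.mul_toSubmodule, Submodule.mul_le]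
  intro f hf g hg
  refine mul_mem_hBSpan ?_ hg
  rw [Subalgebra.mem_toSubmodule, Algebra.adjoin_singleton_eq_range_aeval] at hf
  obtain ⟨p, rfl⟩ := hf
  change Polynomial.aeval _ p ∈ _
  rw [Polynomial.aeval_eq_sum_range]
  exact Submodule.sum_mem _ fun i _ => Submodule.smul_mem _ _ (X_pow_mem_hBSpan K i)

theorem hBSpan_eq : hBSpan K = Subalgebra.toSubmodule (symAlg K) := by
  refine le_antisymm (Submodule.span_le.2 ?_) fun f hf => ?_
  · rintro _ ⟨α, rfl⟩
    exact hBOver_mem K α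
  · have h := (mBasis K).mem_span ⟨f, hf⟩
    have h2 := Submodule.mem_map_of_mem (f := (Subalgebra.toSubmodule (symAlg K)).subtype) h
    rw [Submodule.map_span, ← Set.range_comp] at h2
    refine Submodule.span_le.2 ?_ h2
    rintro _ ⟨l, rfl⟩
    rw [Function.comp_apply, Submodule.subtype_apply, mBasis_apply]
    exact powerAlg_le_hBSpan K (mOver_mem_powerAlg K l)

/-! ### Linear independence of the `hᴮ_λ` -/

theorem hToM_surjective : Function.Surjective (hToM K) := by
  intro v
  have h : ((symEquiv K).symm v).1 ∈ hBSpan K := by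
    rw [hBSpan_eq]
    exact ((symEquiv K).symm v).2
  rw [hBSpan_eq_span_part, Finsupp.mem_span_range_iff_exists_finsupp] at h
  obtain ⟨u, hu⟩ := h
  refine ⟨u, (symEquiv K).symm.injective (Subtype.ext ?_)⟩
  rw [symEquiv_symm_hToM, ← hu]
  rfl

/-- Any vector lies in the finite-dimensional space V of vectors supported in sizes at most some N.
The map preserves V and is surjective on it, hence injective on it. -/
theorem hToM_injective : Function.Injective (hToM K) := by
  rw [injective_iff_map_eq_zero]
  intro u hu
  set N := u.support.sup fun l => l.1.size
  set V := Finsupp.supported K K {l : PseudoPart | l.1.size ≤ N}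
  have hV : ∀ w, w ∈ V ↔ ∀ l : PseudoPart, N < l.1.size → w l = 0 := by
    intro w
    rw [Finsupp.mem_supported']
    simp
  have hmap : ∀ w ∈ V, hToM K w ∈ V := by
    intro w hw
    rw [hV] at hw ⊢
    intro l hl
    exact hToM_apply_eq_zero K (fun l' hl' => hw l' (hl' ▸ hl)) l rfl
  have := (finite_part_size_le N).to_subtype
  have hfin : Module.Finite K V :=
    Module.Finite.equiv (Finsupp.supportedEquivFinsupp {l : PseudoPart | l.1.size ≤ N}).symm
  have hsurj : Function.Surjective ((hToM K).restrict hmap) := by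
    rintro ⟨v, hv⟩
    obtain ⟨w, rfl⟩ := hToM_surjective K v
    have hw' : w.filter (fun l => l.1.size ≤ N) ∈ V := by
      rw [hV]
      intro l hl
      exact Finsupp.filter_apply_neg _ _ hl.not_ge
    -- Truncating a preimage to sizes at most N does not change its image in V, because `hToM`
    -- respects the size.
    refine ⟨⟨_, hw'⟩, Subtype.ext ?_⟩
    change hToM K (w.filter (fun l => l.1.size ≤ N)) = hToM K w
    ext l
    by_cases hl : l.1.size ≤ N
    · rw [← sub_eq_zero, ← Finsupp.sub_apply, ← map_sub]
      refine hToM_apply_eq_zero K (fun l' hl' => ?_) l rfl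
      rw [Finsupp.sub_apply, Finsupp.filter_apply_pos (fun l : PseudoPart => l.1.size ≤ N) _ (hl'.trans_le hl), sub_self]
    · rw [(hV _).1 (hmap _ hw') l (not_le.1 hl), (hV _).1 hv l (not_le.1 hl)]
  have hinj : Function.Injective ((hToM K).restrict hmap) :=
    OrzechProperty.injective_of_surjective_endomorphism _ hsurj
  have huV : u ∈ V := by
    rw [hV]
    intro l hl
    by_contra h
    exact hl.not_ge (Finset.le_sup (f := fun l : PseudoPart => l.1.size)
      (Finsupp.mem_support_iff.2 h))
  have h0 : (⟨u, huV⟩ : V) = 0 := by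
    refine hinj (Subtype.ext ?_)
    change hToM K u = hToM K 0
    rw [hu, map_zero]
  exact congrArg Subtype.val h0

theorem linearIndependent_hBOver : LinearIndependent K fun l : PseudoPart => hBOver K l.1 := by
  rw [LinearIndependent]
  intro u v h
  rw [← symEquiv_symm_hToM, ← symEquiv_symm_hToM] at h
  exact hToM_injective K ((symEquiv K).symm.injective (Subtype.ext h))

end field

/-! ### Integral structure -/

theorem injective_of_linearIndependent_comp {ι R M N : Type*} [CommRing R] [AddCommGroup M]
    [Module R M] [AddCommGroup N] [Module R N] (b : Module.Basis ι R M) (f : M →ₗ[R] N)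
    (h : LinearIndependent R (f ∘ b)) : Function.Injective f := by
  rw [injective_iff_map_eq_zero]
  intro x hx
  rw [← b.linearCombination_repr x, Finsupp.apply_linearCombination] at hx
  rw [← b.linearCombination_repr x, linearIndependent_iff.1 h _ hx, map_zero]

theorem linearIndependent_hB : LinearIndependent ℤ fun l : PseudoPart => hB l.1 := by
  have h := (linearIndependent_hBOver ℚ).restrict_scalars' ℤ
  refine LinearIndependent.of_comp
    (MvPowerSeries.map (Int.castRingHom ℚ)).toAddMonoidHom.toIntLinearMap ?_
  have e : ⇑(MvPowerSeries.map (Int.castRingHom ℚ)).toAddMonoidHom.toIntLinearMap ∘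
      (fun l : PseudoPart => hB l.1) = fun l => hBOver ℚ l.1 := funext fun l => map_hB ℚ l.1
  rw [e]
  exact h

theorem symB_eq_span_part :
    SymB = Submodule.span ℤ (Set.range fun l : PseudoPart => hB l.1) := by
  rw [symB_eq_span, funext fun l : PseudoPart => hB_eq l.1]
  exact hBSpan_eq_span_part ℤ

/-- The basis of `Symᴮ` consisting of the `hᴮ_λ`. -/
def hBasisInt : Module.Basis PseudoPart ℤ SymB :=
  (Module.Basis.span linearIndependent_hB).map (LinearEquiv.ofEq _ _ symB_eq_span_part.symm)

theorem hBasisInt_apply (l : PseudoPart) : (hBasisInt l : MvPowerSeries ℕ ℤ) = hB l.1 := by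
  rw [hBasisInt, Module.Basis.map_apply, LinearEquiv.coe_ofEq_apply, Module.Basis.span_apply]

/-! ### Extension of scalars and multiplication by polynomials in x₀ -/

section scalars

variable (K : Type*) [CommRing K]

theorem scalarExt_tmul (U : Submodule ℤ (MvPowerSeries ℕ ℤ)) (c : K) (f : U) :
    scalarExt K U (c ⊗ₜ f) = c • MvPowerSeries.map (Int.castRingHom K) f.1 := rfl

theorem extended_span (s : Set (MvPowerSeries ℕ ℤ)) :
    extended K (Submodule.span ℤ s) =
      Submodule.span K (MvPowerSeries.map (Int.castRingHom K) '' s) := by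
  refine le_antisymm ?_ (Submodule.span_le.2 ?_)
  · rintro _ ⟨t, rfl⟩
    induction t using TensorProduct.induction_on with
    | zero => rw [map_zero]; exact Submodule.zero_mem _
    | add x y hx hy => rw [map_add]; exact Submodule.add_mem _ hx hy
    | tmul c f =>
      rw [scalarExt_tmul]
      refine Submodule.smul_mem _ _ ?_
      obtain ⟨f, hf⟩ := f
      induction hf using Submodule.span_induction with
      | mem x hx => exact Submodule.subset_span ⟨x, hx, rfl⟩
      | zero => rw [map_zero]; exact Submodule.zero_mem _
      | add x y _ _ hx hy => rw [map_add]; exact Submodule.add_mem _ hx hy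
      | smul n x _ hx => rw [map_zsmul]; exact zsmul_mem hx n
  · rintro _ ⟨f, hf, rfl⟩
    refine ⟨1 ⊗ₜ ⟨f, Submodule.subset_span hf⟩, ?_⟩
    rw [scalarExt_tmul, one_smul]

/-- The algebra of symmetric functions in `x₁, x₂, …`. -/
def posAlg : Subalgebra K (MvPowerSeries ℕ K) := Algebra.adjoin K (Set.range (hPos K))

theorem toSubmodule_posAlg : Subalgebra.toSubmodule (posAlg K) =
    Submodule.span K (Set.range fun α : Comp => (α.1.map (hPos K)).prod) := by
  rw [posAlg, Algebra.adjoin_eq_span]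
  congr 1
  refine subset_antisymm ?_ ?_
  · intro f hf
    induction hf using Submonoid.closure_induction with
    | mem x hx =>
      obtain ⟨k, rfl⟩ := hx
      rcases Nat.eq_zero_or_pos k with rfl | hk
      · exact ⟨⟨[], by simp⟩, by simp [hPos_zero]⟩
      · exact ⟨⟨[k], by simpa using hk⟩, by simp⟩
    | one => exact ⟨⟨[], by simp⟩, by simp⟩
    | mul x y _ _ hx hy =>
      obtain ⟨α, rfl⟩ := hx
      obtain ⟨β, rfl⟩ := hy
      refine ⟨⟨α.1 ++ β.1, fun a ha => ?_⟩, by simp⟩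
      rcases List.mem_append.1 ha with h | h
      exacts [α.2 a h, β.2 a h]
  · rintro _ ⟨α, rfl⟩
    refine Submonoid.list_prod_mem _ fun f hf => ?_
    obtain ⟨k, -, rfl⟩ := List.mem_map.1 hf
    exact Submonoid.subset_closure ⟨k, rfl⟩

theorem symF_eq : SymF = Subalgebra.toSubmodule (posAlg ℤ) := by
  rw [symF_eq_span]
  exact (toSubmodule_posAlg ℤ).symm

theorem extended_symF : extended K SymF = Subalgebra.toSubmodule (posAlg K) := by
  rw [symF_eq_span, extended_span, toSubmodule_posAlg, ← Set.range_comp]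
  congr 2
  funext α
  rw [Function.comp_apply, map_list_prod, List.map_map]
  congr 1
  exact List.map_congr_left fun k _ => map_hPos K k

theorem extended_symB : extended K SymB = hBSpan K := by
  rw [symB_eq_span, extended_span, hBSpan, ← Set.range_comp]
  congr 2
  funext α
  rw [Function.comp_apply, ← hB_eq]
  exact map_hB K α

theorem polyMul_posAlg : polyMul K (Subalgebra.toSubmodule (posAlg K)) =
    Subalgebra.toSubmodule (Algebra.adjoin K {(X 0 : MvPowerSeries ℕ K)} ⊔ posAlg K) := by
  rw [polyMul, Subalgebra.mul_toSubmodule]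

theorem posAlg_le_symAlg : posAlg K ≤ symAlg K := by
  refine Algebra.adjoin_le ?_
  rintro _ ⟨k, rfl⟩
  exact hPos_mem K k

theorem polyMul_posAlg_le :
    polyMul K (Subalgebra.toSubmodule (posAlg K)) ≤ Subalgebra.toSubmodule (symAlg K) := by
  rw [polyMul_posAlg]
  refine Subalgebra.toSubmodule.monotone (sup_le (Algebra.adjoin_le ?_) (posAlg_le_symAlg K))
  rintro _ rfl
  exact X_mem K

/-- `hAll` and `hDbl` are polynomials in x₀ and the `hPos` with integer coefficients, so this
inclusion needs no division. -/
theorem hBSpan_le_polyMul : hBSpan K ≤ polyMul K (Subalgebra.toSubmodule (posAlg K)) := by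
  rw [polyMul_posAlg]
  set B := Algebra.adjoin K {(X 0 : MvPowerSeries ℕ K)} ⊔ posAlg K with hB
  have hX : X 0 ∈ B := (le_sup_left : _ ≤ B) (Algebra.subset_adjoin rfl)
  have hp : ∀ k, hPos K k ∈ B := fun k => (le_sup_right : _ ≤ B) (Algebra.subset_adjoin ⟨k, rfl⟩)
  have ha : ∀ k, hAll K k ∈ B := fun k => by
    rw [hAll_eq]
    exact B.sum_mem fun p _ => B.mul_mem (B.pow_mem hX _) (hp _)
  refine Submodule.span_le.2 ?_
  rintro _ ⟨α, rfl⟩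
  refine B.mul_mem (ha _) (B.list_prod_mem fun f hf => ?_)
  obtain ⟨k, -, rfl⟩ := List.mem_map.1 hf
  exact B.sum_mem fun p _ => B.mul_mem (hp _) (ha _)

theorem coeff_posAlg_eq_zero {f : MvPowerSeries ℕ K} (hf : f ∈ posAlg K) (m : ℕ →₀ ℕ)
    (hm : m 0 ≠ 0) : coeff m f = 0 := by
  induction hf using Algebra.adjoin_induction generalizing m with
  | mem x hx =>
    obtain ⟨k, rfl⟩ := hx
    rw [coeff_hPos, if_neg fun h => hm h.1]
  | algebraMap r =>
    rw [MvPowerSeries.algebraMap_apply, Algebra.algebraMap_self, RingHom.id_apply, coeff_C, if_neg]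
    rintro rfl
    exact hm rfl
  | add x y _ _ hx hy => rw [map_add, hx m hm, hy m hm, add_zero]
  | mul x y _ _ hx hy =>
    rw [coeff_mul]
    refine Finset.sum_eq_zero fun p hp => ?_
    rw [mem_antidiagonal] at hp
    rw [← hp, Finsupp.add_apply] at hm
    by_cases h : p.1 0 = 0
    · rw [hy _ (by omega), mul_zero]
    · rw [hx _ h, zero_mul]

theorem range_tensorMul (U : Submodule K (MvPowerSeries ℕ K)) :
    LinearMap.range (tensorMul K U) = polyMul K U := by
  refine le_antisymm ?_ (Submodule.mul_le.2 ?_)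
  · rintro _ ⟨t, rfl⟩
    induction t using TensorProduct.induction_on with
    | zero => rw [map_zero]; exact Submodule.zero_mem _
    | add x y hx hy => rw [map_add]; exact Submodule.add_mem _ hx hy
    | tmul p f =>
      refine Submodule.mul_mem_mul ?_ f.2
      rw [Subalgebra.mem_toSubmodule, Algebra.adjoin_singleton_eq_range_aeval]
      exact ⟨p, rfl⟩
  · intro f hf g hg
    rw [Subalgebra.mem_toSubmodule, Algebra.adjoin_singleton_eq_range_aeval] at hf
    obtain ⟨p, rfl⟩ := hf
    exact ⟨p ⊗ₜ ⟨g, hg⟩, rfl⟩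

/-- A tensor is a unique finite sum ∑ Xⁿ ⊗ uₙ. As no uₙ involves x₀, the part of the product with
exponent n in x₀ is x₀ⁿuₙ. -/
theorem tensorMul_injective (U : Submodule K (MvPowerSeries ℕ K))
    (hU : ∀ f ∈ U, ∀ m : ℕ →₀ ℕ, m 0 ≠ 0 → coeff m f = 0) :
    Function.Injective (tensorMul K U) := by
  rw [injective_iff_map_eq_zero]
  intro t ht
  set e := TensorProduct.equivFinsuppOfBasisLeft (N := U) (Polynomial.basisMonomials K)
  obtain ⟨u, rfl⟩ := e.symm.surjective t
  have h : ∀ v : ℕ →₀ U, tensorMul K U (e.symm v) = v.sum fun n f => X 0 ^ n * f.1 := by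
    intro v
    rw [TensorProduct.equivFinsuppOfBasisLeft_symm_apply, Finsupp.sum, map_sum]
    refine Finset.sum_congr rfl fun n _ => ?_
    change Polynomial.aeval (X 0) (Polynomial.basisMonomials K n) * (v n).1 = _
    rw [Polynomial.coe_basisMonomials]
    simp
  rw [h] at ht
  have hu : u = 0 := by
    ext n m
    change coeff m (u n).1 = 0
    by_cases hm : m 0 = 0
    -- In the monomial x₀ⁿ·m with m free of x₀, a summand with k < n would need x₀ inside u_k, and
    -- one with k > n does not divide it.
    · have h2 := congrArg (coeff (m + Finsupp.single 0 n)) ht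
      rw [Finsupp.sum, map_sum, map_zero, Finset.sum_eq_single n] at h2
      · rwa [X_pow_eq, add_comm m, coeff_add_monomial_mul, one_mul] at h2
      · intro k _ hk
        rw [X_pow_eq, coeff_monomial_mul, one_mul]
        split_ifs with hle
        · have hkn : k ≤ n := by
            have := Finsupp.single_le_iff.1 hle
            simpa [hm] using this
          refine hU _ (u k).2 _ ?_
          simp [hm]
          omega
        · rfl
      · intro hn
        rw [Finsupp.notMem_support_iff.1 hn]
        simp
    · exact hU _ (u n).2 m hm
  rw [hu, map_zero]

end scalars

/-- By flatness of K over ℤ it suffices to treat `symAlg ℤ` in place of U; there the monomial basis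
is carried to the monomial basis over K. -/
theorem scalarExt_injective (K : Type*) [Field K] [CharZero K]
    {U : Submodule ℤ (MvPowerSeries ℕ ℤ)} (hU : U ≤ Subalgebra.toSubmodule (symAlg ℤ)) :
    Function.Injective (scalarExt K U) := by
  obtain ⟨W, b, hb, hUW⟩ : ∃ (W : Submodule ℤ (MvPowerSeries ℕ ℤ)) (b : Module.Basis PseudoPart ℤ W),
      (∀ l, (b l).1 = mOver ℤ l) ∧ U ≤ W :=
    ⟨Subalgebra.toSubmodule (symAlg ℤ), mBasis ℤ, mBasis_apply, hU⟩
  have h1 : Function.Injective (scalarExt K W) := by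
    refine injective_of_linearIndependent_comp (b.baseChange K) _ ?_
    have h2 := (mBasis K).linearIndependent.map' (Subalgebra.toSubmodule (symAlg K)).subtype
      (Submodule.ker_subtype _)
    have e : ⇑(scalarExt K W) ∘ ⇑(b.baseChange K) =
        ⇑(Subalgebra.toSubmodule (symAlg K)).subtype ∘ ⇑(mBasis K) := by
      funext l
      rw [Function.comp_apply, Function.comp_apply, Module.Basis.baseChange_apply, scalarExt_tmul,
        hb, one_smul, Submodule.subtype_apply, mBasis_apply, ← mB_eq, map_mB]
    rw [e]
    exact h2
  have h2 : Function.Injective (LinearMap.lTensor K (Submodule.inclusion hUW)) :=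
    Module.Flat.lTensor_preserves_injective_linearMap _ (Submodule.inclusion_injective hUW)
  have h3 : ∀ t, scalarExt K U t = scalarExt K W (LinearMap.lTensor K (Submodule.inclusion hUW) t) := by
    intro t
    induction t using TensorProduct.induction_on with
    | zero => simp only [map_zero]
    | add x y hx hy => rw [map_add, map_add, map_add, hx, hy]
    | tmul c f => rfl
  intro x y hxy
  rw [h3, h3] at hxy
  exact h2 (h1 hxy)

theorem symB_le_polyMul : SymB ≤ polyMul ℤ SymF := by
  rw [symF_eq, symB_eq_span]
  exact hBSpan_le_polyMul ℤ

/-- The expansion of 3x₀² in the degree 2 part of the hᴮ_λ. Its coefficient 8 at hᴮ_(2) is not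
divisible by 3. -/
theorem three_mul_X_sq : (3 : MvPowerSeries ℕ ℤ) * X 0 ^ 2 = 8 * hAll ℤ 2 -
    4 * (hAll ℤ 1 * hDbl ℤ 1) - 4 * hDbl ℤ 2 + 3 * (hDbl ℤ 1 * hDbl ℤ 1) := by
  simp only [hDbl, hAll_eq, Finset.Nat.sum_antidiagonal_eq_sum_range_succ_mk, Finset.sum_range_succ,
    Finset.sum_range_zero, hPos_zero]
  norm_num [hPos_zero]
  ring

theorem symB_lt_polyMul : SymB < polyMul ℤ SymF := by
  refine lt_of_le_of_ne symB_le_polyMul fun heq => ?_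
  have hX : (X 0 : MvPowerSeries ℕ ℤ) ^ 2 ∈ SymB := by
    rw [heq, symF_eq, polyMul_posAlg]
    exact Subalgebra.pow_mem _ ((le_sup_left : _ ≤ Algebra.adjoin ℤ {(X 0 : MvPowerSeries ℕ ℤ)} ⊔
      posAlg ℤ) (Algebra.subset_adjoin rfl)) 2
  obtain ⟨v, hv⟩ : ∃ v : SymB, v.1 = X 0 ^ 2 := ⟨⟨_, hX⟩, rfl⟩
  let l₁ : PseudoPart := ⟨⟨2, [], by simp⟩, by simp⟩
  let l₂ : PseudoPart := ⟨⟨1, [1], by simp⟩, by simp⟩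
  let l₃ : PseudoPart := ⟨⟨0, [2], by simp⟩, by simp⟩
  let l₄ : PseudoPart := ⟨⟨0, [1, 1], by simp⟩, by simp⟩
  have h : (3 : ℤ) • v = (8 : ℤ) • hBasisInt l₁ - (4 : ℤ) • hBasisInt l₂ -
      (4 : ℤ) • hBasisInt l₃ + (3 : ℤ) • hBasisInt l₄ := by
    refine Subtype.ext ?_
    change (3 : ℤ) • v.1 = (8 : ℤ) • (hBasisInt l₁).1 -
      (4 : ℤ) • (hBasisInt l₂).1 - (4 : ℤ) • (hBasisInt l₃).1 + (3 : ℤ) • (hBasisInt l₄).1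
    simp only [hv, hBasisInt_apply, hB_eq, hBOver, l₁, l₂, l₃, l₄, hAll_zero, zsmul_eq_mul,
      List.map_nil, List.prod_nil, List.map_cons, List.prod_cons, mul_one, one_mul]
    exact_mod_cast three_mul_X_sq
  -- Comparing coordinates at the pseudo-partition (2) makes 8 a multiple of 3.
  have h2 := congrArg (fun v => hBasisInt.repr v l₁) h
  have e2 : l₂ ≠ l₁ := by simp [l₁, l₂]
  have e3 : l₃ ≠ l₁ := by simp [l₁, l₃]
  have e4 : l₄ ≠ l₁ := by simp [l₁, l₄]
  simp [e2, e3, e4] at h2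
  omega

section field

variable (K : Type*) [Field K] [CharZero K]

theorem extended_symB_eq_symAlg : extended K SymB = Subalgebra.toSubmodule (symAlg K) := by
  rw [extended_symB, hBSpan_eq]

theorem extended_symB_eq_polyMul : extended K SymB = polyMul K (extended K SymF) := by
  rw [extended_symF]
  refine le_antisymm ?_ ?_
  · rw [extended_symB]
    exact hBSpan_le_polyMul K
  · rw [extended_symB_eq_symAlg]
    exact polyMul_posAlg_le K

/-- The `K`-basis of monomial series. -/
def mBasisExt : Module.Basis PseudoPart K (extended K SymB) :=
  (mBasis K).map (LinearEquiv.ofEq _ _ (extended_symB_eq_symAlg K).symm)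

theorem mBasisExt_apply (l : PseudoPart) : (mBasisExt K l : MvPowerSeries ℕ K) = mOver K l := by
  rw [mBasisExt, Module.Basis.map_apply, LinearEquiv.coe_ofEq_apply, mBasis_apply]

/-- The `K`-basis of the `hᴮ_λ`. -/
def hBasisExt : Module.Basis PseudoPart K (extended K SymB) :=
  (Module.Basis.span (linearIndependent_hBOver K)).map (LinearEquiv.ofEq _ _
    ((extended_symB K).trans (hBSpan_eq_span_part K)).symm)

theorem hBasisExt_apply (l : PseudoPart) : (hBasisExt K l : MvPowerSeries ℕ K) = hBOver K l.1 := by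
  rw [hBasisExt, Module.Basis.map_apply, LinearEquiv.coe_ofEq_apply, Module.Basis.span_apply]

end field

/-! ### Descents of words -/

/-- The `i`-th letter of a word `u`, where `u₀ = 0`. -/
def letter (u : List ℤ) (i : ℕ) : ℤ := (0 :: u).getD i 0

@[simp] theorem letter_zero (u : List ℤ) : letter u 0 = 0 := rfl

@[simp] theorem letter_succ (u : List ℤ) (i : ℕ) : letter u (i + 1) = u.getD i 0 := rfl

/-- The descent set of a word. -/
def wordDescents (u : List ℤ) : Finset ℕ :=
  (Finset.range u.length).filter fun i => letter u (i + 1) < letter u i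

theorem mem_wordDescents {u : List ℤ} {i : ℕ} :
    i ∈ wordDescents u ↔ i < u.length ∧ letter u (i + 1) < letter u i := by
  simp [wordDescents]

theorem pairwise_iff_getD (l : List ℤ) :
    l.Pairwise (· ≤ ·) ↔ ∀ j, j + 1 < l.length → l.getD j 0 ≤ l.getD (j + 1) 0 := by
  rw [← List.isChain_iff_pairwise, List.isChain_iff_getElem]
  refine forall_congr' fun j => forall_congr' fun hj => ?_
  rw [List.getD_eq_getElem _ _ hj, List.getD_eq_getElem _ _ (by omega)]

theorem wordDescents_eq_empty (u : List ℤ) :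
    wordDescents u = ∅ ↔ u.Pairwise (· ≤ ·) ∧ ∀ a ∈ u, 0 ≤ a := by
  rw [and_comm, ← List.pairwise_cons, pairwise_iff_getD, Finset.eq_empty_iff_forall_notMem]
  refine forall_congr' fun j => ?_
  rw [mem_wordDescents]
  simp only [List.length_cons, add_lt_add_iff_right, not_and, not_lt]
  rfl

theorem letter_take {u : List ℤ} {k i : ℕ} (hi : i ≤ k) : letter (u.take k) i = letter u i := by
  cases i with
  | zero => rfl
  | succ i =>
    rw [letter_succ, letter_succ, List.getD_eq_getElem?_getD, List.getD_eq_getElem?_getD,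
      List.getElem?_take_of_lt hi]

/-- Descents before position k are those of the prefix, a descent at k is permitted, and descents
after k are exactly the failures of monotonicity in the suffix. -/
theorem wordDescents_subset_insert {u : List ℤ} {k : ℕ} (hk : k ≤ u.length) {D : Finset ℕ}
    (hD : D ⊆ Finset.range k) : wordDescents u ⊆ insert k D ↔
      wordDescents (u.take k) ⊆ D ∧ (u.drop k).Pairwise (· ≤ ·) := by
  have hlen : (u.take k).length = k := by simp [hk]
  rw [pairwise_iff_getD]
  -- The shift by one comes from the letter u₀ = 0 placed in front of the word.
  have hdrop : ∀ j, (u.drop k).getD j 0 = letter u (k + j + 1) := by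
    intro j
    rw [letter_succ, List.getD_eq_getElem?_getD, List.getD_eq_getElem?_getD, List.getElem?_drop]
  simp only [hdrop, List.length_drop]
  constructor
  · intro h
    constructor
    · intro i hi
      rw [mem_wordDescents, hlen, letter_take (by omega), letter_take (by omega)] at hi
      have := h (mem_wordDescents.2 ⟨by omega, hi.2⟩)
      rw [Finset.mem_insert] at this
      exact this.resolve_left (by omega)
    · intro j hj
      by_contra! hlt
      have := h (mem_wordDescents.2 ⟨(by omega : k + j + 1 < u.length), hlt⟩)
      rw [Finset.mem_insert] at this
      rcases this with h1 | h1
      · omega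
      · have := Finset.mem_range.1 (hD h1)
        omega
  · rintro ⟨h1, h2⟩ i hi
    rw [mem_wordDescents] at hi
    rw [Finset.mem_insert]
    rcases lt_trichotomy i k with hik | hik | hik
    · right
      apply h1
      rw [mem_wordDescents, hlen, letter_take (by omega), letter_take (by omega)]
      exact ⟨hik, hi.2⟩
    · exact Or.inl hik
    · exfalso
      obtain ⟨j, rfl⟩ := Nat.exists_eq_add_of_lt hik
      exact (h2 j (by omega)).not_gt hi.2

/-- A word occurs in the product exactly when it is weakly increasing between consecutive cuts and
its first block is nonnegative. Thanks to u₀ = 0 the last condition just says that 0 is not a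
descent; when α₁ = 0 the first block is empty and 0 is a permitted descent. -/
theorem ncHBComp_apply (α : PseudoComp) (w : List ℤ) : ncHBComp α w =
    if w.length = α.size ∧ wordDescents w ⊆ α.descents then 1 else 0 := by
  induction α using PseudoComp.snoc_induction generalizing w with
  | h1 n =>
    change (if w.length = n ∧ w.Pairwise (· ≤ ·) ∧ ∀ a ∈ w, 0 ≤ a then (1 : ℤ) else 0) = _
    refine if_congr (and_congr (by rw [PseudoComp.size_single]) ?_) rfl rfl
    rw [PseudoComp.descents_single, Finset.subset_empty, wordDescents_eq_empty]
  | h2 α k hk ih =>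
    have h1 : ncHBComp (α.snoc k hk) = ncMul (ncHBComp α) (ncH k) := by
      simp [ncHBComp, PseudoComp.snoc, List.foldl_append]
    rw [h1, ncMul, PseudoComp.descents_snoc, PseudoComp.size_snoc]
    simp only [ih, ncH, ← ite_and, mul_ite, mul_one, mul_zero]
    by_cases hlen : w.length = α.size + k
    · rw [Finset.sum_eq_single α.size]
      · refine if_congr ?_ rfl rfl
        rw [wordDescents_subset_insert (by omega) α.descents_subset_range]
        simp [hlen]
        tauto
      · intro i hi hne
        rw [Finset.mem_range] at hi
        refine if_neg fun h => hne ?_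
        have := h.2.1
        simp at this
        omega
      · intro h
        rw [Finset.mem_range] at h
        omega
    · rw [if_neg fun h => hlen h.1]
      refine Finset.sum_eq_zero fun i hi => if_neg fun h => hlen ?_
      have h2 := h.1.1
      have h3 := h.2.1
      rw [Finset.mem_range] at hi
      simp at h2 h3
      omega

/-! ### The level function of a pseudo-composition -/

/-- The number of elements of `D` below `j`. -/
def level (D : Finset ℕ) (j : ℕ) : ℕ := (D.filter (· < j)).card

theorem level_zero (D : Finset ℕ) : level D 0 = 0 := by simp [level]

theorem level_succ (D : Finset ℕ) (j : ℕ) :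
    level D (j + 1) = level D j + if j ∈ D then 1 else 0 := by
  rw [level, level]
  split_ifs with h
  · rw [← Finset.card_insert_of_notMem (a := j) (by simp)]
    congr 1
    ext i
    simp only [Finset.mem_filter, Finset.mem_insert]
    constructor
    · rintro ⟨h1, h2⟩
      rcases Nat.lt_succ_iff_lt_or_eq.1 h2 with h3 | h3
      exacts [Or.inr ⟨h1, h3⟩, Or.inl h3]
    · rintro (rfl | ⟨h1, h2⟩)
      exacts [⟨h, by omega⟩, ⟨h1, by omega⟩]
  · rw [add_zero]
    congr 1
    ext i
    simp only [Finset.mem_filter]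
    refine and_congr_right fun hi => ⟨fun h2 => ?_, fun h2 => by omega⟩
    have : i ≠ j := fun h3 => h (h3 ▸ hi)
    omega

/-- Cut 1, …, n at the descents: the position i + 1 lies in the block numbered by its level,
starting from 0, and contributes one factor of the corresponding variable. -/
theorem canon_eq_sum (α : PseudoComp) :
    canon α = ∑ i ∈ Finset.range α.size, Finsupp.single (level α.descents (i + 1)) 1 := by
  have h1 : ∀ α : PseudoComp, canon α = Finsupp.single 0 α.head +
      ∑ i ∈ Finset.range α.tail.length, Finsupp.single (i + 1) (α.tail.getD i 0) := by
    intro α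
    rw [canon, expo, Finset.sum_range]
    congr 1
    refine Finset.sum_congr rfl fun j _ => ?_
    rw [List.getD_eq_getElem _ _ j.2, List.get_eq_getElem]
  induction α using PseudoComp.snoc_induction with
  | h1 n =>
    rw [h1]
    simp [PseudoComp.single, PseudoComp.size, PseudoComp.descents, level]
  | h2 α k hk ih =>
    have h2 : canon (α.snoc k hk) = canon α + Finsupp.single (α.tail.length + 1) k := by
      rw [h1, h1]
      have hl : (α.snoc k hk).tail.length = α.tail.length + 1 := by simp [PseudoComp.snoc]
      rw [hl, Finset.sum_range_succ, ← add_assoc]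
      congr 1
      · congr 1
        refine Finset.sum_congr rfl fun i hi => ?_
        rw [Finset.mem_range] at hi
        simp only [PseudoComp.snoc]
        rw [List.getD_append _ _ _ _ hi]
      · simp [PseudoComp.snoc]
    rw [h2, ih, PseudoComp.size_snoc, Finset.sum_range_add, PseudoComp.descents_snoc]
    congr 1
    · refine Finset.sum_congr rfl fun i hi => ?_
      rw [Finset.mem_range] at hi
      congr 1
      rw [level, level, Finset.filter_insert, if_neg (by omega)]
    · rw [Finset.sum_congr rfl (g := fun _ => Finsupp.single (α.tail.length + 1) 1),
        Finset.sum_const, Finset.card_range]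
      · simp
      · intro i _
        congr 1
        rw [level, Finset.filter_true_of_mem, Finset.card_insert_of_notMem α.size_notMem_descents]
        · have := α.length_eq
          rw [PseudoComp.length] at this
          omega
        · intro d hd
          rcases Finset.mem_insert.1 hd with rfl | hd
          · omega
          · have := PseudoComp.lt_size_of_mem_descents hd
            omega

theorem content_eq_sum (u : List ℤ) : content u =
    ∑ i ∈ Finset.range u.length, Finsupp.single (letter u (i + 1)).natAbs 1 := by
  induction u with
  | nil => simp [content]
  | cons a u ih =>
    rw [content_cons, List.length_cons, Finset.sum_range_succ', ih, add_comm]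
    rfl

theorem coeff_canon_hB (α β : PseudoComp) (h : α.size = β.size) :
    coeff (canon α) (hB β) =
      (Nat.card {u : List ℤ // content u = canon α ∧ wordDescents u ⊆ β.descents} : ℤ) := by
  rw [hB, chiB, coeff_commutize]
  have h1 : ∀ u ∈ (words_finite Set.univ (canon α)).toFinset, ncHBComp β u =
      if wordDescents u ⊆ β.descents then 1 else 0 := by
    intro u hu
    rw [Set.Finite.mem_toFinset] at hu
    rw [ncHBComp_apply]
    refine if_congr (and_iff_right ?_) rfl rfl
    rw [← length_eq_degree_content, hu.2, degree_canon, h]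
  rw [Finset.sum_congr rfl h1, ← Finset.sum_filter, Finset.sum_const, nsmul_one]
  congr 1
  symm
  rw [Nat.subtype_card]
  intro u
  simp [words]

/-- An odd function on `{-n, …, n}` is determined up to rearrangement by its absolute values. -/
theorem map_Icc_of_odd (n : ℕ) (g : ℤ → ℤ) (hg : ∀ a, g (-a) = -g a) :
    (Finset.Icc (-n : ℤ) n).val.map g = 0 ::ₘ
      ((Finset.range n).val.map fun i : ℕ => (g ((i : ℤ) + 1)).natAbs).bind
        fun k : ℕ => ({(k : ℤ), -(k : ℤ)} : Multiset ℤ) := by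
  induction n with
  | zero =>
    have : g 0 = 0 := by
      have := hg 0
      rw [neg_zero] at this
      omega
    simp [this]
  | succ n ih =>
    have h1 : Finset.Icc (-((n + 1 : ℕ) : ℤ)) ((n + 1 : ℕ) : ℤ) =
        insert (((n : ℤ) + 1)) (insert (-((n : ℤ) + 1)) (Finset.Icc (-n : ℤ) n)) := by
      ext a
      simp only [Finset.mem_insert, Finset.mem_Icc]
      omega
    rw [h1, Finset.insert_val_of_notMem, Finset.insert_val_of_notMem, Finset.range_add_one,
      Finset.insert_val_of_notMem, Multiset.map_cons, Multiset.map_cons, ih, Multiset.map_cons,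
      Multiset.cons_bind, hg]
    · have h2 : ∀ c : ℤ, (c ::ₘ {-c} : Multiset ℤ) = {(c.natAbs : ℤ), -(c.natAbs : ℤ)} := by
        intro c
        rcases abs_choice c with h | h
        · rw [Int.natCast_natAbs, h]
          rfl
        · rw [Int.natCast_natAbs, h, neg_neg]
          exact Multiset.pair_comm _ _
      rw [← h2, Multiset.cons_add, Multiset.singleton_add, Multiset.cons_swap 0,
        Multiset.cons_swap 0]
    · simp
    · simp
    · simp only [Finset.mem_insert, Finset.mem_Icc]
      omega

theorem map_val_eq_of_sum_single {s : Finset ℕ} {f g : ℕ → ℕ}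
    (h : ∑ i ∈ s, Finsupp.single (f i) 1 = ∑ i ∈ s, Finsupp.single (g i) 1) :
    s.val.map f = s.val.map g := by
  have key : ∀ f : ℕ → ℕ, Finsupp.toMultiset (∑ i ∈ s, Finsupp.single (f i) 1) = s.val.map f := by
    intro f
    rw [map_sum]
    simp only [Finsupp.toMultiset_single, one_smul]
    rw [Finset.sum_eq_multiset_sum, ← Multiset.sum_map_singleton (s.val.map f), Multiset.map_map]
    rfl
  rw [← key, ← key, h]

/-! ### Standardization of words -/

/-- The odd extension of the level function. -/
def oddLevel (D : Finset ℕ) (a : ℤ) : ℤ := a.sign * level D a.natAbs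

theorem oddLevel_natCast (D : Finset ℕ) (j : ℕ) : oddLevel D j = level D j := by
  rw [oddLevel, Int.natAbs_natCast]
  rcases Nat.eq_zero_or_pos j with rfl | hj
  · simp [level_zero]
  · rw [Int.sign_eq_one_of_pos (by exact_mod_cast hj), one_mul]

theorem oddLevel_neg (D : Finset ℕ) (a : ℤ) : oddLevel D (-a) = -oddLevel D a := by
  simp [oddLevel]

theorem natAbs_oddLevel (D : Finset ℕ) (a : ℤ) : (oddLevel D a).natAbs = level D a.natAbs := by
  rcases Int.natAbs_eq a with h | h
  · rw [h, oddLevel_natCast, Int.natAbs_natCast, Int.natAbs_natCast]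
  · rw [h, oddLevel_neg, oddLevel_natCast, Int.natAbs_neg, Int.natAbs_natCast, Int.natAbs_neg,
      Int.natAbs_natCast]

theorem oddLevel_add_one_natCast (D : Finset ℕ) (j : ℕ) :
    oddLevel D ((j : ℤ) + 1) = oddLevel D j + if j ∈ D then 1 else 0 := by
  have h : ((j : ℤ) + 1) = ((j + 1 : ℕ) : ℤ) := by push_cast; ring
  rw [h, oddLevel_natCast, oddLevel_natCast, level_succ]
  push_cast
  rfl

theorem oddLevel_monotone (D : Finset ℕ) : Monotone (oddLevel D) := by
  refine monotone_int_of_le_succ fun a => ?_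
  rcases le_or_gt 0 a with h | h
  · lift a to ℕ using h
    rw [oddLevel_add_one_natCast]
    split_ifs <;> simp
  · obtain ⟨j, hj⟩ : ∃ j : ℕ, a = -((j : ℤ) + 1) := ⟨(-a - 1).toNat, by omega⟩
    have h1 : a + 1 = -(j : ℤ) := by omega
    rw [h1, hj, oddLevel_neg, oddLevel_neg, neg_le_neg_iff, oddLevel_add_one_natCast]
    split_ifs <;> simp

namespace SignedPerm

variable {n : ℕ}

theorem apply_neg (w : SignedPerm n) (a : ℤ) : w.1 (-a) = -w.1 a := w.2.1 a

theorem apply_zero (w : SignedPerm n) : w.1 0 = 0 := by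
  have := apply_neg w 0
  rw [neg_zero] at this
  omega

theorem inv_apply_apply (w : SignedPerm n) (a : ℤ) : (w⁻¹).1 (w.1 a) = a :=
  Equiv.symm_apply_apply w.1 a

theorem apply_inv_apply (w : SignedPerm n) (a : ℤ) : w.1 ((w⁻¹).1 a) = a :=
  Equiv.apply_symm_apply w.1 a

theorem abs_apply_le (w : SignedPerm n) {a : ℤ} (ha : |a| ≤ n) : |w.1 a| ≤ n := by
  by_contra! h
  have h1 := w.2.2 _ h
  rw [w.1.injective h1] at h
  omega

theorem mem_descents {w : SignedPerm n} {i : ℕ} :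
    i ∈ (descents w) ↔ i < n ∧ w.1 ((i : ℤ) + 1) < w.1 i := by
  simp [descents]

/-- A monotone function with equal values at a and b is constant between them. So no element of D,
nor its mirror image, is crossed, and v increases at every step; steps on the negative side are
reflected by oddness. -/
theorem lt_of_oddLevel_eq {v : SignedPerm n} {D : Finset ℕ} (hD : (descents v) ⊆ D) {a b : ℤ}
    (ha : -(n : ℤ) ≤ a) (hb : b ≤ n) (hab : a < b) (h : oddLevel D a = oddLevel D b) :
    v.1 a < v.1 b := by
  have step : ∀ i : ℕ, i < n → oddLevel D ((i : ℤ) + 1) = oddLevel D i →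
      v.1 i < v.1 ((i : ℤ) + 1) := by
    intro i hi h
    rw [oddLevel_add_one_natCast] at h
    have hiD : i ∉ D := by
      intro hi
      rw [if_pos hi] at h
      omega
    have h1 : ¬ v.1 ((i : ℤ) + 1) < v.1 i := fun h => hiD (hD (mem_descents.2 ⟨hi, h⟩))
    refine lt_of_le_of_ne (not_lt.1 h1) fun h2 => ?_
    have := v.1.injective h2
    omega
  have step' : ∀ c : ℤ, -(n : ℤ) ≤ c → c + 1 ≤ n → oddLevel D c = oddLevel D (c + 1) →
      v.1 c < v.1 (c + 1) := by
    intro c hc hc' h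
    rcases le_or_gt 0 c with h0 | h0
    · lift c to ℕ using h0
      exact step c (by omega) h.symm
    · obtain ⟨j, rfl⟩ : ∃ j : ℕ, c = -((j : ℤ) + 1) := ⟨(-c - 1).toNat, by omega⟩
      have h1 : -((j : ℤ) + 1) + 1 = -(j : ℤ) := by omega
      rw [h1, oddLevel_neg, oddLevel_neg, neg_inj] at h
      rw [h1, apply_neg, apply_neg, neg_lt_neg_iff]
      exact step j (by omega) h
  have key : ∀ k : ℕ, a + (k + 1) ≤ n → oddLevel D a = oddLevel D (a + (k + 1)) →
      v.1 a < v.1 (a + (k + 1)) := by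
    intro k
    induction k with
    | zero =>
      intro hk h
      simp only [Nat.cast_zero, zero_add] at hk h ⊢
      exact step' a ha hk h
    | succ k ih =>
      intro hk h
      push_cast at hk h ⊢
      have h1 : oddLevel D a ≤ oddLevel D (a + (k + 1)) := oddLevel_monotone D (by omega)
      have h2 : oddLevel D (a + (k + 1)) ≤ oddLevel D (a + (k + 1 + 1)) :=
        oddLevel_monotone D (by omega)
      have h3 := ih (by omega) (by omega)
      have h4 := step' (a + (k + 1)) (by omega) (by omega) (by
        rw [add_assoc]
        omega)
      rw [add_assoc] at h4
      exact h3.trans h4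
  obtain ⟨k, hk⟩ : ∃ k : ℕ, b = a + (k + 1) := ⟨(b - a - 1).toNat, by omega⟩
  rw [hk] at hb h ⊢
  exact key k hb h

/-- The word `f(w(1)) ⋯ f(w(n))`, where `f` is the odd level function. -/
def toWord (D : Finset ℕ) (w : SignedPerm n) : List ℤ :=
  List.ofFn fun i : Fin n => oddLevel D (w.1 ((i : ℤ) + 1))

theorem length_toWord (D : Finset ℕ) (w : SignedPerm n) : (toWord D w).length = n := by
  simp [toWord]

theorem letter_toWord (D : Finset ℕ) (w : SignedPerm n) {i : ℕ} (hi : i ≤ n) :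
    letter (toWord D w) i = oddLevel D (w.1 i) := by
  cases i with
  | zero => simp [apply_zero, oddLevel]
  | succ i =>
    rw [letter_succ, List.getD_eq_getElem _ _ (by rw [length_toWord]; omega)]
    simp [toWord]

theorem content_toWord (α : PseudoComp) (w : SignedPerm α.size) :
    content ((toWord α.descents w)) = canon α := by
  have hnat : ∀ (w : SignedPerm α.size) (i : ℕ), i < α.size →
      ∃ j < α.size, (w.1 ((i : ℤ) + 1)).natAbs = j + 1 := by
    intro w i hi
    have h1 := abs_apply_le w (a := (i : ℤ) + 1) (by rw [abs_of_nonneg (by omega)]; omega)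
    rw [abs_le] at h1
    have h2 : w.1 ((i : ℤ) + 1) ≠ 0 := by
      intro h
      rw [← apply_zero w] at h
      have := w.1.injective h
      omega
    exact ⟨(w.1 ((i : ℤ) + 1)).natAbs - 1, by omega, by omega⟩
  have hinv : ∀ (v w : SignedPerm α.size), (∀ a, v.1 (w.1 a) = a) → ∀ i < α.size,
      (v.1 (((w.1 ((i : ℤ) + 1)).natAbs - 1 : ℕ) + 1)).natAbs - 1 = i := by
    intro v w hvw i hi
    obtain ⟨j, -, hj⟩ := hnat w i hi
    rw [hj, Nat.add_sub_cancel]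
    have h3 : (v.1 ((j : ℤ) + 1)).natAbs = i + 1 := by
      have h4 := hvw ((i : ℤ) + 1)
      rcases Int.natAbs_eq (w.1 ((i : ℤ) + 1)) with h | h
      · rw [hj] at h
        push_cast at h
        rw [h] at h4
        omega
      · rw [hj] at h
        push_cast at h
        rw [h, apply_neg] at h4
        omega
    omega
  rw [content_eq_sum, canon_eq_sum, length_toWord]
  -- The absolute values of w(1), …, w(n) are a permutation of 1, …, n; both sides are shifted to
  -- start from 0.
  refine Finset.sum_bij' (fun i _ => (w.1 ((i : ℤ) + 1)).natAbs - 1)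
    (fun i _ => ((w⁻¹).1 ((i : ℤ) + 1)).natAbs - 1) ?_ ?_ ?_ ?_ ?_
  · intro i hi
    obtain ⟨j, hj, h⟩ := hnat w i (Finset.mem_range.1 hi)
    rw [Finset.mem_range]
    omega
  · intro i hi
    obtain ⟨j, hj, h⟩ := hnat w⁻¹ i (Finset.mem_range.1 hi)
    rw [Finset.mem_range]
    omega
  · intro i hi
    exact hinv _ _ (inv_apply_apply w) i (Finset.mem_range.1 hi)
  · intro i hi
    exact hinv _ _ (apply_inv_apply w) i (Finset.mem_range.1 hi)
  · intro i hi
    obtain ⟨j, hj, h⟩ := hnat w i (Finset.mem_range.1 hi)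
    rw [letter_toWord _ _ (Finset.mem_range.1 hi), natAbs_oddLevel]
    push_cast
    rw [h, Nat.add_sub_cancel]

/-- Comparison of values of `w` in terms of the word of `w`. -/
theorem apply_lt_apply_iff {D : Finset ℕ} {w : SignedPerm n} (hD : (descents w⁻¹) ⊆ D) {a b : ℤ}
    (ha : |a| ≤ n) (hb : |b| ≤ n) : w.1 a < w.1 b ↔ oddLevel D (w.1 a) < oddLevel D (w.1 b) ∨
      oddLevel D (w.1 a) = oddLevel D (w.1 b) ∧ a < b := by
  have h1 : ∀ {a b : ℤ}, |a| ≤ n → |b| ≤ n → w.1 a < w.1 b →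
      oddLevel D (w.1 a) = oddLevel D (w.1 b) → a < b := by
    intro a b ha hb hlt h
    have := lt_of_oddLevel_eq hD (abs_le.1 (abs_apply_le w ha)).1 (abs_le.1 (abs_apply_le w hb)).2
      hlt h
    rwa [inv_apply_apply, inv_apply_apply] at this
  constructor
  · intro hlt
    rcases (oddLevel_monotone D hlt.le).lt_or_eq with h | h
    · exact Or.inl h
    · exact Or.inr ⟨h, h1 ha hb hlt h⟩
  · rintro (h | ⟨h, hab⟩)
    · by_contra! hle
      exact (oddLevel_monotone D hle).not_gt h
    · rcases lt_trichotomy (w.1 a) (w.1 b) with hlt | heq | hgt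
      · exact hlt
      · exact absurd (w.1.injective heq) hab.ne
      · exact absurd (h1 hb ha hgt h.symm) hab.not_gt

/-- Equal letters are ordered in w by position, so at i < i + 1 a tie is never a descent of w. -/
theorem wordDescents_toWord {D : Finset ℕ} {w : SignedPerm n} (hD : (descents w⁻¹) ⊆ D) :
    wordDescents (toWord D w) = (descents w) := by
  ext i
  rw [mem_wordDescents, mem_descents, length_toWord]
  refine and_congr_right fun hi => ?_
  rw [letter_toWord _ _ hi, letter_toWord _ _ hi.le]
  push_cast
  rw [apply_lt_apply_iff hD (abs_le.2 (by omega)) (abs_le.2 (by omega))]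
  constructor
  · exact Or.inl
  · rintro (h | ⟨-, h⟩)
    · exact h
    · omega

theorem le_apply_of_strictMono {g : ℕ → ℤ} (h0 : g 0 = 0) {n : ℕ}
    (hg : ∀ i < n, g i < g (i + 1)) (i : ℕ) (hi : i ≤ n) : (i : ℤ) ≤ g i := by
  induction i with
  | zero => rw [h0]; rfl
  | succ i ih =>
    have h1 := ih (by omega)
    have h2 := hg i (by omega)
    push_cast
    omega

/-- By `apply_lt_apply_iff` the word determines the relative order of all values on {-n, …, n}. Two
signed permutations with the same relative order coincide. -/
theorem toWord_injective {D : Finset ℕ} {w w' : SignedPerm n} (hw : (descents w⁻¹) ⊆ D)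
    (hw' : (descents w'⁻¹) ⊆ D) (h : (toWord D w) = (toWord D w')) : w = w' := by
  have hl : ∀ a : ℤ, |a| ≤ n → oddLevel D (w.1 a) = oddLevel D (w'.1 a) := by
    have hnat : ∀ i : ℕ, i ≤ n → oddLevel D (w.1 i) = oddLevel D (w'.1 i) := by
      intro i hi
      rw [← letter_toWord D w hi, h, letter_toWord D w' hi]
    intro a ha
    rw [abs_le] at ha
    rcases Int.natAbs_eq a with h | h
    · rw [h]
      exact hnat _ (by omega)
    · rw [h, apply_neg, apply_neg, oddLevel_neg, oddLevel_neg, hnat _ (by omega)]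
  have hlt : ∀ {a b : ℤ}, |a| ≤ n → |b| ≤ n → (w.1 a < w.1 b ↔ w'.1 a < w'.1 b) := by
    intro a b ha hb
    rw [apply_lt_apply_iff hw ha hb, apply_lt_apply_iff hw' ha hb, hl a ha, hl b hb]
  -- The composite w'w⁻¹ is strictly increasing on 0, …, n and fixes 0, so it moves nothing down.
  -- The same holds for its inverse, so it is the identity there.
  have key : ∀ (w w' : SignedPerm n), (∀ {a b : ℤ}, |a| ≤ n → |b| ≤ n → w.1 a < w.1 b →
      w'.1 a < w'.1 b) → ∀ i : ℕ, i ≤ n → (i : ℤ) ≤ w'.1 ((w⁻¹).1 i) := by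
    intro w w' hlt
    refine le_apply_of_strictMono (by rw [Nat.cast_zero, apply_zero, apply_zero]) fun i hi => ?_
    refine hlt (abs_apply_le _ (abs_le.2 (by omega))) (abs_apply_le _ (abs_le.2 ?_)) ?_
    · push_cast
      omega
    · rw [apply_inv_apply, apply_inv_apply]
      push_cast
      omega
  have k1 := key w w' fun ha hb h => (hlt ha hb).1 h
  have k2 := key w' w fun ha hb h => (hlt ha hb).2 h
  have hinv : ∀ i : ℕ, i ≤ n → w'.1 ((w⁻¹).1 i) = i := by
    intro i hi
    refine le_antisymm ?_ (k1 i hi)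
    by_contra! hgt
    have hle : |w'.1 ((w⁻¹).1 i)| ≤ n := abs_apply_le _ (abs_apply_le _ (abs_le.2 (by omega)))
    obtain ⟨j, hj⟩ : ∃ j : ℕ, w'.1 ((w⁻¹).1 i) = j := ⟨(w'.1 ((w⁻¹).1 i)).toNat, by omega⟩
    have h3 := k2 j (by rw [hj] at hle; have := (abs_le.1 hle).2; omega)
    rw [← hj, inv_apply_apply, apply_inv_apply] at h3
    omega
  have hinv' : (w⁻¹) = (w'⁻¹) := by
    refine Subtype.ext (Equiv.ext fun a => ?_)
    by_cases ha : |a| ≤ n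
    · rw [abs_le] at ha
      have hnat : ∀ i : ℕ, i ≤ n → (w⁻¹).1 i = (w'⁻¹).1 i := by
        intro i hi
        rw [← hinv i hi, inv_apply_apply, hinv i hi]
      rcases Int.natAbs_eq a with h | h
      · rw [h]
        exact hnat _ (by omega)
      · rw [h, apply_neg, apply_neg, hnat _ (by omega)]
    · rw [(w⁻¹).2.2 a (not_le.1 ha), (w'⁻¹).2.2 a (not_le.1 ha)]
  exact inv_injective hinv'

end SignedPerm

/-! ### Signed permutations obtained by ranking an odd key -/

section rank

variable (n : ℕ) (κ : ℤ → ℤ)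

/-- The number of elements of `{-n, …, n}` with a smaller key. -/
def keyRank (a : ℤ) : ℕ := ((Finset.Icc (-n : ℤ) n).filter fun b => κ b < κ a).card

variable {n κ}

theorem keyRank_lt_keyRank {a b : ℤ} (ha : |a| ≤ n) (h : κ a < κ b) :
    keyRank n κ a < keyRank n κ b := by
  refine Finset.card_lt_card ⟨fun c hc => ?_, fun hsub => ?_⟩
  · rw [Finset.mem_filter] at hc ⊢
    exact ⟨hc.1, hc.2.trans h⟩
  · have := hsub (Finset.mem_filter.2 ⟨Finset.mem_Icc.2 (abs_le.1 ha), h⟩)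
    rw [Finset.mem_filter] at this
    exact this.2.false

/-- Negation matches the elements with key below κ(-a) with those with key above κ(a). Together with
a itself and the elements below it they exhaust the 2n + 1 elements. -/
theorem keyRank_add_keyRank_neg (hodd : ∀ a, κ (-a) = -κ a)
    (hinj : Set.InjOn κ {a | |a| ≤ n}) {a : ℤ} (ha : |a| ≤ n) :
    keyRank n κ a + keyRank n κ (-a) = 2 * n := by
  have h1 : keyRank n κ (-a) = ((Finset.Icc (-n : ℤ) n).filter fun b => κ a < κ b).card := by
    refine Finset.card_bij' (fun b _ => -b) (fun b _ => -b) ?_ ?_ ?_ ?_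
    · intro b hb
      rw [Finset.mem_filter, Finset.mem_Icc] at hb ⊢
      rw [hodd] at hb ⊢
      omega
    · intro b hb
      rw [Finset.mem_filter, Finset.mem_Icc] at hb ⊢
      rw [hodd, hodd]
      omega
    · simp
    · simp
  have ha' : a ∈ Finset.Icc (-n : ℤ) n := Finset.mem_Icc.2 (abs_le.1 ha)
  have h2 : (Finset.Icc (-n : ℤ) n).filter (fun b => ¬ κ b < κ a) =
      insert a ((Finset.Icc (-n : ℤ) n).filter fun b => κ a < κ b) := by
    ext b
    simp only [Finset.mem_filter, Finset.mem_insert, not_lt]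
    constructor
    · rintro ⟨hb, h⟩
      rcases h.lt_or_eq with h | h
      · exact Or.inr ⟨hb, h⟩
      · exact Or.inl (hinj (abs_le.2 (Finset.mem_Icc.1 hb)) ha h.symm)
    · rintro (rfl | ⟨hb, h⟩)
      exacts [⟨ha', le_rfl⟩, ⟨hb, h.le⟩]
  have h3 := Finset.card_filter_add_card_filter_not (s := Finset.Icc (-n : ℤ) n) (fun b => κ b < κ a)
  rw [h2, Finset.card_insert_of_notMem (by simp), Int.card_Icc] at h3
  rw [h1, keyRank]
  omega

/-- The signed permutation ordering `{-n, …, n}` by an odd injective key. -/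
theorem exists_signedPerm_of_key (hodd : ∀ a, κ (-a) = -κ a)
    (hinj : Set.InjOn κ {a | |a| ≤ n}) :
    ∃ w : SignedPerm n, ∀ a b : ℤ, |a| ≤ n → |b| ≤ n → (w.1 a < w.1 b ↔ κ a < κ b) := by
  -- Ranks run from 0 to 2n; subtracting n centers them and makes g odd.
  set g : ℤ → ℤ := fun a => if |a| ≤ n then keyRank n κ a - n else a with hg
  have hgS : ∀ a : ℤ, |a| ≤ n → g a = keyRank n κ a - n := fun a ha => if_pos ha
  have hmaps : ∀ a : ℤ, |a| ≤ n → |g a| ≤ n := by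
    intro a ha
    have := keyRank_add_keyRank_neg hodd hinj ha
    rw [hgS a ha, abs_le]
    omega
  have hlt : ∀ a b : ℤ, |a| ≤ n → |b| ≤ n → κ a < κ b → g a < g b := by
    intro a b ha hb h
    have := keyRank_lt_keyRank ha h
    rw [hgS a ha, hgS b hb]
    omega
  have hgi : ∀ a b : ℤ, |a| ≤ n → |b| ≤ n → g a = g b → a = b := by
    intro a b ha hb h
    refine hinj ha hb ?_
    rcases lt_trichotomy (κ a) (κ b) with h1 | h1 | h1
    · exact absurd h (hlt a b ha hb h1).ne
    · exact h1
    · exact absurd h (hlt b a hb ha h1).ne'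
  have hbij : Function.Bijective g := by
    constructor
    · intro a b h
      by_cases ha : |a| ≤ n <;> by_cases hb : |b| ≤ n
      · exact hgi a b ha hb h
      · have := hmaps a ha
        rw [h, hg] at this
        simp only [if_neg hb] at this
        exact absurd this hb
      · have := hmaps b hb
        rw [← h, hg] at this
        simp only [if_neg ha] at this
        exact absurd this ha
      · simpa only [hg, if_neg ha, if_neg hb] using h
    · intro c
      by_cases hc : |c| ≤ n
      · have hs := Finset.surjOn_of_injOn_of_card_le (s := Finset.Icc (-n : ℤ) n)
          (t := Finset.Icc (-n : ℤ) n) g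
          (fun a ha => Finset.mem_coe.2 (Finset.mem_Icc.2 (abs_le.1 (hmaps a
            (abs_le.2 (Finset.mem_Icc.1 (Finset.mem_coe.1 ha)))))))
          (fun a ha b hb h => hgi a b (abs_le.2 (Finset.mem_Icc.1 (Finset.mem_coe.1 ha)))
            (abs_le.2 (Finset.mem_Icc.1 (Finset.mem_coe.1 hb))) h) le_rfl
        obtain ⟨a, -, ha⟩ := hs (Finset.mem_coe.2 (Finset.mem_Icc.2 (abs_le.1 hc)))
        exact ⟨a, ha⟩
      · exact ⟨c, if_neg hc⟩
  refine ⟨⟨Equiv.ofBijective g hbij, fun a => ?_, fun a ha => if_neg ha.not_ge⟩, fun a b ha hb => ?_⟩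
  · change g (-a) = -g a
    by_cases ha : |a| ≤ n
    · have := keyRank_add_keyRank_neg hodd hinj ha
      rw [hgS a ha, hgS (-a) (by rwa [abs_neg])]
      omega
    · rw [hg]
      simp only [abs_neg, if_neg ha]
  · change g a < g b ↔ κ a < κ b
    refine ⟨fun h => ?_, hlt a b ha hb⟩
    rcases lt_trichotomy (κ a) (κ b) with h1 | h1 | h1
    · exact h1
    · rw [hinj ha hb h1] at h
      exact absurd h (lt_irrefl _)
    · exact absurd h (hlt b a hb ha h1).not_gt

end rank

/-- Two weakly increasing functions on `{-n, …, n}` with the same values are equal. -/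
theorem eq_of_monotone_of_map_eq {n : ℕ} {f g : ℤ → ℤ}
    (hf : ∀ a b : ℤ, |a| ≤ n → |b| ≤ n → a ≤ b → f a ≤ f b)
    (hg : ∀ a b : ℤ, |a| ≤ n → |b| ≤ n → a ≤ b → g a ≤ g b)
    (h : (Finset.Icc (-n : ℤ) n).val.map f = (Finset.Icc (-n : ℤ) n).val.map g) {a : ℤ}
    (ha : |a| ≤ n) : f a = g a := by
  set L := (Finset.Icc (-n : ℤ) n).sort (· ≤ ·) with hL
  have hmem : ∀ a, a ∈ L ↔ |a| ≤ n := by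
    intro a
    rw [hL, Finset.mem_sort, Finset.mem_Icc, abs_le]
  have hsort : ∀ f : ℤ → ℤ, (∀ a b : ℤ, |a| ≤ n → |b| ≤ n → a ≤ b → f a ≤ f b) →
      (L.map f).Pairwise (· ≤ ·) := by
    intro f hf
    rw [List.pairwise_map]
    exact (Finset.pairwise_sort _ _).imp_of_mem fun ha hb hab =>
      hf _ _ ((hmem _).1 ha) ((hmem _).1 hb) hab
  have hperm : (L.map f).Perm (L.map g) := by
    rw [← Multiset.coe_eq_coe, ← Multiset.map_coe, ← Multiset.map_coe, hL, Finset.sort_eq, h]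
  have heq := hperm.eq_of_pairwise (fun _ _ _ _ h h' => le_antisymm h h') (hsort f hf) (hsort g hg)
  exact List.map_inj_left.1 heq a ((hmem a).2 ha)

/-- The odd extension of a word. -/
def oddLetter (u : List ℤ) (a : ℤ) : ℤ := if 0 ≤ a then letter u a.toNat else -letter u (-a).toNat

theorem oddLetter_natCast (u : List ℤ) (i : ℕ) : oddLetter u i = letter u i := by
  simp [oddLetter]

theorem oddLetter_neg (u : List ℤ) (a : ℤ) : oddLetter u (-a) = -oddLetter u a := by
  rcases lt_trichotomy a 0 with h | rfl | h
  · rw [oddLetter, oddLetter, if_pos (by omega), if_neg (by omega), neg_neg]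
  · simp [oddLetter]
  · rw [oddLetter, oddLetter, if_neg (by omega), if_pos (by omega), neg_neg]

/-- Inverse standardization: extend the word to an odd function, sort the positions -n, …, n by
letter and then by position, and let w(a) be the centered rank of a. -/
theorem SignedPerm.exists_toWord_eq (α : PseudoComp) {u : List ℤ} (hu : content u = canon α) :
    ∃ w : SignedPerm α.size, SignedPerm.descents w⁻¹ ⊆ α.descents ∧
      SignedPerm.toWord α.descents w = u := by
  set n := α.size with hn
  have hlen : u.length = n := by rw [← length_eq_degree_content, hu, degree_canon]
  -- Two positions differ by at most 2n, so the factor 2n + 1 makes this key compare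
  -- lexicographically by letter, then position.
  set κ : ℤ → ℤ := fun a => oddLetter u a * (2 * n + 1) + a with hκ
  have hodd : ∀ a, κ (-a) = -κ a := by
    intro a
    simp only [hκ, oddLetter_neg]
    ring
  have hinj : Set.InjOn κ {a | |a| ≤ n} := by
    intro a ha b hb h
    have ha' := abs_le.1 (show |a| ≤ (n : ℤ) from ha)
    have hb' := abs_le.1 (show |b| ≤ (n : ℤ) from hb)
    have h1 : (2 * (n : ℤ) + 1) ∣ b - a := ⟨oddLetter u a - oddLetter u b, by
      simp only [hκ] at h
      linear_combination -h⟩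
    have h2 := Int.eq_zero_of_abs_lt_dvd h1 (by rw [abs_lt]; omega)
    omega
  have hκle : ∀ a b : ℤ, |a| ≤ n → |b| ≤ n → κ a ≤ κ b → oddLetter u a ≤ oddLetter u b := by
    intro a b ha hb h
    rw [abs_le] at ha hb
    by_contra! hlt
    simp only [hκ] at h
    have h1 : (oddLetter u b + 1) * (2 * (n : ℤ) + 1) ≤ oddLetter u a * (2 * n + 1) :=
      mul_le_mul_of_nonneg_right hlt (by omega)
    rw [add_mul, one_mul] at h1
    omega
  obtain ⟨w, hw⟩ := exists_signedPerm_of_key hodd hinj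
  have hmono : ∀ a b : ℤ, |a| ≤ n → |b| ≤ n → a ≤ b →
      oddLetter u ((w⁻¹).1 a) ≤ oddLetter u ((w⁻¹).1 b) := by
    intro a b ha hb hab
    refine hκle _ _ (abs_apply_le _ ha) (abs_apply_le _ hb) ?_
    by_contra! hlt
    rw [← hw _ _ (abs_apply_le _ hb) (abs_apply_le _ ha), apply_inv_apply, apply_inv_apply] at hlt
    omega
  have hvals : (Finset.Icc (-n : ℤ) n).val.map (fun a => oddLetter u ((w⁻¹).1 a)) =
      (Finset.Icc (-n : ℤ) n).val.map (oddLevel α.descents) := by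
    have h1 : (Finset.Icc (-n : ℤ) n).val.map (fun a => (w⁻¹).1 a) = (Finset.Icc (-n : ℤ) n).val := by
      have h2 : (Finset.Icc (-n : ℤ) n).map (w⁻¹).1.toEmbedding = Finset.Icc (-n : ℤ) n := by
        refine Finset.eq_of_subset_of_card_le ?_ (by rw [Finset.card_map])
        intro a ha
        obtain ⟨b, hb, rfl⟩ := Finset.mem_map.1 ha
        exact Finset.mem_Icc.2 (abs_le.1 (abs_apply_le _ (abs_le.2 (Finset.mem_Icc.1 hb))))
      exact congrArg Finset.val h2
    have h3 : (Finset.Icc (-n : ℤ) n).val.map (fun a => oddLetter u ((w⁻¹).1 a)) =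
        ((Finset.Icc (-n : ℤ) n).val.map (fun a => (w⁻¹).1 a)).map (oddLetter u) := by
      rw [Multiset.map_map]
      rfl
    rw [h3, h1, map_Icc_of_odd n _ (oddLetter_neg u), map_Icc_of_odd n _ (oddLevel_neg _)]
    congr 2
    refine map_val_eq_of_sum_single ?_
    rw [content_eq_sum, canon_eq_sum, hlen, ← hn] at hu
    refine Eq.trans (Finset.sum_congr rfl fun i _ => ?_) (hu.trans (Finset.sum_congr rfl fun i _ => ?_))
    · rw [← oddLetter_natCast]
      push_cast
      rfl
    · rw [natAbs_oddLevel]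
      rfl
  -- Listed in the order given by w, the letters increase weakly, and so do the levels. They form
  -- the same multiset, hence agree termwise.
  have hval : ∀ a : ℤ, |a| ≤ n → oddLetter u ((w⁻¹).1 a) = oddLevel α.descents a :=
    fun a ha => eq_of_monotone_of_map_eq hmono
      (fun a b _ _ hab => oddLevel_monotone _ hab) hvals ha
  refine ⟨w, fun i hi => ?_, ?_⟩
  · obtain ⟨hin, hlt⟩ := mem_descents.1 hi
    by_contra hiD
    -- If i is outside D(α), the letters at w⁻¹(i) and w⁻¹(i+1) coincide, so the tie-break puts
    -- w⁻¹(i) first and i is no descent of w⁻¹.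
    have h1 := oddLevel_add_one_natCast α.descents i
    rw [if_neg hiD, add_zero, ← hval _ (abs_le.2 (by omega)), ← hval _ (abs_le.2 (by omega))] at h1
    have h2 := hw ((w⁻¹).1 i) ((w⁻¹).1 ((i : ℤ) + 1)) (abs_apply_le _ (abs_le.2 (by omega)))
      (abs_apply_le _ (abs_le.2 (by omega)))
    rw [apply_inv_apply, apply_inv_apply] at h2
    have h3 := h2.1 (by omega)
    simp only [hκ, h1] at h3
    omega
  · refine List.ext_getElem (by rw [length_toWord, hlen]) fun i h1 h2 => ?_
    rw [hlen] at h2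
    have h3 := letter_toWord α.descents w (Nat.succ_le_of_lt h2)
    have h4 := hval (w.1 ((i + 1 : ℕ) : ℤ)) (abs_apply_le _ (abs_le.2 (by omega)))
    rw [inv_apply_apply, oddLetter_natCast] at h4
    rw [← h4, letter_succ, letter_succ, List.getD_eq_getElem _ _ h1,
      List.getD_eq_getElem _ _ (by omega)] at h3
    exact h3

/-- The coefficients of `hᴮ_β` count signed permutations. -/
theorem coeff_canon_hB_eq_card {α β : PseudoComp} (h : α.size = β.size) :
    coeff (canon α) (hB β) = (Nat.card {w : SignedPerm α.size //
      SignedPerm.descents w⁻¹ ⊆ α.descents ∧ SignedPerm.descents w ⊆ β.descents} : ℤ) := by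
  rw [coeff_canon_hB α β h]
  congr 1
  symm
  refine Nat.card_eq_of_bijective (fun w => ⟨SignedPerm.toWord α.descents w.1,
    SignedPerm.content_toWord α w.1,
    (SignedPerm.wordDescents_toWord w.2.1).subset.trans w.2.2⟩) ⟨?_, ?_⟩
  · rintro ⟨w, hw⟩ ⟨w', hw'⟩ heq
    exact Subtype.ext (SignedPerm.toWord_injective hw.1 hw'.1 (congrArg Subtype.val heq))
  · rintro ⟨u, hu, hu'⟩
    obtain ⟨w, hw, rfl⟩ := SignedPerm.exists_toWord_eq α hu
    exact ⟨⟨w, hw, (SignedPerm.wordDescents_toWord hw).symm.subset.trans hu'⟩, rfl⟩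

/-! ### The bilinear form -/

instance (n : ℕ) : Finite (SignedPerm n) := by
  have hmem : ∀ (w : SignedPerm n) (a : Finset.Icc (-n : ℤ) n), w.1 a ∈ Finset.Icc (-n : ℤ) n :=
    fun w a => Finset.mem_Icc.2 (abs_le.1 (SignedPerm.abs_apply_le w
      (abs_le.2 (Finset.mem_Icc.1 a.2))))
  refine Finite.of_injective (fun w : SignedPerm n => fun a : Finset.Icc (-n : ℤ) n =>
    (⟨w.1 a, hmem w a⟩ : Finset.Icc (-n : ℤ) n)) fun w w' h => ?_
  refine Subtype.ext (Equiv.ext fun a => ?_)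
  by_cases ha : |a| ≤ n
  · exact congrArg Subtype.val (congrFun h ⟨a, Finset.mem_Icc.2 (abs_le.1 ha)⟩)
  · rw [w.2.2 a (not_le.1 ha), w'.2.2 a (not_le.1 ha)]

theorem formCoeff_eq {n : ℕ} {α β : PseudoComp} (hα : α.size = n) (hβ : β.size = n) :
    formCoeff α β = Nat.card {w : SignedPerm n // SignedPerm.descents w⁻¹ = α.descents ∧
      SignedPerm.descents w = β.descents} := by
  subst hβ
  rw [formCoeff, if_pos hα]

theorem formCoeff_comm (α β : PseudoComp) : formCoeff α β = formCoeff β α := by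
  by_cases h : α.size = β.size
  · rw [formCoeff_eq h rfl, formCoeff_eq (α := β) rfl h]
    refine Nat.card_congr ((Equiv.inv (SignedPerm β.size)).subtypeEquiv fun w => ?_)
    rw [Equiv.inv_apply, inv_inv, and_comm]
  · rw [formCoeff, formCoeff, if_neg h, if_neg fun h' => h h'.symm]

/-- The finite set of pseudo-compositions coarser than `α`. -/
def coarserFinset (α : PseudoComp) : Finset PseudoComp :=
  Set.Finite.toFinset (s := {β : PseudoComp | β.Coarser α})
    ((PseudoComp.finite_size_le α.size).subset fun _ h => h.1.le)

theorem mem_coarserFinset {α β : PseudoComp} : β ∈ coarserFinset α ↔ β.Coarser α := by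
  simp [coarserFinset]

/-- For fixed size n, pseudo-compositions correspond to subsets of {0, …, n-1} through their descent
sets. -/
theorem sum_coarserFinset {M : Type*} [AddCommMonoid M] (α : PseudoComp) (f : Finset ℕ → M) :
    ∑ β ∈ coarserFinset α, f β.descents = ∑ S ∈ α.descents.powerset, f S := by
  refine Finset.sum_nbij PseudoComp.descents ?_ ?_ ?_ fun _ _ => rfl
  · intro β hβ
    exact Finset.mem_powerset.2 (mem_coarserFinset.1 hβ).2
  · intro β hβ γ hγ h
    exact PseudoComp.eq_of_size_of_descents ((mem_coarserFinset.1 hβ).1.trans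
      (mem_coarserFinset.1 hγ).1.symm) h
  · intro S hS
    have hS' := Finset.mem_powerset.1 (Finset.mem_coe.1 hS)
    obtain ⟨β, h1, h2⟩ := PseudoComp.exists_of_descents α.size S
      (hS'.trans α.descents_subset_range)
    exact ⟨β, mem_coarserFinset.2 ⟨h1, h2 ▸ hS'⟩, h2⟩

/-- Möbius inversion on the Boolean lattice: for T ⊆ D, complementing S in D leaves the alternating
sum over all subsets of D \ T. -/
theorem sum_powerset_alternating {R : Type*} [CommRing R] (D T : Finset ℕ) :
    ∑ S ∈ D.powerset, (-1 : R) ^ (D.card - S.card) * (if T ⊆ S then 1 else 0) =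
      if T = D then 1 else 0 := by
  by_cases hT : T ⊆ D
  · have h1 : ∑ S ∈ D.powerset, (-1 : R) ^ (D.card - S.card) * (if T ⊆ S then 1 else 0) =
        ∑ S ∈ (D \ T).powerset, (-1 : R) ^ S.card := by
      simp only [mul_ite, mul_one, mul_zero]
      rw [← Finset.sum_filter]
      refine Finset.sum_bij' (fun S _ => D \ S) (fun S _ => D \ S) ?_ ?_ ?_ ?_ ?_
      · intro S hS
        rw [Finset.mem_filter, Finset.mem_powerset] at hS
        exact Finset.mem_powerset.2 (Finset.sdiff_subset_sdiff subset_rfl hS.2)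
      · intro S hS
        rw [Finset.mem_powerset] at hS
        refine Finset.mem_filter.2 ⟨Finset.mem_powerset.2 Finset.sdiff_subset, fun t ht => ?_⟩
        exact Finset.mem_sdiff.2 ⟨hT ht, fun h => (Finset.mem_sdiff.1 (hS h)).2 ht⟩
      · intro S hS
        rw [Finset.mem_filter, Finset.mem_powerset] at hS
        exact Finset.sdiff_sdiff_eq_self hS.1
      · intro S hS
        rw [Finset.mem_powerset] at hS
        exact Finset.sdiff_sdiff_eq_self (hS.trans Finset.sdiff_subset)
      · intro S hS
        rw [Finset.mem_filter, Finset.mem_powerset] at hS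
        rw [Finset.card_sdiff_of_subset hS.1]
    have h2 := congrArg (Int.cast : ℤ → R) (Finset.sum_powerset_neg_one_pow_card (x := D \ T))
    push_cast at h2
    rw [h1, h2]
    refine if_congr ?_ rfl rfl
    rw [Finset.sdiff_eq_empty_iff_subset]
    exact ⟨fun h => hT.antisymm h, fun h => h.ge⟩
  · rw [if_neg fun h => hT h.subset]
    refine Finset.sum_eq_zero fun S hS => ?_
    rw [if_neg fun h => hT (h.trans (Finset.mem_powerset.1 hS)), mul_zero]

theorem sum_ite_mul_ite {ι R : Type*} [Fintype ι] [CommSemiring R] (p q : ι → Prop)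
    [DecidablePred p] [DecidablePred q] :
    ∑ i, (if p i then (1 : R) else 0) * (if q i then 1 else 0) =
      (Nat.card {i // p i ∧ q i} : R) := by
  rw [Nat.card_eq_fintype_card, Fintype.card_subtype, ← Finset.sum_boole]
  refine Finset.sum_congr rfl fun i _ => ?_
  rw [mul_ite, mul_one, mul_zero, ← ite_and]
  exact if_congr and_comm rfl rfl

section form

variable (K : Type*) [Field K]

/-- The element `hᴮ_α` of `Symᴮ_K`. -/
def hExt (α : PseudoComp) : extended K SymB :=
  ⟨hBOver K α, by rw [extended_symB]; exact Submodule.subset_span ⟨α, rfl⟩⟩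

theorem coarser_length_sub {α β : PseudoComp} :
    α.length - β.length = α.descents.card - β.descents.card := by
  rw [PseudoComp.length_eq, PseudoComp.length_eq]
  omega

theorem toExtended_sB (α : PseudoComp) : toExtended K (sB α) =
    ∑ β ∈ coarserFinset α, (-1 : K) ^ (α.descents.card - β.descents.card) • hExt K β := by
  refine Subtype.ext ?_
  rw [AddSubmonoidClass.coe_finsetSum]
  change scalarExt K SymB (1 ⊗ₜ sB α) = ∑ β ∈ coarserFinset α,
    (-1 : K) ^ (α.descents.card - β.descents.card) • hBOver K β
  rw [scalarExt_tmul, one_smul]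
  have h1 : (sB α).1 = ∑ β ∈ coarserFinset α,
      (-1 : ℤ) ^ (α.descents.card - β.descents.card) • hB β := by
    change chiB (ncSBComp α) = _
    rw [ncSBComp, finsum_mem_eq_finite_toFinset_sum _
      ((PseudoComp.finite_size_le α.size).subset fun _ h => h.1.le), map_sum]
    refine Finset.sum_congr rfl fun β _ => ?_
    rw [map_smul, coarser_length_sub]
    rfl
  rw [h1, map_sum]
  refine Finset.sum_congr rfl fun β _ => ?_
  rw [map_zsmul, map_hB, ← Int.cast_smul_eq_zsmul K]
  push_cast
  rfl

variable [CharZero K]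

theorem hExt_eq (α : PseudoComp) : hExt K α = hBasisExt K α.toPart :=
  Subtype.ext (by rw [hBasisExt_apply, hBOver_toPart]; rfl)

/-- The bilinear form on `Symᴮ_K` for which `hᴮ_λ` and `mᴮ_λ` are dual bases. -/
def symForm : LinearMap.BilinForm K (extended K SymB) :=
  (hBasisExt K).constr K fun l => (MvPowerSeries.coeff (canon l.1)) ∘ₗ (extended K SymB).subtype

theorem symForm_hBasisExt (l : PseudoPart) (f : extended K SymB) :
    symForm K (hBasisExt K l) f = coeff (canon l.1) f.1 := by
  rw [symForm, Module.Basis.constr_basis]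
  rfl

/-- The coefficients of a symmetric series depend only on the shape, so the defining formula passes
from pseudo-partitions to all pseudo-compositions. -/
theorem symForm_hExt (α : PseudoComp) (f : extended K SymB) :
    symForm K (hExt K α) f = coeff (canon α) f.1 := by
  rw [hExt_eq, symForm_hBasisExt]
  have hf : f.1 ∈ symAlg K := (extended_symB_eq_symAlg K).le f.2
  exact coeff_eq_of_shape_eq hf (by rw [shape_canon, shape_canon, PseudoComp.toPart_val])

theorem symForm_hExt_hExt_of_ne {α β : PseudoComp} (h : α.size ≠ β.size) :
    symForm K (hExt K α) (hExt K β) = 0 := by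
  rw [symForm_hExt]
  exact coeff_hBOver_of_degree_ne β _ (by rwa [degree_canon])

theorem symForm_hExt_hExt {n : ℕ} [Fintype (SignedPerm n)] {α β : PseudoComp} (hα : α.size = n)
    (hβ : β.size = n) : symForm K (hExt K α) (hExt K β) = ∑ w : SignedPerm n,
      (if SignedPerm.descents w⁻¹ ⊆ α.descents then 1 else 0) *
        (if SignedPerm.descents w ⊆ β.descents then 1 else 0) := by
  subst hα
  rw [symForm_hExt]
  change coeff (canon α) (hBOver K β) = _
  rw [← map_hB, coeff_map, coeff_canon_hB_eq_card hβ.symm]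
  rw [sum_ite_mul_ite]
  simp only [eq_intCast, Int.cast_natCast]

/-- For each w the double sum factors into one sum for D(w⁻¹) and one for D(w), and
inclusion-exclusion replaces each inclusion by an equality. -/
theorem isSymBForm_symForm : IsSymBForm K (symForm K) := by
  intro α β
  rw [toExtended_sB, toExtended_sB]
  simp only [map_sum, LinearMap.sum_apply, map_smul, LinearMap.smul_apply, smul_eq_mul]
  by_cases h : α.size = β.size
  · have := Fintype.ofFinite (SignedPerm β.size)
    rw [formCoeff_eq h rfl]
    have h1 : ∀ α' ∈ coarserFinset α, ∀ β' ∈ coarserFinset β,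
        symForm K (hExt K α') (hExt K β') = ∑ w : SignedPerm β.size,
          (if SignedPerm.descents w⁻¹ ⊆ α'.descents then 1 else 0) *
            (if SignedPerm.descents w ⊆ β'.descents then 1 else 0) := by
      intro α' hα' β' hβ'
      exact symForm_hExt_hExt K ((mem_coarserFinset.1 hα').1.trans h) (mem_coarserFinset.1 hβ').1
    have h2 : ∀ (γ : PseudoComp) (T : Finset ℕ), ∑ γ' ∈ coarserFinset γ,
        (-1 : K) ^ (γ.descents.card - γ'.descents.card) * (if T ⊆ γ'.descents then 1 else 0) =
          if T = γ.descents then 1 else 0 := by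
      intro γ T
      rw [sum_coarserFinset γ fun S => (-1 : K) ^ (γ.descents.card - S.card) *
        (if T ⊆ S then 1 else 0), sum_powerset_alternating]
    calc _ = ∑ β' ∈ coarserFinset β, (-1 : K) ^ (β.descents.card - β'.descents.card) *
          ∑ α' ∈ coarserFinset α, (-1 : K) ^ (α.descents.card - α'.descents.card) *
          ∑ w : SignedPerm β.size, (if SignedPerm.descents w⁻¹ ⊆ α'.descents then (1 : K) else 0) *
            (if SignedPerm.descents w ⊆ β'.descents then 1 else 0) := by
          refine Finset.sum_congr rfl fun β' hβ' => ?_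
          congr 1
          exact Finset.sum_congr rfl fun α' hα' => by rw [h1 α' hα' β' hβ']
      _ = ∑ w : SignedPerm β.size, (∑ α' ∈ coarserFinset α,
            (-1 : K) ^ (α.descents.card - α'.descents.card) *
              (if SignedPerm.descents w⁻¹ ⊆ α'.descents then (1 : K) else 0)) *
          ∑ β' ∈ coarserFinset β, (-1 : K) ^ (β.descents.card - β'.descents.card) *
            (if SignedPerm.descents w ⊆ β'.descents then 1 else 0) := by
          simp only [Finset.mul_sum, Finset.sum_mul]
          rw [Finset.sum_comm (s := Finset.univ)]
          refine Finset.sum_congr rfl fun β' _ => ?_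
          rw [Finset.sum_comm (s := Finset.univ)]
          exact Finset.sum_congr rfl fun α' _ => Finset.sum_congr rfl fun w _ => by ring
      _ = _ := by
          simp only [h2]
          rw [sum_ite_mul_ite]
  · rw [formCoeff, if_neg h, Nat.cast_zero]
    refine Finset.sum_eq_zero fun β' hβ' => ?_
    rw [Finset.sum_eq_zero, mul_zero]
    intro α' hα'
    rw [symForm_hExt_hExt_of_ne, mul_zero]
    rwa [(mem_coarserFinset.1 hα').1, (mem_coarserFinset.1 hβ').1]

/-- The sᴮ are unitriangular in the hᴮ with respect to the number of descents. -/
theorem span_toExtended_sB :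
    Submodule.span K (Set.range fun α => toExtended K (sB α)) = ⊤ := by
  set M := Submodule.span K (Set.range fun α => toExtended K (sB α))
  have key : ∀ (n : ℕ) (α : PseudoComp), α.descents.card = n → hExt K α ∈ M := by
    intro n
    induction n using Nat.strong_induction_on with
    | _ n ih =>
      intro α hα
      have hmem : α ∈ coarserFinset α := mem_coarserFinset.2 ⟨rfl, subset_rfl⟩
      have h := toExtended_sB K α
      rw [← Finset.add_sum_erase _ _ hmem, Nat.sub_self, pow_zero, one_smul,
        ← sub_eq_iff_eq_add] at h
      rw [← h]
      refine Submodule.sub_mem _ (Submodule.subset_span ⟨α, rfl⟩)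
        (Submodule.sum_mem _ fun β hβ => Submodule.smul_mem _ _ (ih β.descents.card ?_ β rfl))
      rw [Finset.mem_erase, mem_coarserFinset] at hβ
      rw [← hα]
      refine Finset.card_lt_card (hβ.2.2.ssubset_of_ne fun heq => hβ.1 ?_)
      exact PseudoComp.eq_of_size_of_descents hβ.2.1 heq
  rw [eq_top_iff, ← (hBasisExt K).span_eq, Submodule.span_le]
  rintro _ ⟨l, rfl⟩
  have := key _ l.1 rfl
  rwa [hExt_eq, PseudoComp.toPart_val] at this

variable {K} in
theorem IsSymBForm.eq {B B' : LinearMap.BilinForm K (extended K SymB)} (hB : IsSymBForm K B)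
    (hB' : IsSymBForm K B') : B = B' := by
  refine LinearMap.ext_on (span_toExtended_sB K) ?_
  rintro _ ⟨α, rfl⟩
  refine LinearMap.ext_on (span_toExtended_sB K) ?_
  rintro _ ⟨β, rfl⟩
  exact (hB α β).trans (hB' α β).symm

/-- The flipped form has the same values on the sᴮ, by w ↦ w⁻¹, so uniqueness applies. -/
theorem symForm_isSymm : (symForm K).IsSymm := by
  have h : IsSymBForm K (symForm K).flip := by
    intro α β
    rw [formCoeff_comm]
    exact isSymBForm_symForm K β α
  have h2 := (isSymBForm_symForm K).eq h
  refine ⟨fun x y => ?_⟩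
  conv_lhs => rw [h2]
  rfl

theorem symForm_dual (l l' : PseudoPart) :
    symForm K (hBasisExt K l) (mBasisExt K l') = if l = l' then 1 else 0 := by
  rw [symForm_hBasisExt, mBasisExt_apply, coeff_mOver, shape_canon_part]

/-- Pairing with mᴮ_λ reads off the coordinate at hᴮ_λ, so the left kernel vanishes; symmetry
handles the right one. -/
theorem symForm_nondegenerate : (symForm K).Nondegenerate := by
  have h1 : ∀ (l : PseudoPart) (x : extended K SymB),
      symForm K x (mBasisExt K l) = (hBasisExt K).repr x l := by
    intro l x
    have : (symForm K).flip (mBasisExt K l) = (hBasisExt K).coord l := by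
      refine (hBasisExt K).ext fun l' => ?_
      rw [Module.Basis.coord_apply, Module.Basis.repr_self, Finsupp.single_apply]
      exact symForm_dual K l' l
    exact LinearMap.congr_fun this x
  have h2 : (symForm K).SeparatingLeft := by
    intro x hx
    apply (hBasisExt K).repr.injective
    ext l
    rw [← h1, hx, map_zero]
    rfl
  refine ⟨h2, fun y hy => h2 y fun x => ?_⟩
  rw [(symForm_isSymm K).eq, hy]

end form

end TypeB

end

theorem mainTheorem10 :
    -- `hᴮ_λ` is well defined
    (∀ (l : PseudoPart) (α : PseudoComp), α.toPart = l → hB α = hB l.1) ∧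
    -- the `hᴮ_λ` form a free `ℤ`-basis of `Symᴮ`
    (∃ b : Module.Basis PseudoPart ℤ SymB,
      ∀ l : PseudoPart, (b l : MvPowerSeries ℕ ℤ) = hB l.1) ∧
    -- `Symᴮ ⊊ ℤ[x₀] · Sym ≅ ℤ[x₀] ⊗ Sym`
    SymB < polyMul ℤ SymF ∧
    Function.Injective (tensorMul ℤ SymF) ∧
    LinearMap.range (tensorMul ℤ SymF) = polyMul ℤ SymF ∧
    ∀ (K : Type*) [Field K] [CharZero K],
      -- `Symᴮ_K` and `Sym_K` are the extensions of scalars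
      Function.Injective (scalarExt K SymB) ∧
      Function.Injective (scalarExt K SymF) ∧
      -- `Symᴮ_K = K[x₀] · Sym_K ≅ K[x₀] ⊗ Sym_K`
      extended K SymB = polyMul K (extended K SymF) ∧
      Function.Injective (tensorMul K (extended K SymF)) ∧
      LinearMap.range (tensorMul K (extended K SymF)) = polyMul K (extended K SymF) ∧
      -- dual bases with respect to the nondegenerate symmetric bilinear form
      ∃ h m : Module.Basis PseudoPart K (extended K SymB),
        (∀ l : PseudoPart, (h l : MvPowerSeries ℕ K) =
          MvPowerSeries.map (Int.castRingHom K) (hB l.1)) ∧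
        (∀ l : PseudoPart, (m l : MvPowerSeries ℕ K) =
          MvPowerSeries.map (Int.castRingHom K) (mB l)) ∧
        ∃ B : LinearMap.BilinForm K (extended K SymB),
          IsSymBForm K B ∧ (∀ B', IsSymBForm K B' → B' = B) ∧
          B.IsSymm ∧ B.Nondegenerate ∧
          (∀ l : PseudoPart, B (h l) (m l) = 1) ∧
          ∀ l l' : PseudoPart, l ≠ l' → B (h l) (m l') = 0 := by
  have hF : SymF ≤ Subalgebra.toSubmodule (symAlg ℤ) := by
    rw [symF_eq]
    exact posAlg_le_symAlg ℤ
  have hSB : SymB ≤ Subalgebra.toSubmodule (symAlg ℤ) := by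
    refine symB_le_polyMul.trans ?_
    rw [symF_eq]
    exact polyMul_posAlg_le ℤ
  refine ⟨?_, ⟨hBasisInt, hBasisInt_apply⟩, symB_lt_polyMul, ?_, range_tensorMul ℤ SymF, ?_⟩
  · rintro _ α rfl
    rw [hB_eq, hB_eq, hBOver_toPart]
  · refine tensorMul_injective ℤ SymF fun f hf => ?_
    rw [symF_eq] at hf
    exact coeff_posAlg_eq_zero ℤ hf
  intro K _ _
  refine ⟨scalarExt_injective K hSB, scalarExt_injective K hF, extended_symB_eq_polyMul K, ?_,
    range_tensorMul K _, hBasisExt K, mBasisExt K, ?_, ?_, symForm K, isSymBForm_symForm K,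
    fun B' hB' => hB'.eq (isSymBForm_symForm K), symForm_isSymm K, symForm_nondegenerate K, ?_, ?_⟩
  · refine tensorMul_injective K _ fun f hf => ?_
    rw [extended_symF] at hf
    exact coeff_posAlg_eq_zero K hf
  · intro l
    rw [hBasisExt_apply, map_hB]
  · intro l
    rw [mBasisExt_apply, map_mB]
  · intro l
    rw [symForm_dual, if_pos rfl]
  · intro l l' h
    rw [symForm_dual, if_neg h]
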